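/- **Setting.** Fix a relational vocabulary (predicate symbols with arities, and constants). Formulas are first-order formulas built with $\bot,\top,=,\neg,\wedge,\vee,\forall,\exists$. An occurrence of a predicate is *positive* if it is under an even number of negations, otherwise *negative*. An *axiom* $P(\vec x)\leftarrow\varphi(\vec x)$ consists of a head atom whose arguments $\vec x$ are distinct variables and a body whose free variables are among $\vec x$; it *affects* $P$. A *stratified axiom program* is a finite sequence $\mathscr P=(\Pi_1,\dots,\Pi_n)$ of finite sets of axioms (strata) such that for every axiom $P(\vec x)\leftarrow\varphi$ in $\Pi_i$: $P$ is not affected by any $\Pi_k$ with $k\ne i$; $P$ does not occur in any $\Pi_k$ with $k<i$; a predicate that occurs positively in $\varphi$ is affected only by strata $\Pi_j$ with $j\le i$; a predicate that occurs negatively in $\varphi$ is affected only by strata $\Pi_j$ with $j<i$. The *derived* predicates are those affected by some axiom, the others are *basic*. For a finite set of objects and a basic state (an interpretation of the basic predicates), the *extended state* is computed by first making all atoms of derived predicates false and then, for $i=1,\dots,n$, repeating the following as long as possible: choose an axiom of $\Pi_i$ and objects for its variables such that the body is true and the head is false, and make the head true. **Stage axioms.** Let $P_1,\dots,P_m$ be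 the predicates affected by a stratum $\Pi_\ell$, and let $\varphi_i$ be the disjunction of the bodies of all axioms of $\Pi_\ell$ with head $P_i$ (with variables renamed to agree). For $1\le i,j\le m$ let $\prec_{ij},\preceq_{ij},\nprec_{ij},\npreceq_{ij},\triangleleft_{ij}$ be new predicates, whose arity is the sum of the arities of $P_i$ and $P_j$, and let $\mathrm{none}_\ell$ (nullary) and $\mathrm{fix}_i$ (with the arity of $P_i$) be new predicates. Write $\varphi[\prec_j\vec y]$, $\varphi[\preceq_j\vec y]$, $\varphi[\neg\nprec_j\vec y]$, $\varphi[\neg\npreceq_j\vec y]$, $\varphi[\bot]$ for the result of replacing each atom $P_k(\vec z)$, $1\le k\le m$, in $\varphi$ by $\vec z\prec_{kj}\vec y$, $\vec z\preceq_{kj}\vec y$, $\neg\,\vec z\nprec_{kj}\vec y$, $\neg\,\vec z\npreceq_{kj}\vec y$, $\bot$, respectively. The *stage axioms* of $\Pi_\ell$ are, for all $i,j$, $$\begin{aligned} \vec x\prec_{ij}\vec y&\leftarrow\textstyle\bigvee_k\exists\vec z\,(\vec x\preceq_{ik}\vec z\wedge\vec z\triangleleft_{kj}\vec y),\\ \vec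 x\preceq_{ij}\vec y&\leftarrow\varphi_i(\vec x)[\prec_j\vec y],\\ \vec x\nprec_{ij}\vec y&\leftarrow\textstyle\varphi_j(\vec y)[\bot]\vee\bigvee_k\exists\vec z\,(\vec x\npreceq_{ik}\vec z\wedge\vec z\triangleleft_{kj}\vec y)\vee\mathrm{none}_\ell(),\\ \vec x\npreceq_{ij}\vec y&\leftarrow\neg\varphi_i(\vec x)[\neg\nprec_j\vec y],\\ \vec x\triangleleft_{ij}\vec y&\leftarrow\varphi_i(\vec x)[\prec_i\vec x]\wedge\neg\varphi_j(\vec y)[\neg\nprec_i\vec x]\wedge\big(\varphi_j(\vec y)[\preceq_i\vec x]\vee\mathrm{fix}_i(\vec x)\big),\\ \mathrm{none}_\ell()&\leftarrow\textstyle\bigwedge_k\forall\vec z\,\neg\varphi_k(\vec z)[\bot],\\ \mathrm{fix}_i(\vec x)&\leftarrow\textstyle\bigwedge_k\forall\vec z\,\big(\neg\varphi_k(\vec z)[\neg\npreceq_i\vec x]\vee\varphi_k(\vec z)[\prec_i\vec x]\big). \end{aligned}$$ **Elimination procedure.** For $\ell=n-1,n-2,\dots,1$ (in this order): if some predicate affected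 by $\Pi_\ell$ occurs negatively in a body of the current program, add the stage axioms of $\Pi_\ell$ to $\Pi_\ell$, and in all later strata of the current program replace every negative occurrence $P_i(\vec t)$ of a predicate $P_i$ affected by $\Pi_\ell$ by $\neg\,\vec t\npreceq_{ii}\vec t$. Let $\mathscr P'$ be the resulting program. **Claim.** For every stratified axiom program $\mathscr P=(\Pi_1,\dots,\Pi_n)$: 1. $\mathscr P'$ is a stratified axiom program with $n$ strata, an original predicate is derived in $\mathscr P'$ if and only if it is derived in $\mathscr P$, and no derived predicate of $\mathscr P'$ occurs negatively in a body of $\mathscr P'$. 2. The union of all strata of $\mathscr P'$ is a single stratum that forms a stratified axiom program without negative occurrences of derived predicates (as PDDL 2.2 requires). 3. For every finite set of objects, every interpretation of the constants and every basic state, the extended states of $\mathscr P$, of $\mathscr P'$ and of the merged one-stratum program exist and do not depend on the choices made; those of $\mathscr P'$ and of the merged program are equal, and they agree with that of $\mathscr P$ on all predicates of the original vocabulary, in particular on all derived predicates of $\mathscr P$. 4. There are a polynomial $f$ and a constant $C$, independent of the vocabulary and of $\mathscr P$, such that the size (number of symbols) of $\mathscr P'$ is at most $f$ of the size of $\mathscr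 P$. Moreover, for every stratum $\Pi_\ell$, the axioms for stage predicates in the $\ell$-th stratum of $\mathscr P'$ have total size at most $C\,(m(q+ro)+m^2R)$, and the axioms for original predicates in it have total size at most $C\,q$. Here $m$ is the number of predicates affected by $\Pi_\ell$, $r$ their maximal arity, $R$ the sum of their arities (where a nullary predicate counts as $1$), $o$ the number of occurrences of these predicates in bodies of $\Pi_\ell$, and $q$ the size of $\Pi_\ell$. -/

import Mathlib

universe u v w

namespace AxiomProgram

/-! ### First-order formulas over a relational vocabulary with constants -/

/-- A relational vocabulary: predicate symbols with their arities, and constants. -/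
structure Vocabulary where
  Pred : Type u
  arity : Pred → ℕ
  Const : Type v

/-- Terms with free variables among `x_0, …, x_{n-1}`. -/
inductive Term (V : Vocabulary.{u, v}) (n : ℕ) where
  | var (i : Fin n)
  | const (c : V.Const)

/-- First-order formulas with free variables among `x_0, …, x_{n-1}`. In `all φ` and `ex φ` the
quantifier binds the last variable `x_n` of `φ`. -/
inductive Formula (V : Vocabulary.{u, v}) : ℕ → Type (max u v) where
  | falsum {n : ℕ} : Formula V n
  | verum {n : ℕ} : Formula V n
  | atom {n : ℕ} (p : V.Pred) (ts : Fin (V.arity p) → Term V n) : Formula V n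
  | eq {n : ℕ} (t t' : Term V n) : Formula V n
  | neg {n : ℕ} (φ : Formula V n) : Formula V n
  | and {n : ℕ} (φ ψ : Formula V n) : Formula V n
  | or {n : ℕ} (φ ψ : Formula V n) : Formula V n
  | all {n : ℕ} (φ : Formula V (n + 1)) : Formula V n
  | ex {n : ℕ} (φ : Formula V (n + 1)) : Formula V n

/-- A truth assignment to all ground atoms over the set `O` of objects. -/
abbrev State (V : Vocabulary.{u, v}) (O : Type w) : Type (max u w) :=
  (p : V.Pred) → (Fin (V.arity p) → O) → Prop

/-- The object denoted by a term, where `I` interprets the constants. -/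
def Term.eval {V : Vocabulary.{u, v}} {O : Type w} (I : V.Const → O) {n : ℕ} (a : Fin n → O) :
    Term V n → O
  | .var i => a i
  | .const c => I c

/-- Truth of a formula in a state under an assignment `a` of objects to the free variables. -/
def Formula.Holds {V : Vocabulary.{u, v}} {O : Type w} (I : V.Const → O) (s : State V O) :
    {n : ℕ} → Formula V n → (Fin n → O) → Prop
  | _, .falsum, _ => False
  | _, .verum, _ => True
  | _, .atom p ts, a => s p (fun i => (ts i).eval I a)
  | _, .eq t t', a => t.eval I a = t'.eval I a
  | _, .neg φ, a => ¬ φ.Holds I s a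
  | _, .and φ ψ, a => φ.Holds I s a ∧ ψ.Holds I s a
  | _, .or φ ψ, a => φ.Holds I s a ∨ ψ.Holds I s a
  | n, .all φ, a => ∀ o : O, φ.Holds I s (Fin.snoc (α := fun _ : Fin (n + 1) => O) a o)
  | n, .ex φ, a => ∃ o : O, φ.Holds I s (Fin.snoc (α := fun _ : Fin (n + 1) => O) a o)

/-- `φ.OccursSigned true p`: `p` has an occurrence in `φ` under an even number of negations;
`φ.OccursSigned false p`: `p` has an occurrence in `φ` under an odd number of negations. -/
def Formula.OccursSigned {V : Vocabulary.{u, v}} (p : V.Pred) :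
    {n : ℕ} → Bool → Formula V n → Prop
  | _, _, .falsum => False
  | _, _, .verum => False
  | _, b, .atom q _ => b = true ∧ q = p
  | _, _, .eq _ _ => False
  | _, b, .neg φ => φ.OccursSigned p (!b)
  | _, b, .and φ ψ => φ.OccursSigned p b ∨ ψ.OccursSigned p b
  | _, b, .or φ ψ => φ.OccursSigned p b ∨ ψ.OccursSigned p b
  | _, b, .all φ => φ.OccursSigned p b
  | _, b, .ex φ => φ.OccursSigned p b

/-- `p` occurs positively in `φ`. -/
def Formula.OccursPos {V : Vocabulary.{u, v}} {n : ℕ} (φ : Formula V n) (p : V.Pred) : Prop :=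
  φ.OccursSigned p true

/-- `p` occurs negatively in `φ`. -/
def Formula.OccursNeg {V : Vocabulary.{u, v}} {n : ℕ} (φ : Formula V n) (p : V.Pred) : Prop :=
  φ.OccursSigned p false

/-- Representation size: the number of symbols (a quantifier counts with its variable). -/
def Formula.size {V : Vocabulary.{u, v}} : {n : ℕ} → Formula V n → ℕ
  | _, .falsum => 1
  | _, .verum => 1
  | _, .atom p _ => 1 + V.arity p
  | _, .eq _ _ => 3
  | _, .neg φ => 1 + φ.size
  | _, .and φ ψ => 1 + φ.size + ψ.size
  | _, .or φ ψ => 1 + φ.size + ψ.size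
  | _, .all φ => 2 + φ.size
  | _, .ex φ => 2 + φ.size

open Classical in
/-- The number of occurrences in `φ` of predicates from the list `A`. -/
noncomputable def Formula.countOcc {V : Vocabulary.{u, v}} (A : List V.Pred) :
    {n : ℕ} → Formula V n → ℕ
  | _, .falsum => 0
  | _, .verum => 0
  | _, .atom p _ => if p ∈ A then 1 else 0
  | _, .eq _ _ => 0
  | _, .neg φ => φ.countOcc A
  | _, .and φ ψ => φ.countOcc A + ψ.countOcc A
  | _, .or φ ψ => φ.countOcc A + ψ.countOcc A
  | _, .all φ => φ.countOcc A
  | _, .ex φ => φ.countOcc A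

/-! ### Axioms, programs and their semantics -/

/-- The axiom `P(x_0, …, x_{r-1}) ← φ(x_0, …, x_{r-1})`, where `r` is the arity of `P`. -/
structure Ax (V : Vocabulary.{u, v}) where
  head : V.Pred
  body : Formula V (V.arity head)

/-- A stratum: a finite set of axioms, written as a list. -/
abbrev Stratum (V : Vocabulary.{u, v}) : Type (max u v) := List (Ax V)

/-- A finite sequence of strata. -/
abbrev Program (V : Vocabulary.{u, v}) : Type (max u v) := List (Stratum V)

/-- `p` is affected by an axiom of the stratum. -/
def Stratum.Affects {V : Vocabulary.{u, v}} (S : Stratum V) (p : V.Pred) : Prop :=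
  ∃ ax ∈ S, ax.head = p

/-- `p` occurs in the head or the body of an axiom of the stratum. -/
def Stratum.Mentions {V : Vocabulary.{u, v}} (S : Stratum V) (p : V.Pred) : Prop :=
  ∃ ax ∈ S, ax.head = p ∨ ax.body.OccursPos p ∨ ax.body.OccursNeg p

/-- The derived predicates of a program are those affected by one of its axioms; all others are
basic. -/
def Program.Derived {V : Vocabulary.{u, v}} (P : Program V) (p : V.Pred) : Prop :=
  ∃ S ∈ P, Stratum.Affects S p

/-- `P` is a stratified axiom program. -/
def Program.IsStratified {V : Vocabulary.{u, v}} (P : Program V) : Prop :=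
  ∀ i : Fin P.length, ∀ ax ∈ P.get i,
    (∀ k : Fin P.length, k ≠ i → ¬ Stratum.Affects (P.get k) ax.head) ∧
    (∀ k : Fin P.length, k < i → ¬ Stratum.Mentions (P.get k) ax.head) ∧
    (∀ p : V.Pred, ax.body.OccursPos p →
      ∀ j : Fin P.length, Stratum.Affects (P.get j) p → j ≤ i) ∧
    (∀ p : V.Pred, ax.body.OccursNeg p →
      ∀ j : Fin P.length, Stratum.Affects (P.get j) p → j < i)

/-- No derived predicate of `P` occurs negatively in the body of an axiom of `P`. -/
def Program.NoNegDerived {V : Vocabulary.{u, v}} (P : Program V) : Prop :=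
  ∀ S ∈ P, ∀ ax ∈ S, ∀ p : V.Pred, P.Derived p → ¬ ax.body.OccursNeg p

/-- The program whose only stratum consists of all axioms of `P`. -/
def Program.merge {V : Vocabulary.{u, v}} (P : Program V) : Program V := [P.flatten]

/-- The state that is obtained from `s` by making the ground atom `p(a)` true. -/
def State.setTrue {V : Vocabulary.{u, v}} {O : Type w} (s : State V O) (p : V.Pred)
    (a : Fin (V.arity p) → O) : State V O :=
  fun q b => s q b ∨
    (⟨q, b⟩ : (q : V.Pred) × (Fin (V.arity q) → O)) = ⟨p, a⟩

/-- One iteration of the loop that extends a state by a stratum: some axiom has, under some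
substitution of objects for its variables, a true body and a false head, and this head is made
true. -/
def Stratum.Step {V : Vocabulary.{u, v}} {O : Type w} (I : V.Const → O) (S : Stratum V)
    (s t : State V O) : Prop :=
  ∃ ax ∈ S, ∃ a : Fin (V.arity ax.head) → O,
    ax.body.Holds I s a ∧ ¬ s ax.head a ∧ t = s.setTrue ax.head a

/-- `t` is a possible result of the loop that extends `s` by the stratum `S`: it is reached by
iterations of the loop, and no further iteration is possible. -/
def Stratum.Extends {V : Vocabulary.{u, v}} {O : Type w} (I : V.Const → O) (S : Stratum V)
    (s t : State V O) : Prop :=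
  Relation.ReflTransGen (Stratum.Step I S) s t ∧ ∀ t', ¬ Stratum.Step I S t t'

/-- Extension by all strata, one after the other. -/
def Program.RunStrata {V : Vocabulary.{u, v}} {O : Type w} (I : V.Const → O) :
    Program V → State V O → State V O → Prop
  | [], s, t => t = s
  | S :: P, s, t => ∃ s', Stratum.Extends I S s s' ∧ Program.RunStrata I P s' t

/-- The assignment that agrees with `s` on the basic predicates of `P` and makes all atoms of
derived predicates false. -/
def Program.initial {V : Vocabulary.{u, v}} {O : Type w} (P : Program V) (s : State V O) :
    State V O :=
  fun p a => s p a ∧ ¬ P.Derived p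

/-- `t` is a possible extended state of `P` for the basic state given by the values of `s` on the
basic predicates of `P`. -/
def Program.Extends {V : Vocabulary.{u, v}} {O : Type w} (P : Program V) (I : V.Const → O)
    (s t : State V O) : Prop :=
  Program.RunStrata I P (P.initial s) t

/-! ### Size parameters -/

/-- Size of an axiom: head, arrow and body. -/
def Ax.size {V : Vocabulary.{u, v}} (ax : Ax V) : ℕ :=
  (1 + V.arity ax.head) + 1 + ax.body.size

/-- Representation size of a stratum. -/
def Stratum.size {V : Vocabulary.{u, v}} (S : Stratum V) : ℕ := (S.map Ax.size).sum

/-- Representation size of a program. -/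
def Program.size {V : Vocabulary.{u, v}} (P : Program V) : ℕ := (P.map Stratum.size).sum

open Classical in
/-- The predicates affected by a stratum, without repetitions. -/
noncomputable def Stratum.affected {V : Vocabulary.{u, v}} (S : Stratum V) : List V.Pred :=
  (S.map Ax.head).dedup

/-- The number of predicates affected by the stratum. -/
noncomputable def Stratum.numAffected {V : Vocabulary.{u, v}} (S : Stratum V) : ℕ :=
  (Stratum.affected S).length

/-- The maximal arity of a predicate affected by the stratum. -/
noncomputable def Stratum.maxArity {V : Vocabulary.{u, v}} (S : Stratum V) : ℕ :=
  ((Stratum.affected S).map V.arity).foldr max 0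

/-- The sum of the arities of the predicates affected by the stratum, where a nullary predicate
counts as `1`. -/
noncomputable def Stratum.sumArity {V : Vocabulary.{u, v}} (S : Stratum V) : ℕ :=
  ((Stratum.affected S).map (fun p => max 1 (V.arity p))).sum

/-- The number of occurrences of predicates affected by the stratum in bodies of the stratum. -/
noncomputable def Stratum.numOcc {V : Vocabulary.{u, v}} (S : Stratum V) : ℕ :=
  (S.map (fun ax => ax.body.countOcc (Stratum.affected S))).sum

/-! ### The vocabulary with stage predicates -/

/-- The original predicates `P`, and for all original `P_i`, `P_j` the stage predicates
`≺_{ij}` (`lt`), `≼_{ij}` (`le`), their complements `⊀_{ij}` (`nlt`), `⋠_{ij}` (`nle`), and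
`◁_{ij}` (`tri`). The auxiliary nullary predicate `none ℓ` says that the stratum with number `ℓ`
derives nothing, and `fix i`, of the arity of `P_i`, says that the fixed point is reached in the
stage of the given `P_i`-atom. -/
inductive StagePred (V : Vocabulary.{u, v}) : Type u where
  | orig (p : V.Pred)
  | lt (i j : V.Pred)
  | le (i j : V.Pred)
  | nlt (i j : V.Pred)
  | nle (i j : V.Pred)
  | tri (i j : V.Pred)
  | none (l : ℕ)
  | fix (i : V.Pred)

/-- Arities of the predicates in the extended vocabulary. -/
def StagePred.arity {V : Vocabulary.{u, v}} : StagePred V → ℕ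
  | .orig p => V.arity p
  | .lt i j => V.arity i + V.arity j
  | .le i j => V.arity i + V.arity j
  | .nlt i j => V.arity i + V.arity j
  | .nle i j => V.arity i + V.arity j
  | .tri i j => V.arity i + V.arity j
  | .none _ => 0
  | .fix i => V.arity i

/-- Is the predicate one of the original vocabulary? -/
def StagePred.isOrig {V : Vocabulary.{u, v}} : StagePred V → Bool
  | .orig _ => true
  | _ => false

/-- The vocabulary extended by the stage predicates. -/
def stageVocab (V : Vocabulary.{u, v}) : Vocabulary.{u, v} where
  Pred := StagePred V
  arity := StagePred.arity
  Const := V.Const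

/-- The interpretation of the original predicates in a state over the extended vocabulary. -/
def State.restrict {V : Vocabulary.{u, v}} {O : Type w} (s : State (stageVocab V) O) :
    State V O :=
  fun p a => s (StagePred.orig p) a

/-! ### Syntactic operations -/

/-- A term in a context with one more variable. -/
def Term.lift {V : Vocabulary.{u, v}} {n : ℕ} : Term V n → Term V (n + 1)
  | .var i => .var i.castSucc
  | .const c => .const c

/-- Substitution in a term, with a change to the extended vocabulary. -/
def Term.subst {V : Vocabulary.{u, v}} {n m : ℕ} (ρ : Fin n → Term (stageVocab V) m) :
    Term V n → Term (stageVocab V) m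
  | .var i => ρ i
  | .const c => .const c

/-- Substitute the terms `ρ` for the free variables of the formula and replace every atom `p(t)`
by the formula `f p t y`, where `y` is a tuple of parameters. -/
def Formula.replace {V : Vocabulary.{u, v}} {k : ℕ}
    (f : {m : ℕ} → (p : V.Pred) → (Fin (V.arity p) → Term (stageVocab V) m) →
      (Fin k → Term (stageVocab V) m) → Formula (stageVocab V) m) :
    {n m : ℕ} → Formula V n → (ρ : Fin n → Term (stageVocab V) m) →
      (y : Fin k → Term (stageVocab V) m) → Formula (stageVocab V) m
  | _, _, .falsum, _, _ => .falsum
  | _, _, .verum, _, _ => .verum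
  | _, _, .atom p ts, ρ, y => f p (fun i => (ts i).subst ρ) y
  | _, _, .eq t t', ρ, _ => .eq (t.subst ρ) (t'.subst ρ)
  | _, _, .neg φ, ρ, y => .neg (φ.replace f ρ y)
  | _, _, .and φ ψ, ρ, y => .and (φ.replace f ρ y) (ψ.replace f ρ y)
  | _, _, .or φ ψ, ρ, y => .or (φ.replace f ρ y) (ψ.replace f ρ y)
  | n, m, .all φ, ρ, y => .all (φ.replace f
      (Fin.snoc (α := fun _ : Fin (n + 1) => Term (stageVocab V) (m + 1))
        (fun i => (ρ i).lift) (.var (Fin.last m)))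
      (fun i => (y i).lift))
  | n, m, .ex φ, ρ, y => .ex (φ.replace f
      (Fin.snoc (α := fun _ : Fin (n + 1) => Term (stageVocab V) (m + 1))
        (fun i => (ρ i).lift) (.var (Fin.last m)))
      (fun i => (y i).lift))

/-- The atom `P(t)` over the extended vocabulary. -/
def origAtom {V : Vocabulary.{u, v}} {m : ℕ} (p : V.Pred)
    (t : Fin (V.arity p) → Term (stageVocab V) m) : Formula (stageVocab V) m :=
  Formula.atom (V := stageVocab V) (StagePred.orig p) t

/-- The atom `x ≺_{ij} y`. -/
def ltAtom {V : Vocabulary.{u, v}} {m : ℕ} (i j : V.Pred)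
    (x : Fin (V.arity i) → Term (stageVocab V) m) (y : Fin (V.arity j) → Term (stageVocab V) m) :
    Formula (stageVocab V) m :=
  Formula.atom (V := stageVocab V) (StagePred.lt i j) (Fin.append x y)

/-- The atom `x ≼_{ij} y`. -/
def leAtom {V : Vocabulary.{u, v}} {m : ℕ} (i j : V.Pred)
    (x : Fin (V.arity i) → Term (stageVocab V) m) (y : Fin (V.arity j) → Term (stageVocab V) m) :
    Formula (stageVocab V) m :=
  Formula.atom (V := stageVocab V) (StagePred.le i j) (Fin.append x y)

/-- The atom `x ⊀_{ij} y`. -/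
def nltAtom {V : Vocabulary.{u, v}} {m : ℕ} (i j : V.Pred)
    (x : Fin (V.arity i) → Term (stageVocab V) m) (y : Fin (V.arity j) → Term (stageVocab V) m) :
    Formula (stageVocab V) m :=
  Formula.atom (V := stageVocab V) (StagePred.nlt i j) (Fin.append x y)

/-- The atom `x ⋠_{ij} y`. -/
def nleAtom {V : Vocabulary.{u, v}} {m : ℕ} (i j : V.Pred)
    (x : Fin (V.arity i) → Term (stageVocab V) m) (y : Fin (V.arity j) → Term (stageVocab V) m) :
    Formula (stageVocab V) m :=
  Formula.atom (V := stageVocab V) (StagePred.nle i j) (Fin.append x y)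

/-- The atom `x ◁_{ij} y`. -/
def triAtom {V : Vocabulary.{u, v}} {m : ℕ} (i j : V.Pred)
    (x : Fin (V.arity i) → Term (stageVocab V) m) (y : Fin (V.arity j) → Term (stageVocab V) m) :
    Formula (stageVocab V) m :=
  Formula.atom (V := stageVocab V) (StagePred.tri i j) (Fin.append x y)

/-- The formula itself, over the extended vocabulary. -/
def Formula.embed {V : Vocabulary.{u, v}} {n : ℕ} (φ : Formula V n) : Formula (stageVocab V) n :=
  φ.replace (k := 0) (fun p t _ => origAtom p t) Term.var Fin.elim0

open Classical in
/-- `φ(x)[≺_j y]`: every atom `P_k(z)` with `P_k` in `A` is replaced by `z ≺_{kj} y`. -/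
noncomputable def Formula.withLt {V : Vocabulary.{u, v}} {n m : ℕ} (φ : Formula V n)
    (A : List V.Pred) (j : V.Pred) (x : Fin n → Term (stageVocab V) m)
    (y : Fin (V.arity j) → Term (stageVocab V) m) : Formula (stageVocab V) m :=
  φ.replace (fun p t y => if p ∈ A then ltAtom p j t y else origAtom p t) x y

open Classical in
/-- `φ(x)[≼_j y]`: every atom `P_k(z)` with `P_k` in `A` is replaced by `z ≼_{kj} y`. -/
noncomputable def Formula.withLe {V : Vocabulary.{u, v}} {n m : ℕ} (φ : Formula V n)
    (A : List V.Pred) (j : V.Pred) (x : Fin n → Term (stageVocab V) m)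
    (y : Fin (V.arity j) → Term (stageVocab V) m) : Formula (stageVocab V) m :=
  φ.replace (fun p t y => if p ∈ A then leAtom p j t y else origAtom p t) x y

open Classical in
/-- `φ(x)[¬⊀_j y]`: every atom `P_k(z)` with `P_k` in `A` is replaced by `¬ z ⊀_{kj} y`. -/
noncomputable def Formula.withNotNlt {V : Vocabulary.{u, v}} {n m : ℕ} (φ : Formula V n)
    (A : List V.Pred) (j : V.Pred) (x : Fin n → Term (stageVocab V) m)
    (y : Fin (V.arity j) → Term (stageVocab V) m) : Formula (stageVocab V) m :=
  φ.replace (fun p t y => if p ∈ A then .neg (nltAtom p j t y) else origAtom p t) x y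

open Classical in
/-- `φ(x)[¬⋠_j y]`: every atom `P_k(z)` with `P_k` in `A` is replaced by `¬ z ⋠_{kj} y`. -/
noncomputable def Formula.withNotNle {V : Vocabulary.{u, v}} {n m : ℕ} (φ : Formula V n)
    (A : List V.Pred) (j : V.Pred) (x : Fin n → Term (stageVocab V) m)
    (y : Fin (V.arity j) → Term (stageVocab V) m) : Formula (stageVocab V) m :=
  φ.replace (fun p t y => if p ∈ A then .neg (nleAtom p j t y) else origAtom p t) x y

open Classical in
/-- `φ(x)[⊥]`: every atom `P_k(z)` with `P_k` in `A` is replaced by `⊥`. -/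
noncomputable def Formula.withBot {V : Vocabulary.{u, v}} {n m : ℕ} (φ : Formula V n)
    (A : List V.Pred) (x : Fin n → Term (stageVocab V) m) : Formula (stageVocab V) m :=
  φ.replace (k := 0) (fun p t _ => if p ∈ A then .falsum else origAtom p t) x Fin.elim0

/-- `∀ z_1 … z_k`. -/
def Formula.allN {V : Vocabulary.{u, v}} {n : ℕ} : (k : ℕ) → Formula V (n + k) → Formula V n
  | 0, φ => φ
  | k + 1, φ => Formula.allN k (.all φ)

/-- `∃ z_1 … z_k`. -/
def Formula.exN {V : Vocabulary.{u, v}} {n : ℕ} : (k : ℕ) → Formula V (n + k) → Formula V n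
  | 0, φ => φ
  | k + 1, φ => Formula.exN k (.ex φ)

/-- Disjunction over a list. -/
def bigOr {V : Vocabulary.{u, v}} {n : ℕ} {α : Type u} (l : List α) (f : α → Formula V n) :
    Formula V n :=
  l.foldr (fun k φ => .or (f k) φ) .falsum

/-- Conjunction over a list. -/
def bigAnd {V : Vocabulary.{u, v}} {n : ℕ} {α : Type u} (l : List α) (f : α → Formula V n) :
    Formula V n :=
  l.foldr (fun k φ => .and (f k) φ) .verum

/-! ### The stage axioms of a stratum -/

open Classical in
/-- The formula `φ_i`: the disjunction of the bodies of all axioms of the stratum with head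
`P_i`. -/
noncomputable def Stratum.bodyOf {V : Vocabulary.{u, v}} (S : Stratum V) (i : V.Pred) :
    Formula V (V.arity i) :=
  S.foldr (fun ax φ => if h : ax.head = i then .or (h ▸ ax.body) φ else φ) .falsum

/-- `x ≺_{ij} y ← ⋁_k ∃ z (x ≼_{ik} z ∧ z ◁_{kj} y)`. -/
noncomputable def ltAxiom {V : Vocabulary.{u, v}} (S : Stratum V) (i j : V.Pred) :
    Ax (stageVocab V) where
  head := StagePred.lt i j
  body := show Formula (stageVocab V) (V.arity i + V.arity j) from
    bigOr (Stratum.affected S) fun k => Formula.exN (V.arity k) <|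
      .and
        (leAtom i k (fun a => .var (Fin.castAdd _ (Fin.castAdd _ a))) (fun a => .var (Fin.natAdd _ a)))
        (triAtom k j (fun a => .var (Fin.natAdd _ a)) (fun a => .var (Fin.castAdd _ (Fin.natAdd _ a))))

/-- `x ≼_{ij} y ← φ_i(x)[≺_j y]`. -/
noncomputable def leAxiom {V : Vocabulary.{u, v}} (S : Stratum V) (i j : V.Pred) :
    Ax (stageVocab V) where
  head := StagePred.le i j
  body := show Formula (stageVocab V) (V.arity i + V.arity j) from
    (Stratum.bodyOf S i).withLt (Stratum.affected S) j
      (fun a => .var (Fin.castAdd _ a)) (fun a => .var (Fin.natAdd _ a))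

/-- `x ⊀_{ij} y ← φ_j(y)[⊥] ∨ ⋁_k ∃ z (x ⋠_{ik} z ∧ z ◁_{kj} y) ∨ none_ℓ()`. -/
noncomputable def nltAxiom {V : Vocabulary.{u, v}} (l : ℕ) (S : Stratum V) (i j : V.Pred) :
    Ax (stageVocab V) where
  head := StagePred.nlt i j
  body := show Formula (stageVocab V) (V.arity i + V.arity j) from
    .or
      ((Stratum.bodyOf S j).withBot (Stratum.affected S) (fun a => .var (Fin.natAdd _ a)))
      (.or
        (bigOr (Stratum.affected S) fun k => Formula.exN (V.arity k) <|
          .and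
            (nleAtom i k (fun a => .var (Fin.castAdd _ (Fin.castAdd _ a)))
              (fun a => .var (Fin.natAdd _ a)))
            (triAtom k j (fun a => .var (Fin.natAdd _ a))
              (fun a => .var (Fin.castAdd _ (Fin.natAdd _ a)))))
        (Formula.atom (V := stageVocab V) (StagePred.none l) Fin.elim0))

/-- `x ⋠_{ij} y ← ¬ φ_i(x)[¬⊀_j y]`. -/
noncomputable def nleAxiom {V : Vocabulary.{u, v}} (S : Stratum V) (i j : V.Pred) :
    Ax (stageVocab V) where
  head := StagePred.nle i j
  body := show Formula (stageVocab V) (V.arity i + V.arity j) from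
    .neg ((Stratum.bodyOf S i).withNotNlt (Stratum.affected S) j
      (fun a => .var (Fin.castAdd _ a)) (fun a => .var (Fin.natAdd _ a)))

/-- `x ◁_{ij} y ← φ_i(x)[≺_i x] ∧ ¬ φ_j(y)[¬⊀_i x] ∧ (φ_j(y)[≼_i x] ∨ fix_i(x))`. -/
noncomputable def triAxiom {V : Vocabulary.{u, v}} (S : Stratum V) (i j : V.Pred) :
    Ax (stageVocab V) where
  head := StagePred.tri i j
  body := show Formula (stageVocab V) (V.arity i + V.arity j) from
    .and
      ((Stratum.bodyOf S i).withLt (Stratum.affected S) i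
        (fun a => .var (Fin.castAdd _ a)) (fun a => .var (Fin.castAdd _ a)))
      (.and
        (.neg ((Stratum.bodyOf S j).withNotNlt (Stratum.affected S) i
          (fun a => .var (Fin.natAdd _ a)) (fun a => .var (Fin.castAdd _ a))))
        (.or
          ((Stratum.bodyOf S j).withLe (Stratum.affected S) i
            (fun a => .var (Fin.natAdd _ a)) (fun a => .var (Fin.castAdd _ a)))
          (Formula.atom (V := stageVocab V) (StagePred.fix i) (fun a => .var (Fin.castAdd _ a)))))

/-- `none_ℓ() ← ⋀_k ∀ z ¬ φ_k(z)[⊥]`. -/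
noncomputable def noneAxiom {V : Vocabulary.{u, v}} (l : ℕ) (S : Stratum V) :
    Ax (stageVocab V) where
  head := StagePred.none l
  body := show Formula (stageVocab V) 0 from
    bigAnd (Stratum.affected S) fun k => Formula.allN (V.arity k) <|
      .neg ((Stratum.bodyOf S k).withBot (Stratum.affected S) (fun a => .var (Fin.natAdd _ a)))

/-- `fix_i(x) ← ⋀_k ∀ z (¬ φ_k(z)[¬⋠_i x] ∨ φ_k(z)[≺_i x])`. -/
noncomputable def fixAxiom {V : Vocabulary.{u, v}} (S : Stratum V) (i : V.Pred) :
    Ax (stageVocab V) where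
  head := StagePred.fix i
  body := show Formula (stageVocab V) (V.arity i) from
    bigAnd (Stratum.affected S) fun k => Formula.allN (V.arity k) <|
      .or
        (.neg ((Stratum.bodyOf S k).withNotNle (Stratum.affected S) i
          (fun a => .var (Fin.natAdd _ a)) (fun a => .var (Fin.castAdd _ a))))
        ((Stratum.bodyOf S k).withLt (Stratum.affected S) i
          (fun a => .var (Fin.natAdd _ a)) (fun a => .var (Fin.castAdd _ a)))

/-- All stage axioms (with the auxiliary ones) for the stratum `S`, which has number `l`. -/
noncomputable def stageAxioms {V : Vocabulary.{u, v}} (l : ℕ) (S : Stratum V) :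
    Stratum (stageVocab V) :=
  noneAxiom l S ::
    (Stratum.affected S).flatMap fun i =>
      fixAxiom S i ::
        (Stratum.affected S).flatMap fun j =>
          [ltAxiom S i j, leAxiom S i j, nltAxiom l S i j, nleAxiom S i j, triAxiom S i j]

/-! ### The elimination procedure -/

open Classical in
/-- Replace all negative occurrences (all positive ones for `b = false`) of atoms `P_i(t)` with
`P_i` in `A` by `¬ t ⋠_{ii} t`. -/
noncomputable def Formula.replaceNeg {V : Vocabulary.{u, v}} (A : List V.Pred) :
    {n : ℕ} → Bool → Formula (stageVocab V) n → Formula (stageVocab V) n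
  | _, _, .falsum => .falsum
  | _, _, .verum => .verum
  | _, b, .atom (StagePred.orig p) ts =>
      if b = false ∧ p ∈ A then .neg (nleAtom p p ts ts) else origAtom p ts
  | _, _, .atom p ts => .atom p ts
  | _, _, .eq t t' => .eq t t'
  | _, b, .neg φ => .neg (φ.replaceNeg A (!b))
  | _, b, .and φ ψ => .and (φ.replaceNeg A b) (ψ.replaceNeg A b)
  | _, b, .or φ ψ => .or (φ.replaceNeg A b) (ψ.replaceNeg A b)
  | _, b, .all φ => .all (φ.replaceNeg A b)
  | _, b, .ex φ => .ex (φ.replaceNeg A b)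

/-- The same program over the extended vocabulary. -/
def Program.embed {V : Vocabulary.{u, v}} (P : Program V) : Program (stageVocab V) :=
  P.map fun S => S.map fun ax => { head := StagePred.orig ax.head, body := ax.body.embed }

open Classical in
/-- Processing the stratum with number `l` of `P`, where `Q` is the current program. If a
predicate affected by this stratum occurs negatively in `Q`, then the stage axioms are added to
this stratum and the negative occurrences in all later strata are replaced. -/
noncomputable def Program.elimStep {V : Vocabulary.{u, v}} (P : Program V) (l : ℕ)
    (Q : Program (stageVocab V)) : Program (stageVocab V) :=
  if ∃ p ∈ Stratum.affected (P.getD l []), ∃ T ∈ Q, ∃ ax ∈ T,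
      ax.body.OccursNeg (StagePred.orig p) then
    Q.mapIdx fun i T =>
      if i < l then T
      else if i = l then T ++ stageAxioms l (P.getD l [])
      else T.map fun ax =>
        { head := ax.head
          body := ax.body.replaceNeg (Stratum.affected (P.getD l [])) true }
  else Q

/-- The elimination procedure: all strata but the last are processed, in the order from the last
to the first (so a stratum is still the original one when its stage axioms are formed). -/
noncomputable def Program.eliminate {V : Vocabulary.{u, v}} (P : Program V) :
    Program (stageVocab V) :=
  (List.range (P.length - 1)).foldr (fun l Q => P.elimStep l Q) P.embed

/-- The axioms of a stratum of the transformed program that derive stage predicates. -/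
def Stratum.stagePart {V : Vocabulary.{u, v}} (S : Stratum (stageVocab V)) :
    Stratum (stageVocab V) :=
  S.filter fun ax => !(StagePred.isOrig ax.head)

/-- The axioms of a stratum of the transformed program that derive original predicates. -/
def Stratum.origPart {V : Vocabulary.{u, v}} (S : Stratum (stageVocab V)) :
    Stratum (stageVocab V) :=
  S.filter fun ax => StagePred.isOrig ax.head

end AxiomProgram

namespace AxiomProgram

/-! ### Least closed states, termination and uniqueness of runs, merging of strata. -/

section Semantics

variable {V : Vocabulary.{u, v}} {O : Type w}

/-! ### Monotonicity -/

/-! The proof is a stage comparison argument: the complement of an inductively defined relation over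
a finite structure is itself defined by a positive induction. Inside a stratum the affected
predicates occur only positively, so its extension is the least closed state, and this is the union
of the increasing stages of a simultaneous induction (`Stratum.Extends.iff_stage`), which become
stationary because there are finitely many ground atoms. An atom has level `n` if it enters in stage
`n + 1`, or if it never enters and the stages are stationary from `n` on. An atom that never enters
has many levels, but they all belong to the same stage (`Stratum.Level.stage_eq`). If `y` has level
`n`, then `x ≺ y` means that `x` is in stage `n`, `x ≼ y` that it is in stage `n + 1`, and `⊀`, `⋠`
are the complements; `z ◁ y` means that `y` has the level following that of the derived atom `z`.
The state `idealState` with these meanings satisfies all stage axioms (`idealState_closed`), so by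
minimality nothing false is derived. Conversely, induction on the level shows that every closed
state below it contains all intended facts (`StageClosed.exact`): to pass from level `n` to `n + 1`,
take an atom `z` that is new in stage `n + 1`; the relations to `z` are already correct, so `z ◁ y`
is derivable and carries them over to `y`. The axiom for `none` starts the induction when the
stratum derives nothing, and `fix` gives a successor to the last atoms that enter. On the diagonal,
`x ⋠ x` says that `x` is not even in the stage after its level, hence in none: the negation has
become a derived atom. For the program, `Program.EliminatedFrom` describes its shape after each
elimination step and implies stratification without negative derived occurrences. A run of the new
program follows the old run stratum by stratum (`Program.EliminatedFrom.restrict_extends`), since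
the replaced bodies are equivalent to the original ones wherever they are evaluated. Without
negative derived occurrences, the separate strata and their union compute the same least closed
state (`Program.Extends.merge`). For the size, a weight that counts original atoms twice is not
increased by replacement, so all replacements together at most double a body. -/

theorem Formula.Holds.mono_signed {I : V.Const → O} {s t : State V O} {n : ℕ} (φ : Formula V n) :
    ((∀ p, φ.OccursSigned p true → ∀ a, s p a → t p a) →
      (∀ p, φ.OccursSigned p false → ∀ a, t p a → s p a) →
      ∀ a, φ.Holds I s a → φ.Holds I t a) ∧
    ((∀ p, φ.OccursSigned p false → ∀ a, s p a → t p a) →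
      (∀ p, φ.OccursSigned p true → ∀ a, t p a → s p a) →
      ∀ a, φ.Holds I t a → φ.Holds I s a) := by
  -- Negation exchanges the two halves, so they have to be proved together.
  induction φ with
  | falsum => exact ⟨fun _ _ _ h => h, fun _ _ _ h => h⟩
  | verum => exact ⟨fun _ _ _ h => h, fun _ _ _ h => h⟩
  | eq t t' => exact ⟨fun _ _ _ h => h, fun _ _ _ h => h⟩
  | atom p ts =>
    exact ⟨fun h _ a => h p ⟨rfl, rfl⟩ _, fun _ h a => h p ⟨rfl, rfl⟩ _⟩
  | neg φ ih =>
    exact ⟨fun h h' a hn hs => hn (ih.2 h h' a hs), fun h h' a hn hs => hn (ih.1 h h' a hs)⟩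
  | and φ ψ ih ih' =>
    refine ⟨fun h h' a hs => ⟨?_, ?_⟩, fun h h' a hs => ⟨?_, ?_⟩⟩
    · exact ih.1 (fun p hp => h p (.inl hp)) (fun p hp => h' p (.inl hp)) a hs.1
    · exact ih'.1 (fun p hp => h p (.inr hp)) (fun p hp => h' p (.inr hp)) a hs.2
    · exact ih.2 (fun p hp => h p (.inl hp)) (fun p hp => h' p (.inl hp)) a hs.1
    · exact ih'.2 (fun p hp => h p (.inr hp)) (fun p hp => h' p (.inr hp)) a hs.2
  | or φ ψ ih ih' =>
    refine ⟨fun h h' a hs => Or.imp ?_ ?_ hs, fun h h' a hs => Or.imp ?_ ?_ hs⟩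
    · exact ih.1 (fun p hp => h p (.inl hp)) (fun p hp => h' p (.inl hp)) a
    · exact ih'.1 (fun p hp => h p (.inr hp)) (fun p hp => h' p (.inr hp)) a
    · exact ih.2 (fun p hp => h p (.inl hp)) (fun p hp => h' p (.inl hp)) a
    · exact ih'.2 (fun p hp => h p (.inr hp)) (fun p hp => h' p (.inr hp)) a
  | all φ ih =>
    exact ⟨fun h h' a hs o => ih.1 h h' _ (hs o), fun h h' a hs o => ih.2 h h' _ (hs o)⟩
  | ex φ ih =>
    exact ⟨fun h h' a ⟨o, hs⟩ => ⟨o, ih.1 h h' _ hs⟩, fun h h' a ⟨o, hs⟩ => ⟨o, ih.2 h h' _ hs⟩⟩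

theorem Formula.Holds.mono {I : V.Const → O} {s t : State V O} {n : ℕ} {φ : Formula V n}
    (hpos : ∀ p, φ.OccursPos p → ∀ a, s p a → t p a)
    (hneg : ∀ p, φ.OccursNeg p → ∀ a, t p a → s p a) {a : Fin n → O} (h : φ.Holds I s a) :
    φ.Holds I t a :=
  (Formula.Holds.mono_signed φ).1 hpos hneg a h

/-- A state is closed under a stratum if every axiom holds in it. -/
def Stratum.Closed (I : V.Const → O) (S : Stratum V) (t : State V O) : Prop :=
  ∀ ax ∈ S, ∀ a : Fin (V.arity ax.head) → O, ax.body.Holds I t a → t ax.head a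

theorem Stratum.closed_iff {I : V.Const → O} {S : Stratum V} {t : State V O} :
    Stratum.Closed I S t ↔ ∀ t', ¬ Stratum.Step I S t t' := by
  constructor
  · rintro h t' ⟨ax, hax, a, hb, hn, -⟩
    exact hn (h ax hax a hb)
  · intro h ax hax a hb
    by_contra hn
    exact h _ ⟨ax, hax, a, hb, hn, rfl⟩

theorem Stratum.Extends.closed {I : V.Const → O} {S : Stratum V} {s t : State V O}
    (h : Stratum.Extends I S s t) : Stratum.Closed I S t :=
  Stratum.closed_iff.2 h.2

theorem State.setTrue_self (s : State V O) (p : V.Pred) (a : Fin (V.arity p) → O) :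
    s.setTrue p a p a := .inr rfl

theorem State.setTrue_of_ne (s : State V O) {p q : V.Pred} (a : Fin (V.arity p) → O)
    (b : Fin (V.arity q) → O) (h : q ≠ p) : s.setTrue p a q b ↔ s q b := by
  constructor
  · rintro (h' | h')
    · exact h'
    · exact absurd (congrArg Sigma.fst h') h
  · exact .inl

theorem Stratum.Step.le {I : V.Const → O} {S : Stratum V} {s t : State V O}
    (h : Stratum.Step I S s t) (p : V.Pred) (a : Fin (V.arity p) → O) (hs : s p a) : t p a := by
  obtain ⟨ax, -, b, -, -, rfl⟩ := h
  exact .inl hs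

theorem Stratum.path_mono {I : V.Const → O} {S : Stratum V} {s t : State V O}
    (h : Relation.ReflTransGen (Stratum.Step I S) s t) (p : V.Pred) (a : Fin (V.arity p) → O)
    (hs : s p a) : t p a := by
  induction h with
  | refl => exact hs
  | tail _ h ih => exact h.le p a ih

theorem Stratum.Step.unaffected {I : V.Const → O} {S : Stratum V} {s t : State V O}
    (h : Stratum.Step I S s t) {p : V.Pred} (hp : ¬ Stratum.Affects S p)
    (a : Fin (V.arity p) → O) : t p a ↔ s p a := by
  obtain ⟨ax, hax, b, -, -, rfl⟩ := h
  exact State.setTrue_of_ne _ _ _ fun h => hp ⟨ax, hax, h.symm⟩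

theorem Stratum.path_unaffected {I : V.Const → O} {S : Stratum V} {s t : State V O}
    (h : Relation.ReflTransGen (Stratum.Step I S) s t) {p : V.Pred}
    (hp : ¬ Stratum.Affects S p) (a : Fin (V.arity p) → O) : t p a ↔ s p a := by
  induction h with
  | refl => rfl
  | tail _ h ih => exact (h.unaffected hp a).trans ih

/-- Everything that is derived from `s` holds in every closed state above `s` that agrees with
`s` on the predicates that may occur negatively. -/
theorem Stratum.path_le {I : V.Const → O} {S : Stratum V} {s t u : State V O}
    (D : V.Pred → Prop) (hD : ∀ ax ∈ S, ∀ p, D p → ¬ ax.body.OccursNeg p)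
    (hsu : ∀ p a, s p a → u p a) (hus : ∀ p, ¬ D p → ∀ a, u p a → s p a)
    (hu : Stratum.Closed I S u) (h : Relation.ReflTransGen (Stratum.Step I S) s t) :
    ∀ p a, t p a → u p a := by
  induction h with
  | refl => exact hsu
  | @tail b c hb hc ih =>
    obtain ⟨ax, hax, x, hx, -, rfl⟩ := hc
    rintro p a (h | h)
    · exact ih p a h
    · have : u ax.head x := by
        -- The body passes from the current state to `u`: positive atoms by induction, and negative
        -- ones because `u` agrees there with `s`, below the current state.
        refine hu ax hax x (Formula.Holds.mono (fun p _ a => ih p a) (fun p hp a hua => ?_) hx)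
        exact Stratum.path_mono hb p a (hus p (fun hd => hD ax hax p hd hp) a hua)
      cases h
      exact this

/-- No axiom body of the stratum has a negative occurrence of an affected predicate. -/
def Stratum.PosAffected (S : Stratum V) : Prop :=
  ∀ ax ∈ S, ∀ p, Stratum.Affects S p → ¬ ax.body.OccursNeg p

/-- Each of two results is a closed state above `s` that agrees with `s` on unaffected predicates,
so each contains the other by `Stratum.path_le`. -/
theorem Stratum.Extends.unique {I : V.Const → O} {S : Stratum V} (hS : S.PosAffected)
    {s t t' : State V O} (h : Stratum.Extends I S s t) (h' : Stratum.Extends I S s t') :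
    t = t' := by
  have key : ∀ {t t' : State V O}, Stratum.Extends I S s t → Stratum.Extends I S s t' →
      ∀ p a, t p a → t' p a := fun h h' =>
    Stratum.path_le (Stratum.Affects S) hS (Stratum.path_mono h'.1)
      (fun p hp a => (Stratum.path_unaffected h'.1 hp a).1) h'.closed h.1
  funext p a
  exact propext ⟨key h h' p a, key h' h p a⟩

/-- The vocabulary may be infinite; finiteness comes from the finitely many heads. It yields both
termination of the loop and stationarity of the stages. -/
theorem Stratum.finite_atoms [Finite O] (S : Stratum V) :
    {x : (p : V.Pred) × (Fin (V.arity p) → O) | Stratum.Affects S x.1}.Finite := by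
  have : {x : (p : V.Pred) × (Fin (V.arity p) → O) | Stratum.Affects S x.1} =
      ⋃ ax ∈ {ax | ax ∈ S}, Set.range
        (fun a : Fin (V.arity ax.head) → O =>
          (⟨ax.head, a⟩ : (p : V.Pred) × (Fin (V.arity p) → O))) := by
    ext ⟨p, a⟩
    simp only [Set.mem_ofPred_eq, Set.mem_iUnion, Set.mem_range, exists_prop]
    constructor
    · rintro ⟨ax, hax, rfl⟩
      exact ⟨ax, hax, a, rfl⟩
    · rintro ⟨ax, hax, b, hb⟩
      exact ⟨ax, hax, congrArg Sigma.fst hb⟩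
  rw [this]
  exact (List.finite_toSet S).biUnion fun ax _ => Set.finite_range _

/-- Every step lowers the number of false atoms of affected predicates. Existence needs no
positivity; only uniqueness does. -/
theorem Stratum.exists_extends [Finite O] (I : V.Const → O) (S : Stratum V) (s : State V O) :
    ∃ t, Stratum.Extends I S s t := by
  let F : State V O → Set ((p : V.Pred) × (Fin (V.arity p) → O)) :=
    fun s => {x | Stratum.Affects S x.1 ∧ ¬ s x.1 x.2}
  have hF : ∀ s, (F s).Finite := fun s => (Stratum.finite_atoms S).subset fun x hx => hx.1
  generalize hn : (F s).ncard = n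
  induction n using Nat.strong_induction_on generalizing s with
  | _ n ih =>
    by_cases h : ∃ t, Stratum.Step I S s t
    · obtain ⟨t, ht⟩ := h
      have hlt : (F t).ncard < (F s).ncard := by
        apply Set.ncard_lt_ncard _ (hF s)
        refine ⟨fun x hx => ⟨hx.1, fun h => hx.2 (ht.le _ _ h)⟩, fun hsub => ?_⟩
        obtain ⟨ax, hax, a, -, hna, rfl⟩ := ht
        exact (hsub (a := ⟨ax.head, a⟩) ⟨⟨ax, hax, rfl⟩, hna⟩).2 (State.setTrue_self s _ _)
      obtain ⟨r, hr⟩ := ih _ (hn ▸ hlt) t rfl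
      exact ⟨r, .head ht hr.1, hr.2⟩
    · exact ⟨s, .refl, fun t ht => h ⟨t, ht⟩⟩

/-! ### Runs of programs -/

/-- Indexing the intermediate states lets two runs be compared stratum by stratum. -/
theorem Program.runStrata_iff {I : V.Const → O} (P : Program V) (s t : State V O) :
    P.RunStrata I s t ↔ ∃ f : ℕ → State V O, f 0 = s ∧ f P.length = t ∧
      ∀ i (h : i < P.length), Stratum.Extends I P[i] (f i) (f (i + 1)) := by
  induction P generalizing s with
  | nil =>
    constructor
    · rintro rfl
      exact ⟨fun _ => t, rfl, rfl, fun i h => absurd h (by simp)⟩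
    · rintro ⟨f, rfl, rfl, -⟩
      rfl
  | cons S P ih =>
    constructor
    · rintro ⟨s', h, h'⟩
      obtain ⟨f, hf0, hfl, hf⟩ := (ih s').1 h'
      refine ⟨fun i => Nat.casesOn i s f, rfl, hfl, fun i hi => ?_⟩
      cases i with
      | zero => simpa [hf0] using h
      | succ i => exact hf i (by simpa using hi)
    · rintro ⟨f, rfl, rfl, hf⟩
      exact ⟨f 1, hf 0 (by simp), (ih _).2 ⟨fun i => f (i + 1), rfl, rfl,
        fun i hi => hf (i + 1) (by simpa using hi)⟩⟩

theorem Program.IsStratified.posAffected {P : Program V} (hP : P.IsStratified) {i : ℕ}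
    (hi : i < P.length) : Stratum.PosAffected P[i] := fun ax hax p hp hn =>
  lt_irrefl _ ((hP ⟨i, hi⟩ ax hax).2.2.2 p hn ⟨i, hi⟩ hp)

theorem Program.IsStratified.affects_unique {P : Program V} (hP : P.IsStratified) {i j : ℕ}
    (hi : i < P.length) (hj : j < P.length) {p : V.Pred} (h : Stratum.Affects P[i] p)
    (h' : Stratum.Affects P[j] p) : i = j := by
  obtain ⟨ax, hax, rfl⟩ := h
  by_contra hne
  exact (hP ⟨i, hi⟩ ax hax).1 ⟨j, hj⟩ (fun h => hne (Fin.mk.inj h).symm) h'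

theorem Program.runStrata_exists [Finite O] (I : V.Const → O) (P : Program V) (s : State V O) :
    ∃ t, P.RunStrata I s t := by
  induction P generalizing s with
  | nil => exact ⟨s, rfl⟩
  | cons S P ih =>
    obtain ⟨s', h⟩ := Stratum.exists_extends I S s
    obtain ⟨t, ht⟩ := ih s'
    exact ⟨t, s', h, ht⟩

theorem Program.runStrata_unique {I : V.Const → O} {P : Program V}
    (hP : ∀ S ∈ P, Stratum.PosAffected S) {s t t' : State V O}
    (h : P.RunStrata I s t) (h' : P.RunStrata I s t') : t = t' := by
  induction P generalizing s with
  | nil => exact Eq.trans h (Eq.symm h')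
  | cons S P ih =>
    obtain ⟨s₁, h1, h2⟩ := h
    obtain ⟨s₂, h1', h2'⟩ := h'
    obtain rfl := h1.unique (hP S (by simp)) h1'
    exact ih (fun T hT => hP T (by simp [hT])) h2 h2'

theorem Program.IsStratified.extends_unique {I : V.Const → O} {P : Program V}
    (hP : P.IsStratified) {s t t' : State V O} (h : P.Extends I s t) (h' : P.Extends I s t') :
    t = t' := by
  refine Program.runStrata_unique (fun S hS => ?_) h h'
  obtain ⟨i, hi, rfl⟩ := List.getElem_of_mem hS
  exact hP.posAffected hi

theorem Program.derived_of_affects {P : Program V} {i : ℕ} (hi : i < P.length) {p : V.Pred}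
    (h : Stratum.Affects P[i] p) : P.Derived p :=
  ⟨P[i], List.getElem_mem hi, h⟩

theorem Program.Derived.exists_index {P : Program V} {p : V.Pred} (h : P.Derived p) :
    ∃ (i : ℕ) (hi : i < P.length), Stratum.Affects P[i] p := by
  obtain ⟨S, hS, h⟩ := h
  obtain ⟨i, hi, rfl⟩ := List.getElem_of_mem hS
  exact ⟨i, hi, h⟩

theorem Program.merge_affects {P : Program V} {p : V.Pred} :
    Stratum.Affects P.flatten p ↔ P.Derived p := by
  constructor
  · rintro ⟨ax, hax, rfl⟩
    obtain ⟨S, hS, hax⟩ := List.mem_flatten.1 hax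
    exact ⟨S, hS, ax, hax, rfl⟩
  · rintro ⟨S, hS, ax, hax, rfl⟩
    exact ⟨ax, List.mem_flatten.2 ⟨S, hS, hax⟩, rfl⟩

theorem Program.merge_derived {P : Program V} {p : V.Pred} : P.merge.Derived p ↔ P.Derived p := by
  rw [← Program.merge_affects (P := P)]
  constructor
  · rintro ⟨S, hS, h⟩
    rw [List.mem_singleton.1 hS] at h
    exact h
  · exact fun h => ⟨_, List.mem_singleton.2 rfl, h⟩

theorem Program.NoNegDerived.merge {P : Program V} (h : P.NoNegDerived) :
    P.merge.NoNegDerived := by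
  intro S hS ax hax p hp
  rw [List.mem_singleton.1 hS] at hax
  obtain ⟨T, hT, hax⟩ := List.mem_flatten.1 hax
  exact h T hT ax hax p (Program.merge_derived.1 hp)

/-- With a single stratum, only the condition on negative occurrences is not automatic, and it is
vacuous here. -/
theorem Program.NoNegDerived.merge_isStratified {P : Program V} (h : P.NoNegDerived) :
    P.merge.IsStratified := by
  have hsub : ∀ i j : Fin P.merge.length, i = j := by
    intro i j
    have hi := i.2
    have hj := j.2
    simp only [Program.merge, List.length_singleton] at hi hj
    exact Fin.ext (by omega)
  intro i ax hax
  refine ⟨fun k hk => absurd (hsub _ _) hk, fun k hk => absurd hk (hsub k i ▸ lt_irrefl _),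
    fun p _ j _ => (hsub j i).le, fun p hp j hj => ?_⟩
  exact absurd hp (h.merge _ (List.get_mem _ _) ax hax p ⟨_, List.get_mem _ _, hj⟩)

section Runs

variable {I : V.Const → O} {P : Program V} {f : ℕ → State V O}

theorem Program.run_mono (hf : ∀ i (h : i < P.length), Stratum.Extends I P[i] (f i) (f (i + 1)))
    {i j : ℕ} (hij : i ≤ j) (hj : j ≤ P.length) (p : V.Pred) (a : Fin (V.arity p) → O)
    (h : f i p a) : f j p a := by
  induction j, hij using Nat.le_induction with
  | base => exact h
  | succ j hij ih => exact Stratum.path_mono (hf j hj).1 p a (ih (Nat.le_of_succ_le hj))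

theorem Program.run_unaffected
    (hf : ∀ i (h : i < P.length), Stratum.Extends I P[i] (f i) (f (i + 1)))
    {i j : ℕ} (hij : i ≤ j) (hj : j ≤ P.length) {p : V.Pred}
    (hp : ∀ k (hk : k < P.length), i ≤ k → k < j → ¬ Stratum.Affects P[k] p)
    (a : Fin (V.arity p) → O) : f j p a ↔ f i p a := by
  induction j, hij using Nat.le_induction with
  | base => rfl
  | succ j hij ih =>
    exact (Stratum.path_unaffected (hf j hj).1 (hp j hj hij (Nat.lt_succ_self j)) a).trans
      (ih (Nat.le_of_succ_le hj) fun k hk h h' => hp k hk h (Nat.lt_succ_of_lt h'))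

/-- The analysis of stages needs all atoms of the affected predicates to be false when their stratum
begins. -/
theorem Program.run_not_yet (hP : P.IsStratified) {s : State V O} (h0 : f 0 = P.initial s)
    (hf : ∀ i (h : i < P.length), Stratum.Extends I P[i] (f i) (f (i + 1)))
    {i : ℕ} (hi : i < P.length) {p : V.Pred} (hp : Stratum.Affects P[i] p)
    (a : Fin (V.arity p) → O) : ¬ f i p a := by
  rw [Program.run_unaffected hf (Nat.zero_le i) hi.le, h0]
  · exact fun h => h.2 (Program.derived_of_affects hi hp)
  · intro k hk _ hki h
    exact hki.ne (hP.affects_unique hk hi h hp)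

/-- A body that is true at the end was already true right after its own stratum: its positive
predicates are affected by no later stratum, and its negative ones can only have grown. -/
theorem Program.run_closed (hP : P.IsStratified)
    (hf : ∀ i (h : i < P.length), Stratum.Extends I P[i] (f i) (f (i + 1))) :
    Stratum.Closed I P.flatten (f P.length) := by
  intro ax hax a ha
  obtain ⟨S, hS, hax⟩ := List.mem_flatten.1 hax
  obtain ⟨i, hi, rfl⟩ := List.getElem_of_mem hS
  refine Program.run_mono hf (Nat.succ_le_of_lt hi) le_rfl _ _
    ((hf i hi).closed ax hax a (Formula.Holds.mono ?_ ?_ ha))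
  · intro p hp b hb
    refine (Program.run_unaffected hf (Nat.succ_le_of_lt hi) le_rfl (fun k hk hik _ h => ?_) b).1 hb
    exact absurd (Fin.mk_le_mk.1 ((hP ⟨i, hi⟩ ax hax).2.2.1 p hp ⟨k, hk⟩ h)) (by omega)
  · exact fun p _ b => Program.run_mono hf (Nat.succ_le_of_lt hi) le_rfl p b

/-- If no derived predicate occurs negatively, then the strata may be merged. -/
theorem Program.Extends.merge [Finite O] (hP : P.IsStratified) (hN : P.NoNegDerived)
    {s t : State V O} (h : P.Extends I s t) : P.merge.Extends I s t := by
  obtain ⟨t', ht'⟩ := Program.runStrata_exists I P.merge (P.merge.initial s)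
  suffices t = t' by rw [this]; exact ht'
  have hinit : P.merge.initial s = P.initial s := by
    funext p a
    exact propext (and_congr_right fun _ => not_congr Program.merge_derived)
  obtain ⟨f, h0, rfl, hf⟩ := (Program.runStrata_iff _ _ _).1 h
  obtain ⟨r, hr, rfl⟩ := ht'
  rw [hinit] at hr
  have hN' : ∀ ax ∈ P.flatten, ∀ p, P.Derived p → ¬ ax.body.OccursNeg p := by
    intro ax hax p hp
    obtain ⟨S, hS, hax⟩ := List.mem_flatten.1 hax
    exact hN S hS ax hax p hp
  have hr' : ∀ p, ¬ P.Derived p → ∀ a, (t' p a ↔ P.initial s p a) := fun p hp a =>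
    Stratum.path_unaffected hr.1 (fun h => hp (Program.merge_affects.1 h)) a
  -- The merged result is closed under each stratum, so by minimality no intermediate state leaves
  -- it.
  have hle : ∀ i, i ≤ P.length → ∀ p a, f i p a → t' p a := by
    intro i
    induction i with
    | zero =>
      intro _
      rw [h0]
      exact Stratum.path_mono hr.1
    | succ i ih =>
      intro hi
      refine Stratum.path_le P.Derived (hN P[i] (List.getElem_mem hi)) (ih (Nat.le_of_succ_le hi))
        (fun p hp a h => ?_) (fun ax hax => hr.closed ax ?_) (hf i hi).1
      · rw [hr' p hp, ← h0] at h
        exact Program.run_mono hf (Nat.zero_le i) (Nat.le_of_succ_le hi) p a h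
      · exact List.mem_flatten.2 ⟨_, List.getElem_mem hi, hax⟩
  funext p a
  -- For the converse, the end of the stratified run is closed under all axioms and hence contains
  -- everything that the merged run derives.
  refine propext ⟨hle _ le_rfl p a, ?_⟩
  refine Stratum.path_le P.Derived hN' (fun p a h => ?_) (fun p hp a => ?_)
    (Program.run_closed hP hf) hr.1 p a
  · rw [← h0] at h
    exact Program.run_mono hf (Nat.zero_le _) le_rfl p a h
  · rw [Program.run_unaffected hf (Nat.zero_le _) le_rfl, h0]
    · exact id
    · exact fun k hk _ _ h => hp (Program.derived_of_affects hk h)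

end Runs

end Semantics

/-! ### Truth of substituted formulas and of the bodies of stage axioms. -/

section Substitution

variable {V : Vocabulary.{u, v}} {O : Type w}

/-! ### Truth of compound formulas -/

theorem Formula.holds_exN {I : V.Const → O} {s : State V O} {n : ℕ} (k : ℕ)
    (φ : Formula V (n + k)) (a : Fin n → O) :
    (Formula.exN k φ).Holds I s a ↔ ∃ b : Fin k → O, φ.Holds I s (Fin.append a b) := by
  induction k with
  | zero =>
    have : ∀ b : Fin 0 → O, Fin.append a b = a := fun b => by
      rw [Subsingleton.elim b Fin.elim0, Fin.append_elim0]
      rfl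
    constructor
    · intro h
      exact ⟨Fin.elim0, (this _).symm ▸ h⟩
    · rintro ⟨b, h⟩
      exact this b ▸ h
  | succ k ih =>
    refine (ih (.ex φ)).trans ⟨?_, ?_⟩
    · rintro ⟨b, o, h⟩
      refine ⟨Fin.snoc (α := fun _ => O) b o, ?_⟩
      rw [Fin.append_snoc]
      exact h
    · rintro ⟨b, h⟩
      refine ⟨Fin.init (α := fun _ => O) b, b (Fin.last k), ?_⟩
      rw [← Fin.snoc_init_self b, Fin.append_snoc] at h
      exact h

theorem Formula.holds_allN {I : V.Const → O} {s : State V O} {n : ℕ} (k : ℕ)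
    (φ : Formula V (n + k)) (a : Fin n → O) :
    (Formula.allN k φ).Holds I s a ↔ ∀ b : Fin k → O, φ.Holds I s (Fin.append a b) := by
  induction k with
  | zero =>
    have : ∀ b : Fin 0 → O, Fin.append a b = a := fun b => by
      rw [Subsingleton.elim b Fin.elim0, Fin.append_elim0]
      rfl
    constructor
    · intro h b
      exact (this _).symm ▸ h
    · intro h
      exact this Fin.elim0 ▸ h Fin.elim0
  | succ k ih =>
    refine (ih (.all φ)).trans ⟨?_, ?_⟩
    · intro h b
      rw [← Fin.snoc_init_self b, Fin.append_snoc]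
      exact h _ _
    · intro h b o
      have := h (Fin.snoc (α := fun _ => O) b o)
      rw [Fin.append_snoc] at this
      exact this

theorem Formula.holds_bigOr {I : V.Const → O} {s : State V O} {n : ℕ} {α : Type u} (l : List α)
    (f : α → Formula V n) (a : Fin n → O) :
    (bigOr l f).Holds I s a ↔ ∃ k ∈ l, (f k).Holds I s a := by
  induction l with
  | nil => exact ⟨fun h => h.elim, fun ⟨_, h, _⟩ => absurd h (by simp)⟩
  | cons k l ih =>
    simp only [List.mem_cons, exists_eq_or_imp, ← ih]
    rfl

theorem Formula.holds_bigAnd {I : V.Const → O} {s : State V O} {n : ℕ} {α : Type u} (l : List α)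
    (f : α → Formula V n) (a : Fin n → O) :
    (bigAnd l f).Holds I s a ↔ ∀ k ∈ l, (f k).Holds I s a := by
  induction l with
  | nil => exact ⟨fun _ _ h => absurd h (by simp), fun _ => trivial⟩
  | cons k l ih =>
    rw [List.forall_mem_cons, ← ih]
    rfl

/-- The equality of dependent pairs replaces the transport along `ax.head = i` in the definition, so
that later uses need only `cases`. -/
theorem Stratum.holds_bodyOf {I : V.Const → O} {s : State V O} (S : Stratum V) (i : V.Pred)
    (a : Fin (V.arity i) → O) :
    (S.bodyOf i).Holds I s a ↔ ∃ ax ∈ S, ∃ b : Fin (V.arity ax.head) → O,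
      (⟨i, a⟩ : (p : V.Pred) × (Fin (V.arity p) → O)) = ⟨ax.head, b⟩ ∧ ax.body.Holds I s b := by
  induction S with
  | nil => exact ⟨fun h => h.elim, fun ⟨_, h, _⟩ => absurd h (by simp)⟩
  | cons ax S ih =>
    simp only [List.mem_cons, exists_eq_or_imp, ← ih]
    by_cases h : ax.head = i
    · subst h
      have : Stratum.bodyOf (ax :: S) ax.head = .or ax.body (Stratum.bodyOf S ax.head) := by
        simp [Stratum.bodyOf]
      rw [this]
      refine or_congr ⟨fun h => ⟨a, rfl, h⟩, ?_⟩ Iff.rfl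
      rintro ⟨b, hb, h⟩
      cases hb
      exact h
    · have : Stratum.bodyOf (ax :: S) i = Stratum.bodyOf S i := by
        simp [Stratum.bodyOf, h]
      rw [this]
      refine ⟨.inr, ?_⟩
      rintro (⟨b, hb, -⟩ | h')
      · exact absurd (congrArg Sigma.fst hb).symm h
      · exact h'

/-! ### Truth and substitution -/

theorem Term.eval_lift {I : V.Const → O} {n : ℕ} (t : Term V n) (a : Fin n → O) (o : O) :
    t.lift.eval I (Fin.snoc (α := fun _ : Fin (n + 1) => O) a o) = t.eval I a := by
  cases t with
  | var i => exact Fin.snoc_castSucc (α := fun _ : Fin (n + 1) => O) o a i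
  | const c => rfl

theorem Term.eval_subst {I : V.Const → O} {n m : ℕ} (ρ : Fin n → Term (stageVocab V) m)
    (t : Term V n) (a : Fin m → O) :
    (t.subst ρ).eval (V := stageVocab V) I a =
      t.eval I (fun i => (ρ i).eval (V := stageVocab V) I a) := by
  cases t <;> rfl

theorem Term.eval_snoc_lift {I : V.Const → O} {n m : ℕ} (ρ : Fin n → Term (stageVocab V) m)
    (a : Fin m → O) (o : O) :
    (fun i => ((Fin.snoc (α := fun _ : Fin (n + 1) => Term (stageVocab V) (m + 1))
        (fun i => (ρ i).lift) (.var (Fin.last m)) : Fin (n + 1) → Term (stageVocab V) (m + 1))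
          i).eval (V := stageVocab V) I (Fin.snoc (α := fun _ : Fin (m + 1) => O) a o)) =
      Fin.snoc (α := fun _ : Fin (n + 1) => O)
        (fun i => (ρ i).eval (V := stageVocab V) I a) o := by
  funext i
  refine Fin.lastCases ?_ (fun i => ?_) i
  · rw [Fin.snoc_last, Fin.snoc_last]
    exact Fin.snoc_last (α := fun _ : Fin (m + 1) => O) o a
  · rw [Fin.snoc_castSucc, Fin.snoc_castSucc]
    exact Term.eval_lift (V := stageVocab V) _ a o

/-- The parameter terms `y` are lifted under quantifiers, but their value `Y` never changes. It is
therefore enough that `f` is correct for this one value, and the substitution amounts to evaluation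
in another state `s`. -/
theorem Formula.holds_replace {I : V.Const → O} {s' : State (stageVocab V) O} {s : State V O}
    {k : ℕ} {Y : Fin k → O}
    {f : {m : ℕ} → (p : V.Pred) → (Fin (V.arity p) → Term (stageVocab V) m) →
      (Fin k → Term (stageVocab V) m) → Formula (stageVocab V) m}
    (hf : ∀ {m : ℕ} (p : V.Pred) (t : Fin (V.arity p) → Term (stageVocab V) m)
      (y : Fin k → Term (stageVocab V) m) (a : Fin m → O),
      (fun i => (y i).eval (V := stageVocab V) I a) = Y →
      ((f p t y).Holds (V := stageVocab V) I s' a ↔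
        s p (fun i => (t i).eval (V := stageVocab V) I a)))
    {n m : ℕ} (φ : Formula V n) (ρ : Fin n → Term (stageVocab V) m)
    (y : Fin k → Term (stageVocab V) m) (a : Fin m → O)
    (hy : (fun i => (y i).eval (V := stageVocab V) I a) = Y) :
    (φ.replace f ρ y).Holds (V := stageVocab V) I s' a ↔
      φ.Holds I s (fun i => (ρ i).eval (V := stageVocab V) I a) := by
  induction φ generalizing m with
  | falsum => rfl
  | verum => rfl
  | atom p ts =>
    refine (hf p _ y a hy).trans (iff_of_eq (congrArg (s p) ?_))
    funext i
    exact Term.eval_subst ρ (ts i) a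
  | eq t t' =>
    refine iff_of_eq ?_
    show (_ = _) = (_ = _)
    rw [Term.eval_subst, Term.eval_subst]
  | neg φ ih => exact not_congr (ih ρ y a hy)
  | and φ ψ ih ih' => exact and_congr (ih ρ y a hy) (ih' ρ y a hy)
  | or φ ψ ih ih' => exact or_congr (ih ρ y a hy) (ih' ρ y a hy)
  | all φ ih =>
    refine forall_congr' fun o => ?_
    rw [ih, Term.eval_snoc_lift]
    rw [← hy]
    funext i
    exact Term.eval_lift (V := stageVocab V) _ a o
  | ex φ ih =>
    refine exists_congr fun o => ?_
    rw [ih, Term.eval_snoc_lift]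
    rw [← hy]
    funext i
    exact Term.eval_lift (V := stageVocab V) _ a o

theorem Formula.holds_embed {I : V.Const → O} {s : State (stageVocab V) O} {n : ℕ}
    (φ : Formula V n) (a : Fin n → O) :
    φ.embed.Holds (V := stageVocab V) I s a ↔ φ.Holds I s.restrict a :=
  Formula.holds_replace (Y := Fin.elim0) (fun _ _ _ _ _ => Iff.rfl) φ Term.var Fin.elim0 a
    (Subsingleton.elim _ _)

/-- The values of the binary stage relation `r` with second argument `P_j(y)` as values of the
predicates in `A`; other predicates keep their values. -/
def State.slice (s : State (stageVocab V) O) (A : List V.Pred)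
    (r : (p : V.Pred) → (Fin (V.arity p) → O) → Prop) : State V O :=
  fun p z => (p ∈ A ∧ r p z) ∨ (p ∉ A ∧ s (StagePred.orig p) z)

theorem State.slice_iff_of_mem {s : State (stageVocab V) O} {A : List V.Pred}
    {r : (p : V.Pred) → (Fin (V.arity p) → O) → Prop} {p : V.Pred} (hp : p ∈ A)
    (z : Fin (V.arity p) → O) : s.slice A r p z ↔ r p z := by
  simp [State.slice, hp]

theorem State.slice_iff_of_not_mem {s : State (stageVocab V) O} {A : List V.Pred}
    {r : (p : V.Pred) → (Fin (V.arity p) → O) → Prop} {p : V.Pred} (hp : p ∉ A)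
    (z : Fin (V.arity p) → O) : s.slice A r p z ↔ s (StagePred.orig p) z := by
  simp [State.slice, hp]

variable {I : V.Const → O} {s : State (stageVocab V) O} {n m : ℕ} {A : List V.Pred} {j : V.Pred}

theorem Term.eval_append {k l : ℕ} (x : Fin k → Term V n) (y : Fin l → Term V n)
    (a : Fin n → O) :
    (fun i => (Fin.append x y i).eval I a) =
      Fin.append (fun i => (x i).eval I a) (fun i => (y i).eval I a) := by
  funext i
  refine Fin.addCases (fun i => ?_) (fun i => ?_) i
  · rw [Fin.append_left, Fin.append_left]
  · rw [Fin.append_right, Fin.append_right]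

/-- The value of a binary stage predicate on a pair of tuples. -/
def State.lt (s : State (stageVocab V) O) (i j : V.Pred) (x : Fin (V.arity i) → O)
    (y : Fin (V.arity j) → O) : Prop := s (StagePred.lt i j) (Fin.append x y)

/-- The value of a binary stage predicate on a pair of tuples. -/
def State.le (s : State (stageVocab V) O) (i j : V.Pred) (x : Fin (V.arity i) → O)
    (y : Fin (V.arity j) → O) : Prop := s (StagePred.le i j) (Fin.append x y)

/-- The value of a binary stage predicate on a pair of tuples. -/
def State.nlt (s : State (stageVocab V) O) (i j : V.Pred) (x : Fin (V.arity i) → O)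
    (y : Fin (V.arity j) → O) : Prop := s (StagePred.nlt i j) (Fin.append x y)

/-- The value of a binary stage predicate on a pair of tuples. -/
def State.nle (s : State (stageVocab V) O) (i j : V.Pred) (x : Fin (V.arity i) → O)
    (y : Fin (V.arity j) → O) : Prop := s (StagePred.nle i j) (Fin.append x y)

/-- The value of a binary stage predicate on a pair of tuples. -/
def State.tri (s : State (stageVocab V) O) (i j : V.Pred) (x : Fin (V.arity i) → O)
    (y : Fin (V.arity j) → O) : Prop := s (StagePred.tri i j) (Fin.append x y)

theorem holds_ltAtom {i j : V.Pred} (x : Fin (V.arity i) → Term (stageVocab V) m)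
    (y : Fin (V.arity j) → Term (stageVocab V) m) (a : Fin m → O) :
    (ltAtom i j x y).Holds (V := stageVocab V) I s a ↔
      s.lt i j (fun i => (x i).eval (V := stageVocab V) I a)
        (fun i => (y i).eval (V := stageVocab V) I a) :=
  iff_of_eq (congrArg (s (StagePred.lt i j)) (Term.eval_append (V := stageVocab V) x y a))

theorem holds_leAtom {i j : V.Pred} (x : Fin (V.arity i) → Term (stageVocab V) m)
    (y : Fin (V.arity j) → Term (stageVocab V) m) (a : Fin m → O) :
    (leAtom i j x y).Holds (V := stageVocab V) I s a ↔
      s.le i j (fun i => (x i).eval (V := stageVocab V) I a)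
        (fun i => (y i).eval (V := stageVocab V) I a) :=
  iff_of_eq (congrArg (s (StagePred.le i j)) (Term.eval_append (V := stageVocab V) x y a))

theorem holds_nltAtom {i j : V.Pred} (x : Fin (V.arity i) → Term (stageVocab V) m)
    (y : Fin (V.arity j) → Term (stageVocab V) m) (a : Fin m → O) :
    (nltAtom i j x y).Holds (V := stageVocab V) I s a ↔
      s.nlt i j (fun i => (x i).eval (V := stageVocab V) I a)
        (fun i => (y i).eval (V := stageVocab V) I a) :=
  iff_of_eq (congrArg (s (StagePred.nlt i j)) (Term.eval_append (V := stageVocab V) x y a))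

theorem holds_nleAtom {i j : V.Pred} (x : Fin (V.arity i) → Term (stageVocab V) m)
    (y : Fin (V.arity j) → Term (stageVocab V) m) (a : Fin m → O) :
    (nleAtom i j x y).Holds (V := stageVocab V) I s a ↔
      s.nle i j (fun i => (x i).eval (V := stageVocab V) I a)
        (fun i => (y i).eval (V := stageVocab V) I a) :=
  iff_of_eq (congrArg (s (StagePred.nle i j)) (Term.eval_append (V := stageVocab V) x y a))

theorem holds_triAtom {i j : V.Pred} (x : Fin (V.arity i) → Term (stageVocab V) m)
    (y : Fin (V.arity j) → Term (stageVocab V) m) (a : Fin m → O) :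
    (triAtom i j x y).Holds (V := stageVocab V) I s a ↔
      s.tri i j (fun i => (x i).eval (V := stageVocab V) I a)
        (fun i => (y i).eval (V := stageVocab V) I a) :=
  iff_of_eq (congrArg (s (StagePred.tri i j)) (Term.eval_append (V := stageVocab V) x y a))

theorem Formula.holds_withLt (φ : Formula V n) (x : Fin n → Term (stageVocab V) m)
    (y : Fin (V.arity j) → Term (stageVocab V) m) (a : Fin m → O) :
    (φ.withLt A j x y).Holds (V := stageVocab V) I s a ↔
      φ.Holds I
        (s.slice A fun p z => s.lt p j z (fun i => (y i).eval (V := stageVocab V) I a))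
        (fun i => (x i).eval (V := stageVocab V) I a) := by
  refine Formula.holds_replace (fun p t y' a' h => ?_) φ x y a rfl
  by_cases hp : p ∈ A
  · rw [if_pos hp, State.slice_iff_of_mem hp, ← h, holds_ltAtom]
  · rw [if_neg hp, State.slice_iff_of_not_mem hp]
    rfl

theorem Formula.holds_withLe (φ : Formula V n) (x : Fin n → Term (stageVocab V) m)
    (y : Fin (V.arity j) → Term (stageVocab V) m) (a : Fin m → O) :
    (φ.withLe A j x y).Holds (V := stageVocab V) I s a ↔
      φ.Holds I
        (s.slice A fun p z => s.le p j z (fun i => (y i).eval (V := stageVocab V) I a))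
        (fun i => (x i).eval (V := stageVocab V) I a) := by
  refine Formula.holds_replace (fun p t y' a' h => ?_) φ x y a rfl
  by_cases hp : p ∈ A
  · rw [if_pos hp, State.slice_iff_of_mem hp, ← h, holds_leAtom]
  · rw [if_neg hp, State.slice_iff_of_not_mem hp]
    rfl

theorem Formula.holds_withNotNlt (φ : Formula V n) (x : Fin n → Term (stageVocab V) m)
    (y : Fin (V.arity j) → Term (stageVocab V) m) (a : Fin m → O) :
    (φ.withNotNlt A j x y).Holds (V := stageVocab V) I s a ↔
      φ.Holds I
        (s.slice A fun p z => ¬ s.nlt p j z (fun i => (y i).eval (V := stageVocab V) I a))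
        (fun i => (x i).eval (V := stageVocab V) I a) := by
  refine Formula.holds_replace (fun p t y' a' h => ?_) φ x y a rfl
  by_cases hp : p ∈ A
  · rw [if_pos hp, State.slice_iff_of_mem hp, ← h]
    exact not_congr (holds_nltAtom t y' a')
  · rw [if_neg hp, State.slice_iff_of_not_mem hp]
    rfl

theorem Formula.holds_withNotNle (φ : Formula V n) (x : Fin n → Term (stageVocab V) m)
    (y : Fin (V.arity j) → Term (stageVocab V) m) (a : Fin m → O) :
    (φ.withNotNle A j x y).Holds (V := stageVocab V) I s a ↔
      φ.Holds I
        (s.slice A fun p z => ¬ s.nle p j z (fun i => (y i).eval (V := stageVocab V) I a))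
        (fun i => (x i).eval (V := stageVocab V) I a) := by
  refine Formula.holds_replace (fun p t y' a' h => ?_) φ x y a rfl
  by_cases hp : p ∈ A
  · rw [if_pos hp, State.slice_iff_of_mem hp, ← h]
    exact not_congr (holds_nleAtom t y' a')
  · rw [if_neg hp, State.slice_iff_of_not_mem hp]
    rfl

theorem Formula.holds_withBot (φ : Formula V n) (x : Fin n → Term (stageVocab V) m)
    (a : Fin m → O) :
    (φ.withBot A x).Holds (V := stageVocab V) I s a ↔
      φ.Holds I (s.slice A fun _ _ => False)
        (fun i => (x i).eval (V := stageVocab V) I a) := by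
  refine Formula.holds_replace (Y := Fin.elim0) (fun p t y' a' h => ?_) φ x Fin.elim0 a
    (Subsingleton.elim _ _)
  by_cases hp : p ∈ A
  · rw [if_pos hp, State.slice_iff_of_mem hp]
    rfl
  · rw [if_neg hp, State.slice_iff_of_not_mem hp]
    rfl

theorem Stratum.mem_affected {S : Stratum V} {p : V.Pred} :
    p ∈ S.affected ↔ Stratum.Affects S p := by
  simp [Stratum.affected, Stratum.Affects]

/-! ### Truth of the bodies of the stage axioms -/

theorem append_fun_left {α : Type*} {k l : ℕ} (x : Fin k → α) (y : Fin l → α) :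
    (fun i => Fin.append x y (Fin.castAdd l i)) = x :=
  funext fun i => Fin.append_left x y i

theorem append_fun_right {α : Type*} {k l : ℕ} (x : Fin k → α) (y : Fin l → α) :
    (fun i => Fin.append x y (Fin.natAdd k i)) = y :=
  funext fun i => Fin.append_right x y i

theorem append_fun_left_left {α : Type*} {k l m : ℕ} (x : Fin k → α) (y : Fin l → α)
    (z : Fin m → α) :
    (fun i => Fin.append (Fin.append x y) z (Fin.castAdd m (Fin.castAdd l i))) = x :=
  funext fun i => (Fin.append_left _ z _).trans (Fin.append_left x y i)

theorem append_fun_left_right {α : Type*} {k l m : ℕ} (x : Fin k → α) (y : Fin l → α)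
    (z : Fin m → α) :
    (fun i => Fin.append (Fin.append x y) z (Fin.castAdd m (Fin.natAdd k i))) = y :=
  funext fun i => (Fin.append_left _ z _).trans (Fin.append_right x y i)

variable {S : Stratum V} {l : ℕ} {i : V.Pred}

theorem holds_ltAxiom (x : Fin (V.arity i) → O) (y : Fin (V.arity j) → O) :
    (ltAxiom S i j).body.Holds (V := stageVocab V) I s (Fin.append x y) ↔
      ∃ k ∈ S.affected, ∃ z : Fin (V.arity k) → O, s.le i k x z ∧ s.tri k j z y := by
  refine (Formula.holds_bigOr (V := stageVocab V) _ _ _).trans (exists_congr fun k =>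
    and_congr_right fun _ => (Formula.holds_exN (V := stageVocab V) _ _ _).trans
      (exists_congr fun z => and_congr ((holds_leAtom _ _ _).trans ?_)
        ((holds_triAtom _ _ _).trans ?_)))
  · exact iff_of_eq (congrArg₂ (s.le i k) (append_fun_left_left x y z) (append_fun_right _ z))
  · exact iff_of_eq (congrArg₂ (s.tri k j) (append_fun_right _ z) (append_fun_left_right x y z))

theorem holds_leAxiom (x : Fin (V.arity i) → O) (y : Fin (V.arity j) → O) :
    (leAxiom S i j).body.Holds (V := stageVocab V) I s (Fin.append x y) ↔
      (S.bodyOf i).Holds I (s.slice S.affected fun p z => s.lt p j z y) x :=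
  (Formula.holds_withLt _ _ _ _).trans (iff_of_eq (congrArg₂
    (fun X Y => (S.bodyOf i).Holds I (s.slice S.affected fun p z => s.lt p j z Y) X)
    (append_fun_left x y) (append_fun_right x y)))

theorem holds_nltAxiom (x : Fin (V.arity i) → O) (y : Fin (V.arity j) → O) :
    (nltAxiom l S i j).body.Holds (V := stageVocab V) I s (Fin.append x y) ↔
      (S.bodyOf j).Holds I (s.slice S.affected fun _ _ => False) y ∨
      (∃ k ∈ S.affected, ∃ z : Fin (V.arity k) → O, s.nle i k x z ∧ s.tri k j z y) ∨
      s (StagePred.none l) Fin.elim0 := by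
  refine or_congr ((Formula.holds_withBot _ _ _).trans ?_) (or_congr
    ((Formula.holds_bigOr (V := stageVocab V) _ _ _).trans (exists_congr fun k =>
    and_congr_right fun _ => (Formula.holds_exN (V := stageVocab V) _ _ _).trans
      (exists_congr fun z => and_congr ((holds_nleAtom _ _ _).trans ?_)
        ((holds_triAtom _ _ _).trans ?_))))
    (iff_of_eq (congrArg (s (StagePred.none l)) (Subsingleton.elim (α := Fin 0 → O) _ _))))
  · exact iff_of_eq (congrArg ((S.bodyOf j).Holds I _) (append_fun_right x y))
  · exact iff_of_eq (congrArg₂ (s.nle i k) (append_fun_left_left x y z) (append_fun_right _ z))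
  · exact iff_of_eq (congrArg₂ (s.tri k j) (append_fun_right _ z) (append_fun_left_right x y z))

theorem holds_nleAxiom (x : Fin (V.arity i) → O) (y : Fin (V.arity j) → O) :
    (nleAxiom S i j).body.Holds (V := stageVocab V) I s (Fin.append x y) ↔
      ¬ (S.bodyOf i).Holds I (s.slice S.affected fun p z => ¬ s.nlt p j z y) x :=
  not_congr ((Formula.holds_withNotNlt _ _ _ _).trans (iff_of_eq (congrArg₂
    (fun X Y => (S.bodyOf i).Holds I (s.slice S.affected fun p z => ¬ s.nlt p j z Y) X)
    (append_fun_left x y) (append_fun_right x y))))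

theorem holds_triAxiom (x : Fin (V.arity i) → O) (y : Fin (V.arity j) → O) :
    (triAxiom S i j).body.Holds (V := stageVocab V) I s (Fin.append x y) ↔
      (S.bodyOf i).Holds I (s.slice S.affected fun p z => s.lt p i z x) x ∧
      ¬ (S.bodyOf j).Holds I (s.slice S.affected fun p z => ¬ s.nlt p i z x) y ∧
      ((S.bodyOf j).Holds I (s.slice S.affected fun p z => s.le p i z x) y ∨
        s (StagePred.fix i) x) := by
  refine and_congr ((Formula.holds_withLt _ _ _ _).trans ?_) (and_congr
    (not_congr ((Formula.holds_withNotNlt _ _ _ _).trans ?_)) (or_congr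
    ((Formula.holds_withLe _ _ _ _).trans ?_)
    (iff_of_eq (congrArg (s (StagePred.fix i)) (append_fun_left x y)))))
  · exact iff_of_eq (congrArg₂
      (fun X Y => (S.bodyOf i).Holds I (s.slice S.affected fun p z => s.lt p i z Y) X)
      (append_fun_left x y) (append_fun_left x y))
  · exact iff_of_eq (congrArg₂
      (fun X Y => (S.bodyOf j).Holds I (s.slice S.affected fun p z => ¬ s.nlt p i z Y) X)
      (append_fun_right x y) (append_fun_left x y))
  · exact iff_of_eq (congrArg₂
      (fun X Y => (S.bodyOf j).Holds I (s.slice S.affected fun p z => s.le p i z Y) X)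
      (append_fun_right x y) (append_fun_left x y))

theorem holds_noneAxiom (a : Fin 0 → O) :
    (noneAxiom l S).body.Holds (V := stageVocab V) I s a ↔
      ∀ k ∈ S.affected, ∀ z : Fin (V.arity k) → O,
        ¬ (S.bodyOf k).Holds I (s.slice S.affected fun _ _ => False) z := by
  refine (Formula.holds_bigAnd (V := stageVocab V) _ _ _).trans (forall_congr' fun k =>
    imp_congr_right fun _ => (Formula.holds_allN (V := stageVocab V) _ _ _).trans
      (forall_congr' fun z => not_congr ((Formula.holds_withBot _ _ _).trans ?_)))
  exact iff_of_eq (congrArg ((S.bodyOf k).Holds I _) (append_fun_right a z))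

theorem holds_fixAxiom (x : Fin (V.arity i) → O) :
    (fixAxiom S i).body.Holds (V := stageVocab V) I s x ↔
      ∀ k ∈ S.affected, ∀ z : Fin (V.arity k) → O,
        ¬ (S.bodyOf k).Holds I (s.slice S.affected fun p z => ¬ s.nle p i z x) z ∨
        (S.bodyOf k).Holds I (s.slice S.affected fun p z => s.lt p i z x) z := by
  refine (Formula.holds_bigAnd (V := stageVocab V) _ _ _).trans (forall_congr' fun k =>
    imp_congr_right fun _ => (Formula.holds_allN (V := stageVocab V) _ _ _).trans
      (forall_congr' fun z => or_congr
        (not_congr ((Formula.holds_withNotNle _ _ _ _).trans ?_))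
        ((Formula.holds_withLt _ _ _ _).trans ?_)))
  · exact iff_of_eq (congrArg₂
      (fun X Y => (S.bodyOf k).Holds I (s.slice S.affected fun p z => ¬ s.nle p i z Y) X)
      (append_fun_right x z) (append_fun_left x z))
  · exact iff_of_eq (congrArg₂
      (fun X Y => (S.bodyOf k).Holds I (s.slice S.affected fun p z => s.lt p i z Y) X)
      (append_fun_right x z) (append_fun_left x z))

end Substitution

/-! ### Stages, levels and the intended meaning of the stage predicates. -/

section Stages

variable {V : Vocabulary.{u, v}} {O : Type w} {I : V.Const → O} {S : Stratum V}

/-! ### Stages of the computation of a stratum -/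

/-- The stages of the simultaneous induction that is given by the stratum `S`. -/
noncomputable def Stratum.stage (I : V.Const → O) (S : Stratum V) (s : State V O) :
    ℕ → State V O
  | 0 => s
  | k + 1 => fun p a => s p a ∨ (S.bodyOf p).Holds I (Stratum.stage I S s k) a

/-- Negative occurrences concern only unaffected predicates, and those do not grow from `s` to `t`.
-/
theorem Stratum.PosAffected.holds_bodyOf_mono (hS : S.PosAffected) {s t : State V O}
    (hst : ∀ p a, s p a → t p a) (hts : ∀ p, p ∉ S.affected → ∀ a, t p a → s p a) (p : V.Pred)
    (a : Fin (V.arity p) → O) (h : (S.bodyOf p).Holds I s a) : (S.bodyOf p).Holds I t a := by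
  rw [Stratum.holds_bodyOf] at h ⊢
  obtain ⟨ax, hax, b, he, h⟩ := h
  refine ⟨ax, hax, b, he, h.mono (fun p _ => hst p) fun p hp => hts p fun hpA => ?_⟩
  exact hS ax hax p (Stratum.mem_affected.1 hpA) hp

theorem Stratum.not_holds_bodyOf {p : V.Pred} (hp : p ∉ S.affected) {s : State V O}
    (a : Fin (V.arity p) → O) : ¬ (S.bodyOf p).Holds I s a := by
  rw [Stratum.holds_bodyOf]
  rintro ⟨ax, hax, b, he, -⟩
  exact hp (Stratum.mem_affected.2 ⟨ax, hax, (congrArg Sigma.fst he).symm⟩)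

theorem Stratum.stage_of_not_mem {p : V.Pred} (hp : p ∉ S.affected) (s : State V O) (k : ℕ)
    (a : Fin (V.arity p) → O) : Stratum.stage I S s k p a ↔ s p a := by
  cases k with
  | zero => rfl
  | succ k => exact or_iff_left (Stratum.not_holds_bodyOf hp a)

theorem Stratum.PosAffected.stage_le_succ (hS : S.PosAffected) (s : State V O) (k : ℕ)
    (p : V.Pred) (a : Fin (V.arity p) → O) (h : Stratum.stage I S s k p a) :
    Stratum.stage I S s (k + 1) p a := by
  induction k generalizing p with
  | zero => exact .inl h
  | succ k ih =>
    refine h.imp_right (hS.holds_bodyOf_mono ih (fun p hp a => ?_) p _)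
    rw [Stratum.stage_of_not_mem hp, Stratum.stage_of_not_mem hp]
    exact id

theorem Stratum.PosAffected.stage_mono (hS : S.PosAffected) (s : State V O) {k k' : ℕ}
    (hk : k ≤ k') (p : V.Pred) (a : Fin (V.arity p) → O) (h : Stratum.stage I S s k p a) :
    Stratum.stage I S s k' p a := by
  induction k', hk using Nat.le_induction with
  | base => exact h
  | succ k' _ ih => exact hS.stage_le_succ s k' p a ih

theorem Stratum.stage_stable {s : State V O} {k k' : ℕ} (hk : k ≤ k')
    (h : Stratum.stage I S s (k + 1) = Stratum.stage I S s k) :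
    Stratum.stage I S s k' = Stratum.stage I S s k := by
  induction k', hk using Nat.le_induction with
  | base => rfl
  | succ k' _ ih =>
    rw [← h]
    funext p a
    simp only [Stratum.stage, ih]

theorem Stratum.PosAffected.exists_stable [Finite O] (hS : S.PosAffected) (s : State V O) :
    ∃ k, Stratum.stage I S s (k + 1) = Stratum.stage I S s k := by
  have : Finite {x : (p : V.Pred) × (Fin (V.arity p) → O) // Stratum.Affects S x.1} :=
    (Stratum.finite_atoms S).to_subtype
  -- An increasing chain of subsets of a finite set is eventually constant. The subtype is needed
  -- because there may be infinitely many atoms of other predicates.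
  obtain ⟨k, hk⟩ := WellFoundedGT.monotone_chain_condition
    (α := Set {x : (p : V.Pred) × (Fin (V.arity p) → O) // Stratum.Affects S x.1})
    ⟨fun k => {x | Stratum.stage I S s k x.1.1 x.1.2},
      fun _ _ h x hx => hS.stage_mono s h _ _ hx⟩
  refine ⟨k, ?_⟩
  funext p a
  by_cases hp : p ∈ S.affected
  · have := Set.ext_iff.1 (hk (k + 1) (Nat.le_succ k))
      ⟨⟨p, a⟩, Stratum.mem_affected.1 hp⟩
    exact propext this.symm
  · rw [eq_iff_iff, Stratum.stage_of_not_mem hp, Stratum.stage_of_not_mem hp]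

/-- The extension by a stratum is the union of the stages. -/
theorem Stratum.Extends.iff_stage [Finite O] (hS : S.PosAffected) {s t : State V O}
    (h : Stratum.Extends I S s t) (p : V.Pred) (a : Fin (V.arity p) → O) :
    t p a ↔ ∃ k, Stratum.stage I S s k p a := by
  constructor
  · obtain ⟨k, hk⟩ := hS.exists_stable (I := I) s
    intro ht
    refine ⟨k, Stratum.path_le (Stratum.Affects S) hS (u := Stratum.stage I S s k)
      (fun p a h => hS.stage_mono s (Nat.zero_le k) p a h) (fun p hp a => ?_) ?_ h.1 p a ht⟩
    · exact (Stratum.stage_of_not_mem (fun h => hp (Stratum.mem_affected.1 h)) s k a).1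
    · intro ax hax a ha
      -- A stationary stage is closed: a body true in stage `k` puts its head into stage `k + 1`,
      -- which is stage `k`.
      rw [← hk]
      exact .inr ((Stratum.holds_bodyOf _ _ _).2 ⟨ax, hax, a, rfl, ha⟩)
  · rintro ⟨k, hk⟩
    induction k generalizing p with
    | zero => exact Stratum.path_mono h.1 p a hk
    | succ k ih =>
      obtain hk | hk := hk
      · exact Stratum.path_mono h.1 p a hk
      · have := hS.holds_bodyOf_mono ih (fun p hp a ht => ?_) p a hk
        · obtain ⟨ax, hax, b, he, hb⟩ := (Stratum.holds_bodyOf _ _ _).1 this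
          cases he
          exact h.closed ax hax _ hb
        · rw [Stratum.stage_of_not_mem hp]
          exact (Stratum.path_unaffected h.1 (fun h => hp (Stratum.mem_affected.2 h)) a).1 ht

/-- The ground atom `p(a)` first holds in stage `k + 1`, or it holds in no stage and the stages
are stationary from `k` on. -/
def Stratum.Level (I : V.Const → O) (S : Stratum V) (s : State V O) (k : ℕ) (p : V.Pred)
    (a : Fin (V.arity p) → O) : Prop :=
  ¬ Stratum.stage I S s k p a ∧
    (Stratum.stage I S s (k + 1) p a ∨ Stratum.stage I S s (k + 1) = Stratum.stage I S s k)

/-- For an atom that enters, take the predecessor of its first stage, which is not `0` by `h0`; for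
the others, take any stationary stage. -/
theorem Stratum.PosAffected.exists_level [Finite O] (hS : S.PosAffected) {s : State V O}
    {p : V.Pred} {a : Fin (V.arity p) → O} (h0 : ¬ s p a) : ∃ k, Stratum.Level I S s k p a := by
  classical
  by_cases h : ∃ k, Stratum.stage I S s k p a
  · obtain ⟨k, hk⟩ : ∃ k, Nat.find h = k + 1 := Nat.exists_eq_succ_of_ne_zero fun h0' =>
      h0 (by
        have := Nat.find_spec h
        rw [h0'] at this
        exact this)
    exact ⟨k, Nat.find_min h (by omega), .inl (hk ▸ Nat.find_spec h)⟩
  · obtain ⟨k, hk⟩ := hS.exists_stable (I := I) s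
    exact ⟨k, fun hka => h ⟨k, hka⟩, .inr hk⟩

/-- If an atom had entered after the smaller of two levels, it would be present at the larger one;
so the stages are stationary from the smaller level on. Thus the stage belonging to a level is well
defined although the level is not. -/
theorem Stratum.Level.stage_eq (hS : S.PosAffected) {s : State V O} {k k' : ℕ} {p : V.Pred}
    {a : Fin (V.arity p) → O} (h : Stratum.Level I S s k p a)
    (h' : Stratum.Level I S s k' p a) : Stratum.stage I S s k = Stratum.stage I S s k' := by
  wlog hk : k ≤ k' generalizing k k'
  · exact (this h' h (Nat.le_of_not_le hk)).symm
  obtain rfl | hk' := hk.eq_or_lt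
  · rfl
  · obtain h1 | h1 := h.2
    · exact absurd (hS.stage_mono s hk' p a h1) h'.1
    · exact (Stratum.stage_stable hk h1).symm

theorem Stratum.stage_succ_congr {s : State V O} {k k' : ℕ}
    (h : Stratum.stage I S s k = Stratum.stage I S s k') :
    Stratum.stage I S s (k + 1) = Stratum.stage I S s (k' + 1) := by
  funext p a
  simp only [Stratum.stage, h]

/-! ### The stage axioms -/

/-- The predicate is a stage predicate for a stratum with number `l` and affected predicates
`A`. -/
def StagePred.Of (A : List V.Pred) (l : ℕ) : StagePred V → Prop
  | .orig _ => False
  | .lt i j => i ∈ A ∧ j ∈ A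
  | .le i j => i ∈ A ∧ j ∈ A
  | .nlt i j => i ∈ A ∧ j ∈ A
  | .nle i j => i ∈ A ∧ j ∈ A
  | .tri i j => i ∈ A ∧ j ∈ A
  | .none l' => l' = l
  | .fix i => i ∈ A

theorem mem_stageAxioms {l : ℕ} {ax : Ax (stageVocab V)} :
    ax ∈ stageAxioms l S ↔ ax = noneAxiom l S ∨ ∃ i ∈ S.affected, ax = fixAxiom S i ∨
      ∃ j ∈ S.affected, ax = ltAxiom S i j ∨ ax = leAxiom S i j ∨ ax = nltAxiom l S i j ∨
        ax = nleAxiom S i j ∨ ax = triAxiom S i j := by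
  simp [stageAxioms]

theorem stageAxioms_affects {l : ℕ} {σ : StagePred V} :
    Stratum.Affects (V := stageVocab V) (stageAxioms l S) σ ↔ σ.Of S.affected l := by
  constructor
  · rintro ⟨ax, hax, rfl⟩
    rw [mem_stageAxioms] at hax
    obtain rfl | ⟨i, hi, rfl | ⟨j, hj, rfl | rfl | rfl | rfl | rfl⟩⟩ := hax
    · exact rfl
    · exact hi
    all_goals exact ⟨hi, hj⟩
  · intro h
    cases σ with
    | orig p => exact h.elim
    | lt i j => exact ⟨_, mem_stageAxioms.2 (.inr ⟨i, h.1, .inr ⟨j, h.2, .inl rfl⟩⟩), rfl⟩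
    | le i j => exact ⟨_, mem_stageAxioms.2 (.inr ⟨i, h.1, .inr ⟨j, h.2, .inr (.inl rfl)⟩⟩), rfl⟩
    | nlt i j =>
      exact ⟨_, mem_stageAxioms.2 (.inr ⟨i, h.1, .inr ⟨j, h.2, .inr (.inr (.inl rfl))⟩⟩), rfl⟩
    | nle i j =>
      exact ⟨_, mem_stageAxioms.2
        (.inr ⟨i, h.1, .inr ⟨j, h.2, .inr (.inr (.inr (.inl rfl)))⟩⟩), rfl⟩
    | tri i j =>
      exact ⟨_, mem_stageAxioms.2
        (.inr ⟨i, h.1, .inr ⟨j, h.2, .inr (.inr (.inr (.inr rfl)))⟩⟩), rfl⟩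
    | none l' =>
      obtain rfl : l' = l := h
      exact ⟨_, mem_stageAxioms.2 (.inl rfl), rfl⟩
    | fix i => exact ⟨_, mem_stageAxioms.2 (.inr ⟨i, h, .inl rfl⟩), rfl⟩

/-- The closure conditions that are expressed by the stage axioms. -/
structure StageClosed (I : V.Const → O) (l : ℕ) (S : Stratum V) (t : State (stageVocab V) O) :
    Prop where
  lt : ∀ i ∈ S.affected, ∀ j ∈ S.affected, ∀ x y,
    (∃ k ∈ S.affected, ∃ z : Fin (V.arity k) → O, t.le i k x z ∧ t.tri k j z y) → t.lt i j x y
  le : ∀ i ∈ S.affected, ∀ j ∈ S.affected, ∀ x y,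
    (S.bodyOf i).Holds I (t.slice S.affected fun p z => t.lt p j z y) x → t.le i j x y
  nlt : ∀ i ∈ S.affected, ∀ j ∈ S.affected, ∀ x y,
    ((S.bodyOf j).Holds I (t.slice S.affected fun _ _ => False) y ∨
      (∃ k ∈ S.affected, ∃ z : Fin (V.arity k) → O, t.nle i k x z ∧ t.tri k j z y) ∨
      t (StagePred.none l) Fin.elim0) → t.nlt i j x y
  nle : ∀ i ∈ S.affected, ∀ j ∈ S.affected, ∀ x y,
    ¬ (S.bodyOf i).Holds I (t.slice S.affected fun p z => ¬ t.nlt p j z y) x → t.nle i j x y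
  tri : ∀ i ∈ S.affected, ∀ j ∈ S.affected, ∀ x y,
    ((S.bodyOf i).Holds I (t.slice S.affected fun p z => t.lt p i z x) x ∧
      ¬ (S.bodyOf j).Holds I (t.slice S.affected fun p z => ¬ t.nlt p i z x) y ∧
      ((S.bodyOf j).Holds I (t.slice S.affected fun p z => t.le p i z x) y ∨
        t (StagePred.fix i) x)) → t.tri i j x y
  none : (∀ k ∈ S.affected, ∀ z : Fin (V.arity k) → O,
        ¬ (S.bodyOf k).Holds I (t.slice S.affected fun _ _ => False) z) →
      t (StagePred.none l) Fin.elim0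
  fix : ∀ i ∈ S.affected, ∀ x, (∀ k ∈ S.affected, ∀ z : Fin (V.arity k) → O,
        ¬ (S.bodyOf k).Holds I (t.slice S.affected fun p z => ¬ t.nle p i z x) z ∨
        (S.bodyOf k).Holds I (t.slice S.affected fun p z => t.lt p i z x) z) →
      t (StagePred.fix i) x

theorem stageClosed_iff {l : ℕ} {t : State (stageVocab V) O} :
    Stratum.Closed (V := stageVocab V) I (stageAxioms l S) t ↔ StageClosed I l S t := by
  constructor
  · intro h
    have h2 : ∀ i ∈ S.affected, ∀ j ∈ S.affected, ∀ ax ∈ [ltAxiom S i j, leAxiom S i j,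
        nltAxiom l S i j, nleAxiom S i j, triAxiom S i j], ∀ a,
        ax.body.Holds (V := stageVocab V) I t a → t ax.head a := fun i hi j hj ax hax =>
      h ax (mem_stageAxioms.2 (.inr ⟨i, hi, .inr ⟨j, hj, by simpa using hax⟩⟩))
    refine ⟨fun i hi j hj x y hb => ?_, fun i hi j hj x y hb => ?_, fun i hi j hj x y hb => ?_,
      fun i hi j hj x y hb => ?_, fun i hi j hj x y hb => ?_, fun hb => ?_, fun i hi x hb => ?_⟩
    · exact h2 i hi j hj (ltAxiom S i j) (by simp) _ ((holds_ltAxiom x y).2 hb)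
    · exact h2 i hi j hj (leAxiom S i j) (by simp) _ ((holds_leAxiom x y).2 hb)
    · exact h2 i hi j hj (nltAxiom l S i j) (by simp) _ ((holds_nltAxiom x y).2 hb)
    · exact h2 i hi j hj (nleAxiom S i j) (by simp) _ ((holds_nleAxiom x y).2 hb)
    · exact h2 i hi j hj (triAxiom S i j) (by simp) _ ((holds_triAxiom x y).2 hb)
    · exact h (noneAxiom l S) (mem_stageAxioms.2 (.inl rfl)) _ ((holds_noneAxiom _).2 hb)
    · exact h (fixAxiom S i) (mem_stageAxioms.2 (.inr ⟨i, hi, .inl rfl⟩)) _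
        ((holds_fixAxiom x).2 hb)
  · intro h ax hax a ha
    rw [mem_stageAxioms] at hax
    obtain rfl | ⟨i, hi, rfl | ⟨j, hj, hax⟩⟩ := hax
    · have := h.none ((holds_noneAxiom _).1 ha)
      exact (Subsingleton.elim (α := Fin 0 → O) _ a) ▸ this
    · exact h.fix i hi a ((holds_fixAxiom _).1 ha)
    · have he : ∀ a : Fin (V.arity i + V.arity j) → O, ∃ x y, a = Fin.append x y :=
        fun a => ⟨_, _, Fin.append_castAdd_natAdd.symm⟩
      obtain rfl | rfl | rfl | rfl | rfl := hax
      · obtain ⟨x, y, rfl⟩ := he a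
        exact h.lt i hi j hj x y ((holds_ltAxiom x y).1 ha)
      · obtain ⟨x, y, rfl⟩ := he a
        exact h.le i hi j hj x y ((holds_leAxiom x y).1 ha)
      · obtain ⟨x, y, rfl⟩ := he a
        exact h.nlt i hi j hj x y ((holds_nltAxiom x y).1 ha)
      · obtain ⟨x, y, rfl⟩ := he a
        exact h.nle i hi j hj x y ((holds_nleAxiom x y).1 ha)
      · obtain ⟨x, y, rfl⟩ := he a
        exact h.tri i hi j hj x y ((holds_triAxiom x y).1 ha)

/-- The intended meaning of the stage predicates of the stratum `S` with number `l`, over the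
base state `s`. -/
def idealState (I : V.Const → O) (l : ℕ) (S : Stratum V) (s : State (stageVocab V) O) :
    State (stageVocab V) O
  | .orig p => fun a => ∃ k, Stratum.stage I S s.restrict k p a
  -- The disjunct with `s` keeps the values of stage predicates of other strata, so that the ideal
  -- state lies above `s` and agrees with it on unaffected predicates, as `Stratum.path_le`
  -- requires.
  | .lt i j => fun a => s (StagePred.lt i j) a ∨ ((i ∈ S.affected ∧ j ∈ S.affected) ∧
      ∃ n, Stratum.Level I S s.restrict n j (fun b => a (Fin.natAdd (V.arity i) b)) ∧
        Stratum.stage I S s.restrict n i (fun b => a (Fin.castAdd (V.arity j) b)))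
  | .le i j => fun a => s (StagePred.le i j) a ∨ ((i ∈ S.affected ∧ j ∈ S.affected) ∧
      ∃ n, Stratum.Level I S s.restrict n j (fun b => a (Fin.natAdd (V.arity i) b)) ∧
        Stratum.stage I S s.restrict (n + 1) i (fun b => a (Fin.castAdd (V.arity j) b)))
  | .nlt i j => fun a => s (StagePred.nlt i j) a ∨ ((i ∈ S.affected ∧ j ∈ S.affected) ∧
      ∃ n, Stratum.Level I S s.restrict n j (fun b => a (Fin.natAdd (V.arity i) b)) ∧
        ¬ Stratum.stage I S s.restrict n i (fun b => a (Fin.castAdd (V.arity j) b)))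
  | .nle i j => fun a => s (StagePred.nle i j) a ∨ ((i ∈ S.affected ∧ j ∈ S.affected) ∧
      ∃ n, Stratum.Level I S s.restrict n j (fun b => a (Fin.natAdd (V.arity i) b)) ∧
        ¬ Stratum.stage I S s.restrict (n + 1) i (fun b => a (Fin.castAdd (V.arity j) b)))
  -- The left atom must really enter, in stage `n + 1`, whereas the right one may be an atom that
  -- never enters, provided that the stages are stationary from `n + 1` on.
  | .tri i j => fun a => s (StagePred.tri i j) a ∨ ((i ∈ S.affected ∧ j ∈ S.affected) ∧
      ∃ n, Stratum.Level I S s.restrict (n + 1) j (fun b => a (Fin.natAdd (V.arity i) b)) ∧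
        Stratum.stage I S s.restrict (n + 1) i (fun b => a (Fin.castAdd (V.arity j) b)) ∧
        ¬ Stratum.stage I S s.restrict n i (fun b => a (Fin.castAdd (V.arity j) b)))
  | .none l' => fun a => s (StagePred.none l') a ∨ (l' = l ∧
      Stratum.stage I S s.restrict 1 = Stratum.stage I S s.restrict 0)
  | .fix i => fun a => s (StagePred.fix i) a ∨ (i ∈ S.affected ∧
      ∃ n, Stratum.Level I S s.restrict n i a ∧
        Stratum.stage I S s.restrict (n + 2) = Stratum.stage I S s.restrict (n + 1))

/-! ### Soundness and completeness of the stage axioms. -/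

section Ideal

variable {l : ℕ} {s : State (stageVocab V) O}

theorem ideal_lt {i j : V.Pred} (hi : i ∈ S.affected) (hj : j ∈ S.affected)
    (h0 : ∀ σ : StagePred V, σ.Of S.affected l → ∀ a, ¬ s σ a)
    (x : Fin (V.arity i) → O) (y : Fin (V.arity j) → O) :
    (idealState I l S s).lt i j x y ↔ ∃ n, Stratum.Level I S s.restrict n j y ∧
      Stratum.stage I S s.restrict n i x := by
  refine (or_iff_right (h0 (.lt i j) ⟨hi, hj⟩ _)).trans ((and_iff_right ⟨hi, hj⟩).trans ?_)
  exact iff_of_eq (congrArg₂ (fun X Y => ∃ n, Stratum.Level I S s.restrict n j Y ∧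
      Stratum.stage I S s.restrict n i X) (append_fun_left x y) (append_fun_right x y))

theorem ideal_le {i j : V.Pred} (hi : i ∈ S.affected) (hj : j ∈ S.affected)
    (h0 : ∀ σ : StagePred V, σ.Of S.affected l → ∀ a, ¬ s σ a)
    (x : Fin (V.arity i) → O) (y : Fin (V.arity j) → O) :
    (idealState I l S s).le i j x y ↔ ∃ n, Stratum.Level I S s.restrict n j y ∧
      Stratum.stage I S s.restrict (n + 1) i x := by
  refine (or_iff_right (h0 (.le i j) ⟨hi, hj⟩ _)).trans ((and_iff_right ⟨hi, hj⟩).trans ?_)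
  exact iff_of_eq (congrArg₂ (fun X Y => ∃ n, Stratum.Level I S s.restrict n j Y ∧
      Stratum.stage I S s.restrict (n + 1) i X) (append_fun_left x y) (append_fun_right x y))

theorem ideal_nlt {i j : V.Pred} (hi : i ∈ S.affected) (hj : j ∈ S.affected)
    (h0 : ∀ σ : StagePred V, σ.Of S.affected l → ∀ a, ¬ s σ a)
    (x : Fin (V.arity i) → O) (y : Fin (V.arity j) → O) :
    (idealState I l S s).nlt i j x y ↔ ∃ n, Stratum.Level I S s.restrict n j y ∧
      ¬ Stratum.stage I S s.restrict n i x := by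
  refine (or_iff_right (h0 (.nlt i j) ⟨hi, hj⟩ _)).trans ((and_iff_right ⟨hi, hj⟩).trans ?_)
  exact iff_of_eq (congrArg₂ (fun X Y => ∃ n, Stratum.Level I S s.restrict n j Y ∧
      ¬ Stratum.stage I S s.restrict n i X) (append_fun_left x y) (append_fun_right x y))

theorem ideal_nle {i j : V.Pred} (hi : i ∈ S.affected) (hj : j ∈ S.affected)
    (h0 : ∀ σ : StagePred V, σ.Of S.affected l → ∀ a, ¬ s σ a)
    (x : Fin (V.arity i) → O) (y : Fin (V.arity j) → O) :
    (idealState I l S s).nle i j x y ↔ ∃ n, Stratum.Level I S s.restrict n j y ∧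
      ¬ Stratum.stage I S s.restrict (n + 1) i x := by
  refine (or_iff_right (h0 (.nle i j) ⟨hi, hj⟩ _)).trans ((and_iff_right ⟨hi, hj⟩).trans ?_)
  exact iff_of_eq (congrArg₂ (fun X Y => ∃ n, Stratum.Level I S s.restrict n j Y ∧
      ¬ Stratum.stage I S s.restrict (n + 1) i X) (append_fun_left x y) (append_fun_right x y))

theorem ideal_tri {i j : V.Pred} (hi : i ∈ S.affected) (hj : j ∈ S.affected)
    (h0 : ∀ σ : StagePred V, σ.Of S.affected l → ∀ a, ¬ s σ a)
    (x : Fin (V.arity i) → O) (y : Fin (V.arity j) → O) :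
    (idealState I l S s).tri i j x y ↔ ∃ n, Stratum.Level I S s.restrict (n + 1) j y ∧
      Stratum.stage I S s.restrict (n + 1) i x ∧ ¬ Stratum.stage I S s.restrict n i x := by
  refine (or_iff_right (h0 (.tri i j) ⟨hi, hj⟩ _)).trans ((and_iff_right ⟨hi, hj⟩).trans ?_)
  exact iff_of_eq (congrArg₂ (fun X Y => ∃ n, Stratum.Level I S s.restrict (n + 1) j Y ∧
      Stratum.stage I S s.restrict (n + 1) i X ∧ ¬ Stratum.stage I S s.restrict n i X)
      (append_fun_left x y) (append_fun_right x y))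

theorem ideal_none (h0 : ∀ σ : StagePred V, σ.Of S.affected l → ∀ a, ¬ s σ a)
    (a : Fin 0 → O) : idealState I l S s (.none l) a ↔
      Stratum.stage I S s.restrict 1 = Stratum.stage I S s.restrict 0 :=
  (or_iff_right (h0 (.none l) rfl _)).trans (and_iff_right rfl)

theorem ideal_fix {i : V.Pred} (hi : i ∈ S.affected)
    (h0 : ∀ σ : StagePred V, σ.Of S.affected l → ∀ a, ¬ s σ a)
    (x : Fin (V.arity i) → O) : idealState I l S s (.fix i) x ↔
      ∃ n, Stratum.Level I S s.restrict n i x ∧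
        Stratum.stage I S s.restrict (n + 2) = Stratum.stage I S s.restrict (n + 1) :=
  (or_iff_right (h0 (.fix i) hi _)).trans (and_iff_right hi)

/-- Every substitution in the stage axioms thereby becomes the evaluation of `φ_i` in one of the
stages. -/
theorem slice_eq_stage {t : State (stageVocab V) O}
    {r : (p : V.Pred) → (Fin (V.arity p) → O) → Prop} {n : ℕ}
    (ht : ∀ p, p ∉ S.affected → ∀ a, t (.orig p) a ↔ s (.orig p) a)
    (hr : ∀ p ∈ S.affected, ∀ a, r p a ↔ Stratum.stage I S s.restrict n p a) :
    t.slice S.affected r = Stratum.stage I S s.restrict n := by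
  funext p a
  rw [eq_iff_iff]
  by_cases hp : p ∈ S.affected
  · rw [State.slice_iff_of_mem hp, hr p hp]
  · rw [State.slice_iff_of_not_mem hp, Stratum.stage_of_not_mem hp]
    exact ht p hp a

/-- Since the predicate is false in the base state, the inflationary disjunct in the definition of a
stage drops out. -/
theorem stage_succ_iff {p : V.Pred} (h0 : ∀ a, ¬ s (.orig p) a)
    (n : ℕ) (a : Fin (V.arity p) → O) :
    (S.bodyOf p).Holds I (Stratum.stage I S s.restrict n) a ↔
      Stratum.stage I S s.restrict (n + 1) p a :=
  (or_iff_right (h0 a)).symm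

theorem stage_eq_of_forall {n m : ℕ}
    (h : ∀ p ∈ S.affected, ∀ a, Stratum.stage I S s.restrict n p a ↔
      Stratum.stage I S s.restrict m p a) :
    Stratum.stage I S s.restrict n = Stratum.stage I S s.restrict m := by
  funext p a
  rw [eq_iff_iff]
  by_cases hp : p ∈ S.affected
  · exact h p hp a
  · rw [Stratum.stage_of_not_mem hp, Stratum.stage_of_not_mem hp]

variable (hS : S.PosAffected) (h0 : ∀ σ : StagePred V, σ.Of S.affected l → ∀ a, ¬ s σ a)
  (hA : ∀ p ∈ S.affected, ∀ a, ¬ s (.orig p) a)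

include hS h0 hA

/-- Relative to an atom of level `n`, the slices of `≺` and `¬⊀` are stage `n`, and those of `≼` and
`¬⋠` are stage `n + 1`. Each closure condition then becomes a statement about consecutive stages. -/
theorem idealState_closed [Finite O] : StageClosed I l S (idealState I l S s) := by
  have hout : ∀ p, p ∉ S.affected → ∀ a, idealState I l S s (.orig p) a ↔ s (.orig p) a := by
    intro p hp a
    refine (exists_congr fun k => Stratum.stage_of_not_mem hp s.restrict k a).trans ?_
    exact exists_const _
  have hlv : ∀ p ∈ S.affected, ∀ a, ∃ n, Stratum.Level I S s.restrict n p a := fun p hp a =>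
    hS.exists_level (hA p hp a)
  have hlt : ∀ {n j y}, j ∈ S.affected → Stratum.Level I S s.restrict n j y →
      (idealState I l S s).slice S.affected (fun p z => (idealState I l S s).lt p j z y) =
        Stratum.stage I S s.restrict n := by
    intro n j y hj hn
    refine slice_eq_stage hout fun p hp z => (ideal_lt hp hj h0 z y).trans ?_
    refine ⟨fun ⟨m, hm, h⟩ => hm.stage_eq hS hn ▸ h, fun h => ⟨n, hn, h⟩⟩
  have hle : ∀ {n j y}, j ∈ S.affected → Stratum.Level I S s.restrict n j y →
      (idealState I l S s).slice S.affected (fun p z => (idealState I l S s).le p j z y) =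
        Stratum.stage I S s.restrict (n + 1) := by
    intro n j y hj hn
    refine slice_eq_stage hout fun p hp z => (ideal_le hp hj h0 z y).trans ?_
    exact ⟨fun ⟨m, hm, h⟩ => Stratum.stage_succ_congr (hm.stage_eq hS hn) ▸ h,
      fun h => ⟨n, hn, h⟩⟩
  have hnlt : ∀ {n j y}, j ∈ S.affected → Stratum.Level I S s.restrict n j y →
      (idealState I l S s).slice S.affected (fun p z => ¬ (idealState I l S s).nlt p j z y) =
        Stratum.stage I S s.restrict n := by
    intro n j y hj hn
    refine slice_eq_stage hout fun p hp z => (not_congr (ideal_nlt hp hj h0 z y)).trans ?_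
    refine ⟨fun h => by_contra fun h' => h ⟨n, hn, h'⟩, fun h ⟨m, hm, h'⟩ => h' ?_⟩
    exact hn.stage_eq hS hm ▸ h
  have hnle : ∀ {n j y}, j ∈ S.affected → Stratum.Level I S s.restrict n j y →
      (idealState I l S s).slice S.affected (fun p z => ¬ (idealState I l S s).nle p j z y) =
        Stratum.stage I S s.restrict (n + 1) := by
    intro n j y hj hn
    refine slice_eq_stage hout fun p hp z => (not_congr (ideal_nle hp hj h0 z y)).trans ?_
    refine ⟨fun h => by_contra fun h' => h ⟨n, hn, h'⟩, fun h ⟨m, hm, h'⟩ => h' ?_⟩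
    exact Stratum.stage_succ_congr (hn.stage_eq hS hm) ▸ h
  have hbot : (idealState I l S s).slice S.affected (fun _ _ => False) =
      Stratum.stage I S s.restrict 0 :=
    slice_eq_stage hout fun p hp z => iff_of_false id (hA p hp z)
  constructor
  -- From `z ◁ y`, the atom `z` has level `n` and `y` has level `n + 1`; so `x ≼ z` and `x ≺ y`
  -- speak of the same stage `n + 1`.
  · rintro i hi j hj x y ⟨k, hk, z, hxz, hzy⟩
    obtain ⟨n, hn, hz, hz'⟩ := (ideal_tri hk hj h0 z y).1 hzy
    obtain ⟨m, hm, hx⟩ := (ideal_le hi hk h0 x z).1 hxz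
    refine (ideal_lt hi hj h0 x y).2 ⟨n + 1, hn, ?_⟩
    rwa [Stratum.stage_succ_congr (hm.stage_eq hS ⟨hz', .inl hz⟩)] at hx
  · intro i hi j hj x y h
    obtain ⟨n, hn⟩ := hlv j hj y
    rw [hlt hj hn, stage_succ_iff (hA i hi)] at h
    exact (ideal_le hi hj h0 x y).2 ⟨n, hn, h⟩
  · rintro i hi j hj x y (h | ⟨k, hk, z, hxz, hzy⟩ | h)
    -- Replacing the affected atoms by `⊥` evaluates in stage `0`, so `y` enters in stage `1` and
    -- has level `0`, where `x` is absent.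
    · rw [hbot, stage_succ_iff (hA j hj)] at h
      exact (ideal_nlt hi hj h0 x y).2 ⟨0, ⟨hA j hj y, .inl h⟩, hA i hi x⟩
    · obtain ⟨n, hn, hz, hz'⟩ := (ideal_tri hk hj h0 z y).1 hzy
      obtain ⟨m, hm, hx⟩ := (ideal_nle hi hk h0 x z).1 hxz
      refine (ideal_nlt hi hj h0 x y).2 ⟨n + 1, hn, ?_⟩
      rwa [Stratum.stage_succ_congr (hm.stage_eq hS ⟨hz', .inl hz⟩)] at hx
    · exact (ideal_nlt hi hj h0 x y).2
        ⟨0, ⟨hA j hj y, .inr ((ideal_none h0 _).1 h)⟩, hA i hi x⟩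
  · intro i hi j hj x y h
    obtain ⟨n, hn⟩ := hlv j hj y
    rw [hnlt hj hn, stage_succ_iff (hA i hi)] at h
    exact (ideal_nle hi hj h0 x y).2 ⟨n, hn, h⟩
  · rintro i hi j hj x y ⟨hx, hy, hxy⟩
    obtain ⟨n, hn⟩ := hlv i hi x
    rw [hlt hi hn, stage_succ_iff (hA i hi)] at hx
    rw [hnlt hi hn, stage_succ_iff (hA j hj)] at hy
    refine (ideal_tri hi hj h0 x y).2 ⟨n, ⟨hy, ?_⟩, hx, hn.1⟩
    refine hxy.imp (fun h => ?_) fun h => ?_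
    · rwa [hle hi hn, stage_succ_iff (hA j hj)] at h
    -- The level `m` provided by `fix` may differ from `n`, but the corresponding stages and their
    -- successors coincide.
    · obtain ⟨m, hm, h⟩ := (ideal_fix hi h0 x).1 h
      have := Stratum.stage_succ_congr (hm.stage_eq hS hn)
      rw [← this, ← Stratum.stage_succ_congr this, h]
  · intro h
    refine (ideal_none h0 _).2 (stage_eq_of_forall fun p hp a => ?_)
    have := h p hp a
    rw [hbot, stage_succ_iff (hA p hp)] at this
    exact iff_of_false this (hA p hp a)
  · intro i hi x h
    obtain ⟨n, hn⟩ := hlv i hi x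
    refine (ideal_fix hi h0 x).2 ⟨n, hn, stage_eq_of_forall fun p hp a => ?_⟩
    refine ⟨fun hpa => ?_, hS.stage_le_succ _ _ _ _⟩
    -- Evaluated in the stages, the body of `fix` says that stage `n + 2` is contained in stage `n +
    -- 1`.
    have := h p hp a
    rw [hnle hi hn, hlt hi hn, stage_succ_iff (hA p hp), stage_succ_iff (hA p hp)] at this
    exact this.resolve_left (not_not_intro hpa)

/-- In a closed state that is contained in the intended one, the stage predicates have their
intended meaning. -/
theorem StageClosed.exact {t : State (stageVocab V) O} (ht : StageClosed I l S t)
    (hle : ∀ σ a, t σ a → idealState I l S s σ a)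
    (hout : ∀ p, p ∉ S.affected → ∀ a, t (.orig p) a ↔ s (.orig p) a) (n : ℕ) :
    ∀ j ∈ S.affected, ∀ y, Stratum.Level I S s.restrict n j y → ∀ i ∈ S.affected, ∀ x,
      (t.lt i j x y ↔ Stratum.stage I S s.restrict n i x) ∧
      (t.nlt i j x y ↔ ¬ Stratum.stage I S s.restrict n i x) ∧
      (t.le i j x y ↔ Stratum.stage I S s.restrict (n + 1) i x) ∧
      (t.nle i j x y ↔ ¬ Stratum.stage I S s.restrict (n + 1) i x) := by
  have hbot : t.slice S.affected (fun _ _ => False) =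
      Stratum.stage I S s.restrict 0 :=
    slice_eq_stage hout fun p hp z => iff_of_false id (hA p hp z)
  -- Containment in the ideal state gives the forward implications for all four relations; what
  -- remains is derivability.
  have sound_lt : ∀ {n j y i x}, j ∈ S.affected → Stratum.Level I S s.restrict n j y →
      i ∈ S.affected → t.lt i j x y → Stratum.stage I S s.restrict n i x := by
    intro n j y i x hj hn hi h
    obtain ⟨m, hm, h⟩ := (ideal_lt hi hj h0 x y).1 (hle _ _ h)
    exact hm.stage_eq hS hn ▸ h
  have sound_nlt : ∀ {n j y i x}, j ∈ S.affected → Stratum.Level I S s.restrict n j y →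
      i ∈ S.affected → t.nlt i j x y → ¬ Stratum.stage I S s.restrict n i x := by
    intro n j y i x hj hn hi h
    obtain ⟨m, hm, h⟩ := (ideal_nlt hi hj h0 x y).1 (hle _ _ h)
    exact hm.stage_eq hS hn ▸ h
  have sound_le : ∀ {n j y i x}, j ∈ S.affected → Stratum.Level I S s.restrict n j y →
      i ∈ S.affected → t.le i j x y → Stratum.stage I S s.restrict (n + 1) i x := by
    intro n j y i x hj hn hi h
    obtain ⟨m, hm, h⟩ := (ideal_le hi hj h0 x y).1 (hle _ _ h)
    exact Stratum.stage_succ_congr (hm.stage_eq hS hn) ▸ h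
  have sound_nle : ∀ {n j y i x}, j ∈ S.affected → Stratum.Level I S s.restrict n j y →
      i ∈ S.affected → t.nle i j x y → ¬ Stratum.stage I S s.restrict (n + 1) i x := by
    intro n j y i x hj hn hi h
    obtain ⟨m, hm, h⟩ := (ideal_nle hi hj h0 x y).1 (hle _ _ h)
    exact Stratum.stage_succ_congr (hm.stage_eq hS hn) ▸ h
  -- it suffices to derive `lt` and `nlt`
  have lift : ∀ n, (∀ j ∈ S.affected, ∀ y, Stratum.Level I S s.restrict n j y →
      ∀ i ∈ S.affected, ∀ x, (Stratum.stage I S s.restrict n i x → t.lt i j x y) ∧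
        (¬ Stratum.stage I S s.restrict n i x → t.nlt i j x y)) →
      ∀ j ∈ S.affected, ∀ y, Stratum.Level I S s.restrict n j y → ∀ i ∈ S.affected, ∀ x,
      (t.lt i j x y ↔ Stratum.stage I S s.restrict n i x) ∧
      (t.nlt i j x y ↔ ¬ Stratum.stage I S s.restrict n i x) ∧
      (t.le i j x y ↔ Stratum.stage I S s.restrict (n + 1) i x) ∧
      (t.nle i j x y ↔ ¬ Stratum.stage I S s.restrict (n + 1) i x) := by
    intro n h j hj y hn i hi x
    refine ⟨⟨sound_lt hj hn hi, (h j hj y hn i hi x).1⟩,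
      ⟨sound_nlt hj hn hi, (h j hj y hn i hi x).2⟩,
      ⟨sound_le hj hn hi, fun hx => ht.le i hi j hj x y ?_⟩,
      ⟨sound_nle hj hn hi, fun hx => ht.nle i hi j hj x y ?_⟩⟩
    · rwa [slice_eq_stage (n := n) hout fun p hp z =>
        ⟨sound_lt hj hn hp, (h j hj y hn p hp z).1⟩, stage_succ_iff (hA i hi)]
    · rwa [slice_eq_stage (n := n) hout fun p hp z =>
        ⟨fun hz => by_contra fun hz' => hz ((h j hj y hn p hp z).2 hz'),
          fun hz hz' => sound_nlt hj hn hp hz' hz⟩, stage_succ_iff (hA i hi)]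
  induction n with
  | zero =>
    refine lift 0 fun j hj y hn i hi x => ⟨fun h => absurd h (hA i hi x), fun _ => ?_⟩
    -- At level `0` either `y` enters in stage `1`, which is `φ_j(y)[⊥]`, or the stages are
    -- stationary from the start, which is `none`.
    refine ht.nlt i hi j hj x y (hn.2.imp (fun h => ?_) fun h => .inr (ht.none fun k hk z => ?_))
    · rwa [hbot, stage_succ_iff (hA j hj)]
    · rw [hbot, stage_succ_iff (hA k hk), h]
      exact hA k hk z
  | succ n ih =>
    have slt : ∀ j (hj : j ∈ S.affected) y (_ : Stratum.Level I S s.restrict n j y),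
        t.slice S.affected (fun p z => t.lt p j z y) = Stratum.stage I S s.restrict n :=
      fun j hj y hn => slice_eq_stage hout fun p hp z => (ih j hj y hn p hp z).1
    have snlt : ∀ j (hj : j ∈ S.affected) y (_ : Stratum.Level I S s.restrict n j y),
        t.slice S.affected (fun p z => ¬ t.nlt p j z y) = Stratum.stage I S s.restrict n :=
      fun j hj y hn => slice_eq_stage hout fun p hp z =>
        (not_congr (ih j hj y hn p hp z).2.1).trans not_not
    have sle : ∀ j (hj : j ∈ S.affected) y (_ : Stratum.Level I S s.restrict n j y),
        t.slice S.affected (fun p z => t.le p j z y) = Stratum.stage I S s.restrict (n + 1) :=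
      fun j hj y hn => slice_eq_stage hout fun p hp z => (ih j hj y hn p hp z).2.2.1
    have snle : ∀ j (hj : j ∈ S.affected) y (_ : Stratum.Level I S s.restrict n j y),
        t.slice S.affected (fun p z => ¬ t.nle p j z y) = Stratum.stage I S s.restrict (n + 1) :=
      fun j hj y hn => slice_eq_stage hout fun p hp z =>
        (not_congr (ih j hj y hn p hp z).2.2.2).trans not_not
    refine lift (n + 1) fun j hj y hn i hi x => ?_
    -- If nothing is new in stage `n + 1`, no predecessor `z` exists; but then `y` also has level
    -- `n`, and the induction hypothesis applies to `y` itself.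
    by_cases hst : Stratum.stage I S s.restrict (n + 1) = Stratum.stage I S s.restrict n
    · have hn' : Stratum.Level I S s.restrict n j y := ⟨hst ▸ hn.1, .inr hst⟩
      rw [hst]
      exact ⟨(ih j hj y hn' i hi x).1.2, (ih j hj y hn' i hi x).2.1.2⟩
    · obtain ⟨k, hk, z, hz, hz'⟩ : ∃ k ∈ S.affected, ∃ z,
          Stratum.stage I S s.restrict (n + 1) k z ∧ ¬ Stratum.stage I S s.restrict n k z := by
        by_contra hcon
        push Not at hcon
        exact hst (stage_eq_of_forall fun p hp a =>
          ⟨hcon p hp a, hS.stage_le_succ _ _ _ _⟩)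
      have hlev : Stratum.Level I S s.restrict n k z := ⟨hz', .inl hz⟩
      have htri : t.tri k j z y := by
        refine ht.tri k hk j hj z y ⟨?_, ?_, ?_⟩
        · rwa [slt k hk z hlev, stage_succ_iff (hA k hk)]
        · rw [snlt k hk z hlev, stage_succ_iff (hA j hj)]
          exact hn.1
        · rw [sle k hk z hlev, stage_succ_iff (hA j hj)]
          -- If `y` enters in stage `n + 2`, then `φ_j(y)[≼ z]` holds; otherwise stages `n + 1` and
          -- `n + 2` agree, which makes `fix` derivable for `z`.
          refine hn.2.imp id fun h => ht.fix k hk z fun p hp a => ?_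
          rw [snle k hk z hlev, slt k hk z hlev, stage_succ_iff (hA p hp),
            stage_succ_iff (hA p hp), h]
          exact (em _).symm
      have hih := (ih k hk z hlev i hi x).2.2
      exact ⟨fun h => ht.lt i hi j hj x y ⟨k, hk, z, hih.1.2 h, htri⟩,
        fun h => ht.nlt i hi j hj x y (.inr (.inl ⟨k, hk, z, hih.2.2 h, htri⟩))⟩

/-- Compared with itself at level `n`, an atom satisfies `⋠` exactly if it is absent from stage `n +
1`; by the definition of a level this means that it never enters. -/
theorem StageClosed.nle_iff [Finite O] {t : State (stageVocab V) O} (ht : StageClosed I l S t)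
    (hle : ∀ σ a, t σ a → idealState I l S s σ a)
    (hout : ∀ p, p ∉ S.affected → ∀ a, t (.orig p) a ↔ s (.orig p) a) {p : V.Pred}
    (hp : p ∈ S.affected) (x : Fin (V.arity p) → O) :
    t.nle p p x x ↔ ¬ ∃ k, Stratum.stage I S s.restrict k p x := by
  obtain ⟨n, hn⟩ := hS.exists_level (I := I) (s := s.restrict) (hA p hp x)
  rw [(ht.exact hS h0 hA hle hout n p hp x hn p hp x).2.2.2]
  refine not_congr ⟨fun h => ⟨_, h⟩, fun ⟨k, hk⟩ => hn.2.resolve_right fun h => hn.1 ?_⟩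
  obtain hkn | hkn := le_total k n
  · exact hS.stage_mono _ hkn p x hk
  · exact Stratum.stage_stable hkn h ▸ hk

end Ideal

end Stages

/-! ### Signs of occurrences after substitution. -/

section Occurrences

variable {V : Vocabulary.{u, v}}

/-! ### Occurrences of predicates after syntactic operations -/

theorem Formula.occursSigned_exN {p : V.Pred} {b : Bool} {n : ℕ} (k : ℕ) (φ : Formula V (n + k)) :
    (Formula.exN k φ).OccursSigned p b ↔ φ.OccursSigned p b := by
  induction k with
  | zero => rfl
  | succ k ih => exact ih (.ex φ)

theorem Formula.occursSigned_allN {p : V.Pred} {b : Bool} {n : ℕ} (k : ℕ)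
    (φ : Formula V (n + k)) : (Formula.allN k φ).OccursSigned p b ↔ φ.OccursSigned p b := by
  induction k with
  | zero => rfl
  | succ k ih => exact ih (.all φ)

theorem Formula.occursSigned_bigOr {p : V.Pred} {b : Bool} {n : ℕ} {α : Type u} {l : List α}
    {f : α → Formula V n} (h : (bigOr l f).OccursSigned p b) :
    ∃ k ∈ l, (f k).OccursSigned p b := by
  induction l with
  | nil => exact h.elim
  | cons k l ih =>
    obtain h | h := h
    · exact ⟨k, by simp, h⟩
    · obtain ⟨k', hk', h⟩ := ih h
      exact ⟨k', by simp [hk'], h⟩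

theorem Formula.occursSigned_bigAnd {p : V.Pred} {b : Bool} {n : ℕ} {α : Type u} {l : List α}
    {f : α → Formula V n} (h : (bigAnd l f).OccursSigned p b) :
    ∃ k ∈ l, (f k).OccursSigned p b := by
  induction l with
  | nil => exact h.elim
  | cons k l ih =>
    obtain h | h := h
    · exact ⟨k, by simp, h⟩
    · obtain ⟨k', hk', h⟩ := ih h
      exact ⟨k', by simp [hk'], h⟩

theorem Stratum.occursSigned_bodyOf {S : Stratum V} {i p : V.Pred} {b : Bool}
    (h : (S.bodyOf i).OccursSigned p b) : ∃ ax ∈ S, ax.body.OccursSigned p b := by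
  induction S with
  | nil => exact h.elim
  | cons ax S ih =>
    by_cases hi : ax.head = i
    · subst hi
      have he : Stratum.bodyOf (ax :: S) ax.head = .or ax.body (Stratum.bodyOf S ax.head) := by
        simp [Stratum.bodyOf]
      rw [he] at h
      obtain h | h := h
      · exact ⟨ax, by simp, h⟩
      · obtain ⟨ax', hax', h⟩ := ih h
        exact ⟨ax', by simp [hax'], h⟩
    · have he : Stratum.bodyOf (ax :: S) i = Stratum.bodyOf S i := by
        simp [Stratum.bodyOf, hi]
      rw [he] at h
      obtain ⟨ax', hax', h⟩ := ih h
      exact ⟨ax', by simp [hax'], h⟩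

/-- Signs multiply: an occurrence in the result comes from an atom of sign `b'` and an occurrence in
its replacement, whose sign is positive exactly if `b = b'`. -/
theorem Formula.occursSigned_replace {k : ℕ}
    {f : {m : ℕ} → (p : V.Pred) → (Fin (V.arity p) → Term (stageVocab V) m) →
      (Fin k → Term (stageVocab V) m) → Formula (stageVocab V) m}
    {σ : (stageVocab V).Pred} {n m : ℕ} (φ : Formula V n) (ρ : Fin n → Term (stageVocab V) m)
    (y : Fin k → Term (stageVocab V) m) {b : Bool}
    (h : (φ.replace f ρ y).OccursSigned σ b) :
    ∃ p b', φ.OccursSigned p b' ∧ ∃ (m : ℕ) (t : Fin (V.arity p) → Term (stageVocab V) m)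
      (y : Fin k → Term (stageVocab V) m), (f p t y).OccursSigned σ (b == b') := by
  induction φ generalizing m b with
  | falsum => exact h.elim
  | verum => exact h.elim
  | atom p ts => exact ⟨p, true, ⟨rfl, rfl⟩, m, fun i => (ts i).subst ρ, y, by
    cases b <;> exact h⟩
  | eq t t' => exact h.elim
  | neg φ ih =>
    obtain ⟨p, b', hp, m, t, y, h⟩ := ih ρ y h
    refine ⟨p, !b', ?_, m, t, y, ?_⟩
    · show φ.OccursSigned p (!!b')
      simpa using hp
    · cases b <;> cases b' <;> exact h
  | and φ ψ ih ih' =>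
    obtain h | h := h
    · obtain ⟨p, b', hp, h⟩ := ih ρ y h
      exact ⟨p, b', .inl hp, h⟩
    · obtain ⟨p, b', hp, h⟩ := ih' ρ y h
      exact ⟨p, b', .inr hp, h⟩
  | or φ ψ ih ih' =>
    obtain h | h := h
    · obtain ⟨p, b', hp, h⟩ := ih ρ y h
      exact ⟨p, b', .inl hp, h⟩
    · obtain ⟨p, b', hp, h⟩ := ih' ρ y h
      exact ⟨p, b', .inr hp, h⟩
  | all φ ih => exact ih _ _ h
  | ex φ ih => exact ih _ _ h

theorem Formula.occursSigned_embed {σ : (stageVocab V).Pred} {n : ℕ} {φ : Formula V n} {b : Bool}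
    (h : φ.embed.OccursSigned σ b) : ∃ p, σ = StagePred.orig p ∧ φ.OccursSigned p b := by
  obtain ⟨p, b', hp, m, t, y, h1, rfl⟩ := Formula.occursSigned_replace _ _ _ h
  obtain rfl : b = b' := by simpa using h1
  exact ⟨p, rfl, hp⟩

/-- The admissible occurrences in stage axioms: stage predicates occur only positively, and
predicates affected by the stratum do not occur. -/
def Stratum.StageOccurrence (l : ℕ) (S : Stratum V) (σ : StagePred V) (b : Bool) : Prop :=
  (b = true ∧ σ.Of S.affected l) ∨
    ∃ p, p ∉ S.affected ∧ σ = StagePred.orig p ∧ ∃ ax ∈ S, ∃ b', ax.body.OccursSigned p b'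

section

variable {S : Stratum V} (hS : S.PosAffected) {l : ℕ} {σ : (stageVocab V).Pred} {b : Bool}
  {i j : V.Pred} {m : ℕ} {x : Fin (V.arity i) → Term (stageVocab V) m}
  {y : Fin (V.arity j) → Term (stageVocab V) m}

include hS

theorem Stratum.PosAffected.sign_bodyOf {p : V.Pred} (hp : p ∈ S.affected)
    (h : (S.bodyOf i).OccursSigned p b) : b = true := by
  obtain ⟨ax, hax, h⟩ := Stratum.occursSigned_bodyOf h
  cases b with
  | true => rfl
  | false => exact absurd h (hS ax hax p (Stratum.mem_affected.1 hp))

theorem occursSigned_withLt (hj : j ∈ S.affected)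
    (h : ((S.bodyOf i).withLt S.affected j x y).OccursSigned σ b) :
    S.StageOccurrence l σ b := by
  obtain ⟨p, b', hp, m, t, y, h⟩ := Formula.occursSigned_replace _ _ _ h
  split_ifs at h with hpA
  · obtain ⟨h1, rfl⟩ := h
    exact .inl ⟨by simpa [hS.sign_bodyOf hpA hp] using h1, hpA, hj⟩
  · obtain ⟨h, rfl⟩ := h
    obtain ⟨ax, hax, h⟩ := Stratum.occursSigned_bodyOf hp
    exact .inr ⟨p, hpA, rfl, ax, hax, b', h⟩

theorem occursSigned_withLe (hj : j ∈ S.affected)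
    (h : ((S.bodyOf i).withLe S.affected j x y).OccursSigned σ b) :
    S.StageOccurrence l σ b := by
  obtain ⟨p, b', hp, m, t, y, h⟩ := Formula.occursSigned_replace _ _ _ h
  split_ifs at h with hpA
  · obtain ⟨h1, rfl⟩ := h
    exact .inl ⟨by simpa [hS.sign_bodyOf hpA hp] using h1, hpA, hj⟩
  · obtain ⟨h, rfl⟩ := h
    obtain ⟨ax, hax, h⟩ := Stratum.occursSigned_bodyOf hp
    exact .inr ⟨p, hpA, rfl, ax, hax, b', h⟩

/-- The sign is `!b` because this formula always stands under a negation in a stage axiom. That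
negation and the one in `¬⊀` cancel, so `⊀` occurs positively. -/
theorem occursSigned_withNotNlt (hj : j ∈ S.affected)
    (h : ((S.bodyOf i).withNotNlt S.affected j x y).OccursSigned σ (!b)) :
    S.StageOccurrence l σ b := by
  obtain ⟨p, b', hp, m, t, y, h⟩ := Formula.occursSigned_replace _ _ _ h
  split_ifs at h with hpA
  · obtain ⟨h1, rfl⟩ := h
    exact .inl ⟨by simpa [hS.sign_bodyOf hpA hp] using h1, hpA, hj⟩
  · obtain ⟨h, rfl⟩ := h
    obtain ⟨ax, hax, h⟩ := Stratum.occursSigned_bodyOf hp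
    exact .inr ⟨p, hpA, rfl, ax, hax, b', h⟩

theorem occursSigned_withNotNle (hj : j ∈ S.affected)
    (h : ((S.bodyOf i).withNotNle S.affected j x y).OccursSigned σ (!b)) :
    S.StageOccurrence l σ b := by
  obtain ⟨p, b', hp, m, t, y, h⟩ := Formula.occursSigned_replace _ _ _ h
  split_ifs at h with hpA
  · obtain ⟨h1, rfl⟩ := h
    exact .inl ⟨by simpa [hS.sign_bodyOf hpA hp] using h1, hpA, hj⟩
  · obtain ⟨h, rfl⟩ := h
    obtain ⟨ax, hax, h⟩ := Stratum.occursSigned_bodyOf hp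
    exact .inr ⟨p, hpA, rfl, ax, hax, b', h⟩

omit hS in
-- The signs `b` and `b'` are unrelated because only unaffected original predicates survive, and
-- these are admissible with any sign.
theorem occursSigned_withBot {b' : Bool}
    (h : ((S.bodyOf i).withBot S.affected x).OccursSigned σ b') :
    S.StageOccurrence l σ b := by
  obtain ⟨p, b', hp, m, t, y, h⟩ := Formula.occursSigned_replace _ _ _ h
  split_ifs at h with hpA
  · exact h.elim
  · obtain ⟨h, rfl⟩ := h
    obtain ⟨ax, hax, h⟩ := Stratum.occursSigned_bodyOf hp
    exact .inr ⟨p, hpA, rfl, ax, hax, b', h⟩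

theorem stageAxioms_occurrence {ax : Ax (stageVocab V)} (hax : ax ∈ stageAxioms l S)
    (h : ax.body.OccursSigned σ b) : S.StageOccurrence l σ b := by
  rw [mem_stageAxioms] at hax
  obtain rfl | ⟨i, hi, rfl | ⟨j, hj, rfl | rfl | rfl | rfl | rfl⟩⟩ := hax
  · obtain ⟨k, hk, h⟩ := Formula.occursSigned_bigAnd (V := stageVocab V) h
    replace h := (Formula.occursSigned_allN (V := stageVocab V) _ _).1 h
    exact occursSigned_withBot (b' := !b) h
  · obtain ⟨k, hk, h⟩ := Formula.occursSigned_bigAnd (V := stageVocab V) h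
    obtain h | h := (Formula.occursSigned_allN _ _).1 h
    · exact occursSigned_withNotNle hS hi h
    · exact occursSigned_withLt hS hi h
  · obtain ⟨k, hk, h⟩ := Formula.occursSigned_bigOr (V := stageVocab V) h
    obtain ⟨h1, rfl⟩ | ⟨h1, rfl⟩ := (Formula.occursSigned_exN _ _).1 h
    · exact .inl ⟨h1, hi, hk⟩
    · exact .inl ⟨h1, hk, hj⟩
  · exact occursSigned_withLt hS hj h
  · obtain h | h | ⟨h, rfl⟩ := h
    · exact occursSigned_withBot h
    · obtain ⟨k, hk, h⟩ := Formula.occursSigned_bigOr (V := stageVocab V) h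
      obtain ⟨h1, rfl⟩ | ⟨h1, rfl⟩ := (Formula.occursSigned_exN _ _).1 h
      · exact .inl ⟨h1, hi, hk⟩
      · exact .inl ⟨h1, hk, hj⟩
    · exact .inl ⟨h, rfl⟩
  · exact occursSigned_withNotNlt hS hj h
  · obtain h | h | h | ⟨h, rfl⟩ := h
    · exact occursSigned_withLt hS hi h
    · exact occursSigned_withNotNlt hS hi h
    · exact occursSigned_withLe hS hi h
    · exact .inl ⟨h, hi⟩

end

end Occurrences

/-! ### One stratum together with its stage axioms. -/

section Strata

variable {V : Vocabulary.{u, v}} {O : Type w} {I : V.Const → O}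

/-! ### The extension of a transformed stratum -/

theorem Stratum.affects_append {S T : Stratum V} {p : V.Pred} :
    Stratum.Affects (S ++ T) p ↔ Stratum.Affects S p ∨ Stratum.Affects T p := by
  simp [Stratum.Affects, or_and_right, exists_or]

/-- The stratum over the extended vocabulary. -/
def Stratum.embed (S : Stratum V) : Stratum (stageVocab V) :=
  S.map fun ax => { head := StagePred.orig ax.head, body := ax.body.embed }

theorem Stratum.embed_affects {S : Stratum V} {σ : StagePred V} :
    Stratum.Affects (V := stageVocab V) S.embed σ ↔
      ∃ p, σ = StagePred.orig p ∧ Stratum.Affects S p := by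
  constructor
  · rintro ⟨ax, hax, rfl⟩
    obtain ⟨ax, hax1, rfl⟩ := List.mem_map.1 hax
    exact ⟨ax.head, rfl, ax, hax1, rfl⟩
  · rintro ⟨p, rfl, ax, hax, rfl⟩
    exact ⟨_, List.mem_map.2 ⟨ax, hax, rfl⟩, rfl⟩

theorem State.restrict_setTrue_orig (s : State (stageVocab V) O) (p : V.Pred)
    (a : Fin (V.arity p) → O) :
    (State.setTrue (V := stageVocab V) s (StagePred.orig p) a).restrict =
      s.restrict.setTrue p a := by
  funext q b
  refine propext (or_congr Iff.rfl ⟨fun h => ?_, fun h => ?_⟩)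
  · obtain ⟨h1, h2⟩ := Sigma.mk.inj_iff.1 h
    obtain rfl := StagePred.orig.inj h1
    obtain rfl := eq_of_heq h2
    rfl
  · cases h
    rfl

/-- Additional axioms for other predicates do not change the extension on the original
predicates. -/
theorem Stratum.Extends.restrict {S : Stratum V} {X : Stratum (stageVocab V)}
    (hX : ∀ p : V.Pred, ¬ Stratum.Affects (V := stageVocab V) X (StagePred.orig p))
    {s t : State (stageVocab V) O}
    (h : Stratum.Extends (V := stageVocab V) I (S.embed ++ X) s t) :
    Stratum.Extends I S s.restrict t.restrict := by
  constructor
  · replace h := h.1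
    induction h with
    | refl => exact .refl
    | @tail b c _ h ih =>
      obtain ⟨ax, hax, a, ha, hn, rfl⟩ := h
      obtain hax | hax := List.mem_append.1 hax
      · obtain ⟨ax, hax1, rfl⟩ := List.mem_map.1 hax
        exact ih.tail ⟨ax, hax1, a, (Formula.holds_embed _ _).1 ha, hn,
          State.restrict_setTrue_orig b ax.head a⟩
      · have : (State.setTrue (V := stageVocab V) b ax.head a).restrict = b.restrict := by
          funext p x
          exact propext (State.setTrue_of_ne (V := stageVocab V) (q := StagePred.orig p) b a x fun h => hX p ⟨ax, hax, h.symm⟩)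
        rw [this]
        exact ih
  · refine Stratum.closed_iff.1 fun ax hax a ha => ?_
    exact h.closed _ (List.mem_append_left _ (List.mem_map.2 ⟨ax, hax, rfl⟩)) a
      ((Formula.holds_embed _ _).2 ha)

/-- This is what makes the enlarged stratum compute a least closed state, so that the ideal state
bounds it. -/
theorem Stratum.PosAffected.embed_append_stageAxioms {S : Stratum V} (hS : S.PosAffected)
    (l : ℕ) : Stratum.PosAffected (V := stageVocab V) (S.embed ++ stageAxioms l S) := by
  intro ax hax σ ⟨ax', hax', hσ⟩ hocc
  have hσ' : (∃ p, σ = StagePred.orig p ∧ p ∈ S.affected) ∨ StagePred.Of S.affected l σ := by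
    obtain hax' | hax' := List.mem_append.1 hax'
    · obtain ⟨p, hp, h⟩ := Stratum.embed_affects.1 ⟨ax', hax', hσ⟩
      exact .inl ⟨p, hp, Stratum.mem_affected.2 h⟩
    · exact .inr (stageAxioms_affects.1 ⟨ax', hax', hσ⟩)
  obtain hax | hax := List.mem_append.1 hax
  · obtain ⟨ax, hax1, rfl⟩ := List.mem_map.1 hax
    obtain ⟨p, rfl, hp⟩ := Formula.occursSigned_embed hocc
    obtain ⟨q, hq, hqA⟩ | h := hσ'
    · cases hq
      exact hS ax hax1 p (Stratum.mem_affected.1 hqA) hp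
    · exact h
  · obtain ⟨h, -⟩ | ⟨p, hp, rfl, -⟩ := stageAxioms_occurrence hS hax hocc
    · cases h
    · obtain ⟨q, hq, hqA⟩ | h := hσ'
      · cases hq
        exact hp hqA
      · exact h

theorem stageAxioms_not_affects_orig {S : Stratum V} {l : ℕ} (p : V.Pred) :
    ¬ Stratum.Affects (V := stageVocab V) (stageAxioms l S) (StagePred.orig p) :=
  fun h => stageAxioms_affects.1 h

/-- The stage axioms of a stratum compute the complements of the affected predicates. -/
theorem Stratum.Extends.nle_iff [Finite O] {S : Stratum V} (hS : S.PosAffected) {l : ℕ}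
    {s t : State (stageVocab V) O} (h0 : ∀ σ : StagePred V, σ.Of S.affected l → ∀ a, ¬ s σ a)
    (hA : ∀ p ∈ S.affected, ∀ a, ¬ s (.orig p) a)
    (h : Stratum.Extends (V := stageVocab V) I (S.embed ++ stageAxioms l S) s t) {p : V.Pred}
    (hp : p ∈ S.affected) (x : Fin (V.arity p) → O) :
    t.nle p p x x ↔ ¬ t (.orig p) x := by
  have hr := h.restrict stageAxioms_not_affects_orig
  have hcl : StageClosed I l S t := stageClosed_iff.1 fun ax hax =>
    h.closed ax (List.mem_append_right _ hax)
  have hout : ∀ p, p ∉ S.affected → ∀ a, t (.orig p) a ↔ s (.orig p) a := fun p hp a =>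
    Stratum.path_unaffected hr.1 (fun h => hp (Stratum.mem_affected.2 h)) a
  refine (hcl.nle_iff hS h0 hA ?_ hout hp x).trans (not_congr (hr.iff_stage hS p x).symm)
  have hid : (idealState I l S s).restrict = t.restrict := by
    funext p a
    exact propext (hr.iff_stage hS p a).symm
  -- By minimality it suffices that the ideal state lies above `s`, agrees with it on unaffected
  -- predicates and is closed.
  refine Stratum.path_le _ (hS.embed_append_stageAxioms l) ?_ ?_ ?_ h.1
  · intro σ a hs
    cases σ with
    | orig p => exact ⟨0, hs⟩
    | _ => exact .inl hs
  · intro σ hσ a hid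
    rw [Stratum.affects_append] at hσ
    push Not at hσ
    replace hσ := And.intro (mt Stratum.embed_affects.2 hσ.1) (mt stageAxioms_affects.2 hσ.2)
    cases σ with
    | orig p =>
      obtain ⟨k, hk⟩ := hid
      exact (Stratum.stage_of_not_mem (fun h => hσ.1 ⟨p, rfl, Stratum.mem_affected.1 h⟩)
        s.restrict k a).1 hk
    | _ => exact hid.resolve_right fun h => hσ.2 h.1
  · intro ax hax
    obtain hax | hax := List.mem_append.1 hax
    · obtain ⟨ax, hax1, rfl⟩ := List.mem_map.1 hax
      intro a ha
      have ha' := (Formula.holds_embed _ _).1 ha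
      rw [hid] at ha'
      exact (hr.iff_stage hS _ _).1 (hr.closed ax hax1 a ha')
    · exact stageClosed_iff.2 (idealState_closed hS h0 hA) ax hax

end Strata

/-! ### Replacing negative atoms by negated diagonal atoms. -/

section Replacement

variable {V : Vocabulary.{u, v}} {O : Type w} {I : V.Const → O}

/-! ### The replacement of negative occurrences -/

theorem Formula.holds_replaceNeg {A : List V.Pred} {s : State (stageVocab V) O}
    (hs : ∀ p ∈ A, ∀ x, s.nle p p x x ↔ ¬ s (.orig p) x) {n : ℕ}
    (φ : Formula (stageVocab V) n) (b : Bool) (a : Fin n → O) :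
    (φ.replaceNeg A b).Holds (V := stageVocab V) I s a ↔ φ.Holds (V := stageVocab V) I s a := by
  induction φ generalizing b with
  | falsum => rfl
  | verum => rfl
  | atom σ ts =>
    cases σ with
    | orig p =>
      simp only [Formula.replaceNeg]
      split_ifs with h
      · exact (not_congr ((holds_nleAtom (I := I) (s := s) (i := p) (j := p) ts ts a).trans
          (hs p h.2 fun i => (ts i).eval (V := stageVocab V) I a))).trans not_not
      · rfl
    | _ => rfl
  | eq t t' => rfl
  | neg φ ih => exact not_congr (ih _ a)
  | and φ ψ ih ih' => exact and_congr (ih _ a) (ih' _ a)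
  | or φ ψ ih ih' => exact or_congr (ih _ a) (ih' _ a)
  | all φ ih => exact forall_congr' fun o => ih _ _
  | ex φ ih => exact exists_congr fun o => ih _ _

/-- Here `b` is the polarity of the context of `φ`, so an occurrence of sign `b'` within `φ` is
negative in the whole formula exactly if `b' ≠ b`. Such occurrences of predicates in `A` disappear,
and the new `nle` atoms are positive in the whole. -/
theorem Formula.occursSigned_replaceNeg {A : List V.Pred} {σ : StagePred V} {n : ℕ}
    {φ : Formula (stageVocab V) n} {b b' : Bool}
    (h : (φ.replaceNeg A b).OccursSigned (V := stageVocab V) σ b') :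
    (φ.OccursSigned (V := stageVocab V) σ b' ∧ ¬ (b' ≠ b ∧ ∃ p ∈ A, σ = .orig p)) ∨
      (b' = b ∧ ∃ p ∈ A, σ = .nle p p) := by
  induction φ generalizing b b' with
  | falsum => exact h.elim
  | verum => exact h.elim
  | eq t t' => exact h.elim
  | atom τ ts =>
    cases τ with
    | orig p =>
      simp only [Formula.replaceNeg] at h
      split_ifs at h with hp
      · obtain ⟨h1, h2⟩ := h
        refine .inr ⟨?_, p, hp.2, h2.symm⟩
        rw [hp.1]
        simpa using h1
      · obtain ⟨rfl, h2⟩ := h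
        refine .inl ⟨⟨rfl, h2⟩, ?_⟩
        rintro ⟨hb, q, hq, rfl⟩
        obtain rfl := StagePred.orig.inj h2
        exact hp ⟨by simpa using hb.symm, hq⟩
    | _ =>
      obtain ⟨h1, h2⟩ := h
      refine .inl ⟨⟨h1, h2⟩, ?_⟩
      rintro ⟨-, q, -, rfl⟩
      cases h2
  | neg φ ih =>
    obtain ⟨h1, h2⟩ | ⟨h1, h2⟩ := ih (b := !b) (b' := !b') h
    · exact .inl ⟨h1, fun h => h2 ⟨by simpa using h.1, h.2⟩⟩
    · exact .inr ⟨by simpa using h1, h2⟩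
  | and φ ψ ih ih' =>
    obtain h | h := h
    · exact (ih h).imp_left fun h => ⟨.inl h.1, h.2⟩
    · exact (ih' h).imp_left fun h => ⟨.inr h.1, h.2⟩
  | or φ ψ ih ih' =>
    obtain h | h := h
    · exact (ih h).imp_left fun h => ⟨.inl h.1, h.2⟩
    · exact (ih' h).imp_left fun h => ⟨.inr h.1, h.2⟩
  | all φ ih => exact ih (b := b) h
  | ex φ ih => exact ih (b := b) h

/-- The replacement of negative occurrences for the strata of `P` with numbers in `L`. -/
noncomputable def Program.replaceFor (P : Program V) (L : List ℕ) {n : ℕ}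
    (φ : Formula (stageVocab V) n) : Formula (stageVocab V) n :=
  L.foldr (fun l φ => φ.replaceNeg (Stratum.affected (P.getD l [])) true) φ

theorem Program.holds_replaceFor {P : Program V} {L : List ℕ} {s : State (stageVocab V) O}
    (hs : ∀ l ∈ L, ∀ p ∈ Stratum.affected (P.getD l []), ∀ x,
      s.nle p p x x ↔ ¬ s (.orig p) x) {n : ℕ} (φ : Formula (stageVocab V) n) (a : Fin n → O) :
    (P.replaceFor L φ).Holds (V := stageVocab V) I s a ↔ φ.Holds (V := stageVocab V) I s a := by
  induction L with
  | nil => rfl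
  | cons l L ih =>
    exact (Formula.holds_replaceNeg (hs l (by simp)) _ true a).trans
      (ih fun l hl => hs l (by simp [hl]))

theorem Program.occursSigned_replaceFor {P : Program V} {L : List ℕ} {σ : StagePred V} {n : ℕ}
    {φ : Formula (stageVocab V) n} {b : Bool}
    (h : (P.replaceFor L φ).OccursSigned (V := stageVocab V) σ b) :
    φ.OccursSigned (V := stageVocab V) σ b ∨
      (b = true ∧ ∃ l ∈ L, ∃ p ∈ Stratum.affected (P.getD l []), σ = .nle p p) := by
  induction L with
  | nil => exact .inl h
  | cons l L ih =>
    obtain ⟨h, -⟩ | ⟨h, p, hp, hσ⟩ := Formula.occursSigned_replaceNeg h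
    · exact (ih h).imp_right fun ⟨hb, l, hl, h⟩ => ⟨hb, l, by simp [hl], h⟩
    · exact .inr ⟨h, l, by simp, p, hp, hσ⟩

end Replacement

/-! ### The invariant of the elimination procedure and its consequences. -/

section Elimination

variable {V : Vocabulary.{u, v}}

/-! ### The shape of the transformed program -/

/-- The axiom with another body. -/
def Ax.mapBody (F : {n : ℕ} → Formula V n → Formula V n) (ax : Ax V) : Ax V :=
  { head := ax.head, body := F ax.body }

theorem Stratum.affects_mapBody {F : {n : ℕ} → Formula V n → Formula V n} {S : Stratum V}
    {p : V.Pred} : Stratum.Affects (S.map (Ax.mapBody F)) p ↔ Stratum.Affects S p := by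
  simp [Stratum.Affects, Ax.mapBody]

/-- The bodies need to be equivalent only in states that agree with `s` outside the affected
predicates, and the loop visits no others. -/
theorem Stratum.Extends.of_mapBody {O : Type w} {I : V.Const → O}
    {F : {n : ℕ} → Formula V n → Formula V n} {S : Stratum V} {s t : State V O}
    (hF : ∀ u : State V O, (∀ p, ¬ Stratum.Affects S p → ∀ a, u p a ↔ s p a) →
      ∀ ax ∈ S, ∀ a, (F ax.body).Holds I u a ↔ ax.body.Holds I u a)
    (h : Stratum.Extends I (S.map (Ax.mapBody F)) s t) : Stratum.Extends I S s t := by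
  have hun : ∀ {u : State V O},
      Relation.ReflTransGen (Stratum.Step I (S.map (Ax.mapBody F))) s u →
      ∀ p, ¬ Stratum.Affects S p → ∀ a, u p a ↔ s p a := fun hu p hp a =>
    Stratum.path_unaffected hu (fun h => hp (Stratum.affects_mapBody.1 h)) a
  constructor
  · replace h := h.1
    induction h with
    | refl => exact .refl
    | @tail b c hb hc ih =>
      obtain ⟨ax, hax, a, ha, hn, rfl⟩ := hc
      obtain ⟨ax, hax, rfl⟩ := List.mem_map.1 hax
      exact ih.tail ⟨ax, by assumption, a, (hF b (hun hb) ax (by assumption) a).1 ha, hn, rfl⟩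
  · refine Stratum.closed_iff.1 fun ax hax a ha => ?_
    exact h.closed _ (List.mem_map.2 ⟨ax, hax, rfl⟩) a ((hF t (hun h.1) ax hax a).2 ha)

/-- The program `Q` arises from `P` by processing the strata with numbers at least `m`, where
stage axioms are added to the strata with numbers in `c`. -/
structure Program.EliminatedFrom (P : Program V) (c : ℕ → Prop) (m : ℕ)
    (Q : Program (stageVocab V)) : Prop where
  length_eq : Q.length = P.length
  le_of_mem : ∀ l, c l → m ≤ l
  -- A stratum without affected predicates has size bound `0`, but its stage axioms would still
  -- contain the one for `none`.
  affected_ne_nil : ∀ l, c l → Stratum.affected (P.getD l []) ≠ []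
  -- Stage axioms are formed from the unmodified stratum, and the replacements for earlier strata
  -- act on them as well.
  shape : ∀ i (hi : i < Q.length), ∃ (L : List ℕ) (X : Stratum (stageVocab V)),
    (∀ l ∈ L, l < i ∧ c l) ∧
    ((c i ∧ X = stageAxioms i (P.getD i [])) ∨ (¬ c i ∧ X = [])) ∧
    Q[i] = (Stratum.embed (P.getD i []) ++ X).map (Ax.mapBody (V := stageVocab V)
      (P.replaceFor L))
  not_neg : ∀ l, m ≤ l → ∀ p ∈ Stratum.affected (P.getD l []), ∀ T ∈ Q, ∀ ax ∈ T,
    ¬ ax.body.OccursNeg (V := stageVocab V) (.orig p)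

theorem Program.lt_of_mem_affected {P : Program V} {l : ℕ} {p : V.Pred}
    (h : p ∈ Stratum.affected (P.getD l [])) : l < P.length := by
  by_contra hl
  rw [List.getD_eq_default _ _ (not_lt.1 hl), Stratum.mem_affected] at h
  obtain ⟨ax, hax, -⟩ := h
  simp at hax

theorem Program.mem_affected_getD {P : Program V} {l : ℕ} (hl : l < P.length) {p : V.Pred} :
    p ∈ Stratum.affected (P.getD l []) ↔ Stratum.Affects P[l] p := by
  rw [Stratum.mem_affected, List.getD_eq_getElem _ _ hl]

/-- The predicate is an original or a stage predicate of the stratum of `P` with number `l`. -/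
def Program.HasLevel (P : Program V) (σ : StagePred V) (l : ℕ) : Prop :=
  (∃ p ∈ Stratum.affected (P.getD l []), σ = .orig p) ∨
    σ.Of (Stratum.affected (P.getD l [])) l

theorem Program.IsStratified.affected_unique {P : Program V} (hP : P.IsStratified) {i j : ℕ}
    {p : V.Pred} (hi : p ∈ Stratum.affected (P.getD i []))
    (hj : p ∈ Stratum.affected (P.getD j [])) : i = j :=
  hP.affects_unique (Program.lt_of_mem_affected hi) (Program.lt_of_mem_affected hj)
    ((Program.mem_affected_getD _).1 hi) ((Program.mem_affected_getD _).1 hj)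

/-- A stage predicate carries original predicates or the stratum number in its name and inherits
uniqueness from them. -/
theorem Program.IsStratified.hasLevel_unique {P : Program V} (hP : P.IsStratified) {i j : ℕ}
    {σ : StagePred V} (hi : P.HasLevel σ i) (hj : P.HasLevel σ j) : i = j := by
  obtain ⟨p, hp, rfl⟩ | hi := hi
  · obtain ⟨q, hq, h⟩ | hj := hj
    · cases h
      exact hP.affected_unique hp hq
    · exact hj.elim
  · obtain ⟨q, hq, rfl⟩ | hj := hj
    · exact hi.elim
    · cases σ with
      | orig p => exact hi.elim
      | none l => exact hi.symm.trans hj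
      | fix p => exact hP.affected_unique hi hj
      | _ => exact hP.affected_unique hi.1 hj.1

theorem Program.IsStratified.le_of_occurs {P : Program V} (hP : P.IsStratified) {i l : ℕ}
    {p : V.Pred} {ax : Ax V} (hax : ax ∈ P.getD i []) {b : Bool}
    (h : ax.body.OccursSigned p b) (hp : p ∈ Stratum.affected (P.getD l [])) : l ≤ i := by
  have hl := Program.lt_of_mem_affected hp
  have hi : i < P.length := Program.lt_of_mem_affected
    (Stratum.mem_affected.2 ⟨ax, hax, rfl⟩)
  rw [List.getD_eq_getElem _ _ hi] at hax
  rw [Program.mem_affected_getD hl] at hp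
  cases b with
  | true => exact (hP ⟨i, hi⟩ ax hax).2.2.1 p h ⟨l, hl⟩ hp
  | false => exact ((hP ⟨i, hi⟩ ax hax).2.2.2 p h ⟨l, hl⟩ hp).le

theorem Program.IsStratified.lt_of_occursNeg {P : Program V} (hP : P.IsStratified) {i l : ℕ}
    {p : V.Pred} {ax : Ax V} (hax : ax ∈ P.getD i [])
    (h : ax.body.OccursNeg p) (hp : p ∈ Stratum.affected (P.getD l [])) : l < i := by
  have hl := Program.lt_of_mem_affected hp
  have hi : i < P.length := Program.lt_of_mem_affected
    (Stratum.mem_affected.2 ⟨ax, hax, rfl⟩)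
  rw [List.getD_eq_getElem _ _ hi] at hax
  rw [Program.mem_affected_getD hl] at hp
  exact (hP ⟨i, hi⟩ ax hax).2.2.2 p h ⟨l, hl⟩ hp

theorem Program.IsStratified.posAffected_getD {P : Program V} (hP : P.IsStratified) (i : ℕ) :
    Stratum.PosAffected (P.getD i []) := fun _ hax _ hp h =>
  lt_irrefl _ (hP.lt_of_occursNeg hax h (Stratum.mem_affected.2 hp))

section

variable {P : Program V} {c : ℕ → Prop} {m : ℕ} {Q : Program (stageVocab V)}

theorem Program.EliminatedFrom.affects (h : P.EliminatedFrom c m Q) {i : ℕ} (hi : i < Q.length)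
    {σ : StagePred V} : Stratum.Affects (V := stageVocab V) Q[i] σ ↔
      (∃ p ∈ Stratum.affected (P.getD i []), σ = .orig p) ∨
        (c i ∧ σ.Of (Stratum.affected (P.getD i [])) i) := by
  obtain ⟨L, X, -, hX, he⟩ := h.shape i hi
  rw [he]
  refine (Stratum.affects_mapBody (V := stageVocab V)).trans
    ((Stratum.affects_append (V := stageVocab V)).trans (or_congr ?_ ?_))
  · refine Stratum.embed_affects.trans (exists_congr fun p => ?_)
    rw [Stratum.mem_affected, and_comm]
  · obtain ⟨hc, rfl⟩ | ⟨hc, rfl⟩ := hX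
    · exact stageAxioms_affects.trans (and_iff_right hc).symm
    · exact iff_of_false (fun ⟨ax, hax, _⟩ => by simp at hax) fun h => hc h.1

theorem Program.EliminatedFrom.hasLevel (h : P.EliminatedFrom c m Q) {i : ℕ} (hi : i < Q.length)
    {σ : StagePred V} (hσ : Stratum.Affects (V := stageVocab V) Q[i] σ) : P.HasLevel σ i :=
  ((h.affects hi).1 hσ).imp_right And.right

theorem Program.EliminatedFrom.occurs (hP : P.IsStratified) (h : P.EliminatedFrom c m Q) {i : ℕ}
    (hi : i < Q.length) {ax : Ax (stageVocab V)} (hax : ax ∈ Q[i]) {σ : StagePred V} {b : Bool}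
    (hσ : ax.body.OccursSigned (V := stageVocab V) σ b) :
    (∃ p, σ = .orig p ∧ ∃ ax ∈ P.getD i [], ∃ b', ax.body.OccursSigned p b') ∨
      (b = true ∧ ∃ l ≤ i, σ.Of (Stratum.affected (P.getD l [])) l) := by
  obtain ⟨L, X, hL, hX, he⟩ := h.shape i hi
  rw [he] at hax
  obtain ⟨ax, hax1, rfl⟩ := List.mem_map.1 hax
  obtain hσ1 | ⟨hb, l, hl, p, hp, rfl⟩ := Program.occursSigned_replaceFor hσ
  · obtain hax1 | hax1 := List.mem_append.1 hax1
    · obtain ⟨ax, hax2, rfl⟩ := List.mem_map.1 hax1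
      obtain ⟨p, rfl, hp⟩ := Formula.occursSigned_embed hσ1
      exact .inl ⟨p, rfl, ax, hax2, b, hp⟩
    · obtain ⟨hc, rfl⟩ | ⟨hc, rfl⟩ := hX
      · obtain hst | ⟨p, -, hst⟩ := stageAxioms_occurrence (hP.posAffected_getD i) hax1 hσ1
        · exact .inr ⟨hst.1, i, le_rfl, hst.2⟩
        · exact .inl ⟨p, hst⟩
      · simp at hax1
  · exact .inr ⟨hb, l, (hL l hl).1.le, hp, hp⟩

/-- A stage predicate enters a body through the stage axioms of its own stratum or through a
replacement in a later one, so never before its level. -/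
theorem Program.EliminatedFrom.level_le (hP : P.IsStratified) (h : P.EliminatedFrom c m Q)
    {i : ℕ} (hi : i < Q.length) {ax : Ax (stageVocab V)} (hax : ax ∈ Q[i]) {σ : StagePred V}
    {b : Bool} (hσ : ax.body.OccursSigned (V := stageVocab V) σ b) {l : ℕ}
    (hl : P.HasLevel σ l) : l ≤ i := by
  obtain ⟨p, rfl, ax', hax', b', hp⟩ | ⟨-, k, hk, hσk⟩ := h.occurs hP hi hax hσ
  · obtain ⟨q, hq, he⟩ | hl := hl
    · cases he
      exact hP.le_of_occurs hax' hp hq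
    · exact hl.elim
  · rw [hP.hasLevel_unique hl (.inr hσk)]
    exact hk

/-- Predicates of the last stratum cannot occur negatively anywhere, which is why the procedure may
start one stratum earlier. -/
theorem Program.embed_eliminatedFrom (hP : P.IsStratified) :
    P.EliminatedFrom (fun _ => False) (P.length - 1) P.embed := by
  refine ⟨by simp [Program.embed], fun _ h => h.elim, fun _ h => h.elim,
    fun i hi => ⟨[], [], by simp, by simp, ?_⟩,
    ?_⟩
  · have hi' : i < P.length := by simpa [Program.embed] using hi
    simp only [Program.embed, List.getElem_map, List.getD_eq_getElem _ _ hi', List.append_nil,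
      Stratum.embed]
    exact (List.map_id _).symm
  · intro l hl p hp T hT ax hax hn
    have hl' := Program.lt_of_mem_affected hp
    obtain ⟨S, hS, rfl⟩ := List.mem_map.1 hT
    obtain ⟨ax, hax1, rfl⟩ := List.mem_map.1 hax
    obtain ⟨i, hi, rfl⟩ := List.getElem_of_mem hS
    obtain ⟨q, hq, hn'⟩ := Formula.occursSigned_embed hn
    cases hq
    rw [← List.getD_eq_getElem _ [] hi] at hax1
    have := hP.lt_of_occursNeg hax1 hn' hp
    omega

theorem Program.EliminatedFrom.step (hP : P.IsStratified) {l : ℕ}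
    (h : P.EliminatedFrom c (l + 1) Q) : ∃ c', P.EliminatedFrom c' l (P.elimStep l Q) := by
  have hcl : ¬ c l := fun hc => absurd (h.le_of_mem l hc) (by omega)
  unfold Program.elimStep
  split_ifs with hcond
  · refine ⟨fun i => c i ∨ i = l, by simpa using h.length_eq, ?_, ?_, ?_, ?_⟩
    · rintro i (hi | rfl)
      · exact Nat.le_of_succ_le (h.le_of_mem i hi)
      · exact le_rfl
    · rintro i (hi | rfl)
      · exact h.affected_ne_nil i hi
      · obtain ⟨p, hp, -⟩ := hcond
        exact List.ne_nil_of_mem hp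
    · intro i hi
      have hi' : i < Q.length := by simpa using hi
      obtain ⟨L, X, hL, hX, he⟩ := h.shape i hi'
      rw [List.getElem_mapIdx]
      split_ifs with h1 h2
      · refine ⟨L, X, fun k hk => ⟨(hL k hk).1, .inl (hL k hk).2⟩, ?_, he⟩
        simpa [h1.ne] using hX
      · subst h2
        -- Only strata after `l` have been processed and replacements act only on still later ones,
        -- so stratum `l` is unchanged.
        have hLnil : L = [] := List.eq_nil_iff_forall_not_mem.2 fun k hk =>
          absurd (h.le_of_mem k (hL k hk).2) (by have := (hL k hk).1; omega)
        obtain rfl : X = [] := by simpa [hcl] using hX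
        refine ⟨[], stageAxioms i (P.getD i []), by simp, .inl ⟨.inr rfl, rfl⟩, ?_⟩
        rw [he, hLnil, List.append_nil, List.map_append]
        exact congrArg _ (List.map_id _).symm
      · refine ⟨l :: L, X, ?_, ?_, ?_⟩
        · intro k hk
          obtain rfl | hk := List.mem_cons.1 hk
          · exact ⟨by omega, .inr rfl⟩
          · exact ⟨(hL k hk).1, .inl (hL k hk).2⟩
        · simpa [h2] using hX
        · rw [he, List.map_map]
          rfl
    · intro k hk p hp T hT ax hax hn
      obtain ⟨i, hi, rfl⟩ := List.getElem_of_mem hT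
      have hi' : i < Q.length := by simpa using hi
      have hocc : ∀ ax ∈ Q[i], ax.body.OccursNeg (V := stageVocab V) (.orig p) → l ≤ i ∧ k ≤ i := by
        intro ax hax hn
        have := h.level_le hP hi' hax hn (.inl ⟨p, hp, rfl⟩)
        omega
      rw [List.getElem_mapIdx] at hax
      split_ifs at hax with h1 h2
      · exact absurd (hocc ax hax hn).1 (by omega)
      · subst h2
        obtain hax | hax := List.mem_append.1 hax
        · obtain hik | hik := hk.eq_or_lt
          · subst hik
            obtain ⟨L, X, hL, hX, he⟩ := h.shape i hi'
            obtain rfl : X = [] := by simpa [hcl] using hX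
            rw [he, List.append_nil] at hax
            obtain ⟨ax, hax1, rfl⟩ := List.mem_map.1 hax
            obtain ⟨ax, hax2, rfl⟩ := List.mem_map.1 hax1
            obtain hn1 | ⟨hb, -⟩ := Program.occursSigned_replaceFor hn
            · obtain ⟨q, hq, hn2⟩ := Formula.occursSigned_embed hn1
              cases hq
              exact lt_irrefl _ (hP.lt_of_occursNeg hax2 hn2 hp)
            · cases hb
          · exact absurd (hocc ax hax hn).2 (by omega)
        -- A negative occurrence in a new stage axiom is of an original predicate outside this
        -- stratum; stratification places it in an earlier one, against `l ≤ k`.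
        · obtain ⟨hb, -⟩ | ⟨q, hq, he, ax', hax', b', hq'⟩ :=
            stageAxioms_occurrence (hP.posAffected_getD i) hax hn
          · cases hb
          · cases he
            have hki := hP.le_of_occurs hax' hq' hp
            obtain rfl : k = i := by omega
            exact hq hp
      · obtain ⟨ax, hax1, rfl⟩ := List.mem_map.1 hax
        obtain ⟨hn1, hn2⟩ | ⟨hb, -⟩ := Formula.occursSigned_replaceNeg hn
        · obtain hik | hik := hk.eq_or_lt
          · subst hik
            exact hn2 ⟨by simp, p, hp, rfl⟩
          · exact h.not_neg k hik p hp _ (List.getElem_mem hi') ax hax1 hn1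
        · cases hb
  · refine ⟨c, h.length_eq, fun i hi => Nat.le_of_succ_le (h.le_of_mem i hi),
      h.affected_ne_nil, h.shape, ?_⟩
    intro k hk p hp T hT ax hax hn
    obtain hik | hik := hk.eq_or_lt
    · subst hik
      exact hcond ⟨p, hp, T, hT, ax, hax, hn⟩
    · exact h.not_neg k hik p hp T hT ax hax hn

theorem Program.IsStratified.eliminatedFrom (hP : P.IsStratified) :
    ∃ c, P.EliminatedFrom c 0 P.eliminate := by
  have key : ∀ k Q, (∃ c, P.EliminatedFrom c k Q) →
      ∃ c, P.EliminatedFrom c 0 ((List.range k).foldr (fun l Q => P.elimStep l Q) Q) := by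
    intro k
    induction k with
    | zero => exact fun Q h => h
    | succ k ih =>
      rintro Q ⟨c, h⟩
      -- The largest index is innermost in the fold and is thus processed first.
      rw [List.range_succ, List.foldr_append]
      exact ih _ (h.step hP)
  exact key _ _ ⟨_, Program.embed_eliminatedFrom hP⟩

theorem Program.EliminatedFrom.noNegDerived (hP : P.IsStratified) (h : P.EliminatedFrom c 0 Q) :
    Q.NoNegDerived := by
  intro T hT ax hax σ hσ hn
  obtain ⟨j, hj, hσj⟩ := hσ.exists_index
  obtain ⟨i, hi, rfl⟩ := List.getElem_of_mem hT
  obtain ⟨p, hp, rfl⟩ | ⟨-, hσ'⟩ := (h.affects hj).1 hσj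
  · exact h.not_neg j (Nat.zero_le _) p hp _ hT ax hax hn
  · obtain ⟨p, rfl, -⟩ | ⟨hb, -⟩ := h.occurs hP hi hax hn
    · exact hσ'.elim
    · cases hb

theorem Program.EliminatedFrom.isStratified (hP : P.IsStratified)
    (h : P.EliminatedFrom c 0 Q) : Q.IsStratified := by
  rintro ⟨i, hi⟩ ax hax
  have hlev : P.HasLevel ax.head i := h.hasLevel hi ⟨ax, hax, rfl⟩
  refine ⟨fun k hk hσ => hk ?_, fun k hk hm => ?_, fun σ hσ j hj => ?_, fun σ hσ j hj => ?_⟩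
  · exact Fin.ext (hP.hasLevel_unique (h.hasLevel k.2 hσ) hlev)
  · refine absurd hk (not_lt.2 (Fin.mk_le_of_le_val ?_))
    obtain ⟨ax', hax', he | ho | ho⟩ := hm
    · exact (hP.hasLevel_unique hlev (h.hasLevel k.2 ⟨ax', hax', he⟩)).le
    · exact h.level_le hP k.2 hax' ho hlev
    · exact h.level_le hP k.2 hax' ho hlev
  · exact h.level_le hP hi hax hσ (h.hasLevel j.2 hj)
  · exact absurd hσ (h.noNegDerived hP _ (List.getElem_mem hi) ax hax σ
      (Program.derived_of_affects j.2 hj))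

theorem Program.EliminatedFrom.derived_orig (h : P.EliminatedFrom c m Q) (p : V.Pred) :
    Q.Derived (V := stageVocab V) (.orig p) ↔ P.Derived p := by
  constructor
  · intro hd
    obtain ⟨i, hi, hp⟩ := hd.exists_index
    obtain ⟨q, hq, he⟩ | ⟨-, hf⟩ := (h.affects hi).1 hp
    · cases he
      have hi' := Program.lt_of_mem_affected hq
      exact Program.derived_of_affects hi' ((Program.mem_affected_getD hi').1 hq)
    · exact hf.elim
  · intro hd
    obtain ⟨i, hi, hp⟩ := hd.exists_index
    have hi' : i < Q.length := h.length_eq ▸ hi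
    exact Program.derived_of_affects (V := stageVocab V) hi'
      ((h.affects hi').2 (.inl ⟨p, (Program.mem_affected_getD hi).2 hp, rfl⟩))

/-! ### Comparison of the extended states -/

/-- The transformed program computes the same values of the original predicates. -/
theorem Program.EliminatedFrom.restrict_extends {O : Type w} [Finite O] {I : V.Const → O}
    (hP : P.IsStratified) (h : P.EliminatedFrom c 0 Q) {s t' : State (stageVocab V) O}
    {t : State V O} (ht : P.Extends I s.restrict t)
    (ht' : Program.Extends (V := stageVocab V) Q I s t') : t'.restrict = t := by
  obtain ⟨f, hf0, rfl, hf⟩ := (Program.runStrata_iff _ _ _).1 ht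
  obtain ⟨g, hg0, rfl, hg⟩ := (Program.runStrata_iff (V := stageVocab V) _ _ _).1 ht'
  have hQ := h.isStratified hP
  -- Besides agreement on original predicates, the induction carries that the diagonal `nle` atoms
  -- of the strata passed so far are correct complements.
  have key : ∀ i, i ≤ P.length → (g i).restrict = f i ∧
      ∀ l < i, c l → ∀ p ∈ Stratum.affected (P.getD l []), ∀ x,
        (g i).nle p p x x ↔ ¬ g i (.orig p) x := by
    intro i
    induction i with
    | zero =>
      refine fun _ => ⟨?_, fun l hl => absurd hl (Nat.not_lt_zero l)⟩
      rw [hf0, hg0]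
      funext p a
      exact propext (and_congr_right fun _ => not_congr (h.derived_orig p))
    | succ i ih =>
      intro hi
      have hi' : i < Q.length := h.length_eq ▸ hi
      obtain ⟨hr, hgood⟩ := ih (Nat.le_of_succ_le hi)
      obtain ⟨L, X, hL, hX, he⟩ := h.shape i hi'
      -- Stratum `i` affects neither side of the complement relation of an earlier stratum, so it
      -- persists while stratum `i` is evaluated.
      have hpres : ∀ u : State (stageVocab V) O,
          (∀ σ, ¬ Stratum.Affects (V := stageVocab V) Q[i] σ → ∀ a, u σ a ↔ g i σ a) →
          ∀ l < i, c l → ∀ p ∈ Stratum.affected (P.getD l []), ∀ x,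
            u.nle p p x x ↔ ¬ u (.orig p) x := by
        intro u hu l hl hc p hp x
        have h1 : ¬ Stratum.Affects (V := stageVocab V) Q[i] (.nle p p) := fun hσ =>
          hl.ne (hP.hasLevel_unique (σ := .nle p p) (.inr ⟨hp, hp⟩) (h.hasLevel hi' hσ))
        have h2 : ¬ Stratum.Affects (V := stageVocab V) Q[i] (.orig p) := fun hσ =>
          hl.ne (hP.hasLevel_unique (.inl ⟨p, hp, rfl⟩) (h.hasLevel hi' hσ))
        exact (hu _ h1 _).trans ((hgood l hl hc p hp x).trans (not_congr (hu _ h2 x).symm))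
      -- Replaced bodies are equivalent to the old ones in all states of the loop, so the
      -- replacements may be undone for the analysis of this stratum.
      have hB : Stratum.Extends (V := stageVocab V) I (Stratum.embed (P.getD i []) ++ X)
          (g i) (g (i + 1)) := by
        have hE := hg i hi'
        rw [he] at hE
        refine hE.of_mapBody fun u hu ax _ a => ?_
        refine Program.holds_replaceFor (fun l hl => hpres u ?_ l (hL l hl).1 (hL l hl).2) _ a
        intro σ hσ
        refine hu σ fun hσ' => hσ ?_
        rw [he]
        exact Stratum.affects_mapBody.2 hσ'
      have hXorig : ∀ p : V.Pred,
          ¬ Stratum.Affects (V := stageVocab V) X (StagePred.orig p) := by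
        obtain ⟨-, rfl⟩ | ⟨-, rfl⟩ := hX
        · exact stageAxioms_not_affects_orig
        · rintro p ⟨ax, hax, -⟩
          simp at hax
      constructor
      · have hR := hB.restrict hXorig
        rw [List.getD_eq_getElem _ _ hi, hr] at hR
        exact hR.unique (hP.posAffected hi) (hf i hi)
      · intro l hl hc p hp x
        obtain rfl | hli := (Nat.lt_succ_iff.1 hl).eq_or_lt
        · obtain ⟨-, rfl⟩ | ⟨hc', -⟩ := hX
          · refine hB.nle_iff (hP.posAffected_getD l) (fun σ hσ a => ?_) (fun p hp a => ?_) hp x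
            · exact Program.run_not_yet (V := stageVocab V) hQ hg0 hg hi'
                ((h.affects hi').2 (.inr ⟨hc, hσ⟩)) a
            · exact Program.run_not_yet (V := stageVocab V) hQ hg0 hg hi'
                ((h.affects hi').2 (.inl ⟨p, hp, rfl⟩)) a
          · exact absurd hc hc'
        · exact hpres _ (fun σ hσ a => Stratum.path_unaffected (hg i hi').1 hσ a) l hli hc p hp x
  rw [h.length_eq]
  exact (key _ le_rfl).1

end

end Elimination

/-! ### Size estimates. -/

section Sizes

variable {V : Vocabulary.{u, v}}

/-! ### Sizes of formulas after syntactic operations -/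

theorem Formula.countOcc_le_size (A : List V.Pred) {n : ℕ} (φ : Formula V n) :
    φ.countOcc A ≤ φ.size := by
  induction φ with
  | atom p ts =>
    simp only [Formula.countOcc, Formula.size]
    split_ifs <;> omega
  | _ => simp only [Formula.countOcc, Formula.size]; omega

/-- `K` is the extra cost of replacing one occurrence of a predicate in `A`. -/
theorem Formula.size_replace_le {k K : ℕ} {A : List V.Pred}
    {f : {m : ℕ} → (p : V.Pred) → (Fin (V.arity p) → Term (stageVocab V) m) →
      (Fin k → Term (stageVocab V) m) → Formula (stageVocab V) m}
    (hf : ∀ (m : ℕ) p (t : Fin (V.arity p) → Term (stageVocab V) m) y,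
      (p ∈ A → (f p t y).size (V := stageVocab V) ≤ 1 + V.arity p + K) ∧
      (p ∉ A → (f p t y).size (V := stageVocab V) ≤ 1 + V.arity p))
    {n m : ℕ} (φ : Formula V n) (ρ : Fin n → Term (stageVocab V) m)
    (y : Fin k → Term (stageVocab V) m) :
    (φ.replace f ρ y).size (V := stageVocab V) ≤ φ.size + K * φ.countOcc A := by
  induction φ generalizing m with
  | falsum => simp [Formula.replace, Formula.size]
  | verum => simp [Formula.replace, Formula.size]
  | eq t t' => simp [Formula.replace, Formula.size]
  | atom p ts =>
    simp only [Formula.replace, Formula.size, Formula.countOcc]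
    split_ifs with hp
    · simpa using (hf m p _ y).1 hp
    · simpa using (hf m p _ y).2 hp
  | neg φ ih =>
    have := ih ρ y
    simp only [Formula.replace, Formula.size, Formula.countOcc]
    omega
  | and φ ψ ih ih' =>
    have := ih ρ y
    have := ih' ρ y
    simp only [Formula.replace, Formula.size, Formula.countOcc, mul_add]
    omega
  | or φ ψ ih ih' =>
    have := ih ρ y
    have := ih' ρ y
    simp only [Formula.replace, Formula.size, Formula.countOcc, mul_add]
    omega
  | all φ ih =>
    simp only [Formula.replace, Formula.size, Formula.countOcc, add_assoc]
    exact Nat.add_le_add_left (ih _ _) 2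
  | ex φ ih =>
    simp only [Formula.replace, Formula.size, Formula.countOcc, add_assoc]
    exact Nat.add_le_add_left (ih _ _) 2

theorem Formula.size_embed_le {n : ℕ} (φ : Formula V n) :
    φ.embed.size (V := stageVocab V) ≤ φ.size := by
  refine (Formula.size_replace_le (K := 0) (A := []) (fun m p t y => ⟨fun _ => ?_, fun _ => ?_⟩)
    φ _ _).trans (by simp)
  all_goals exact le_rfl

theorem Formula.size_exN {n : ℕ} (k : ℕ) (φ : Formula V (n + k)) :
    (Formula.exN k φ).size = 2 * k + φ.size := by
  induction k with
  | zero => simp [Formula.exN]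
  | succ k ih =>
    refine (ih (.ex φ)).trans ?_
    simp only [Formula.size]
    ring

theorem Formula.size_allN {n : ℕ} (k : ℕ) (φ : Formula V (n + k)) :
    (Formula.allN k φ).size = 2 * k + φ.size := by
  induction k with
  | zero => simp [Formula.allN]
  | succ k ih =>
    refine (ih (.all φ)).trans ?_
    simp only [Formula.size]
    ring

theorem Formula.size_bigOr {n : ℕ} {α : Type u} (l : List α) (f : α → Formula V n) :
    (bigOr l f).size = 1 + (l.map fun k => 1 + (f k).size).sum := by
  induction l with
  | nil => rfl
  | cons k l ih =>
    have : (bigOr (k :: l) f).size = 1 + (f k).size + (bigOr l f).size := rfl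
    rw [this, ih, List.map_cons, List.sum_cons]
    ring

theorem Formula.size_bigAnd {n : ℕ} {α : Type u} (l : List α) (f : α → Formula V n) :
    (bigAnd l f).size = 1 + (l.map fun k => 1 + (f k).size).sum := by
  induction l with
  | nil => rfl
  | cons k l ih =>
    have : (bigAnd (k :: l) f).size = 1 + (f k).size + (bigAnd l f).size := rfl
    rw [this, ih, List.map_cons, List.sum_cons]
    ring

/-- The size, where an atom of an original predicate is counted twice. -/
def Formula.weight : {n : ℕ} → Formula (stageVocab V) n → ℕ
  | _, .falsum => 1
  | _, .verum => 1
  | _, .atom (StagePred.orig p) _ => 2 + 2 * V.arity p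
  | _, .atom p _ => 1 + StagePred.arity p
  | _, .eq _ _ => 3
  | _, .neg φ => 1 + φ.weight
  | _, .and φ ψ => 1 + φ.weight + ψ.weight
  | _, .or φ ψ => 1 + φ.weight + ψ.weight
  | _, .all φ => 2 + φ.weight
  | _, .ex φ => 2 + φ.weight

theorem Formula.size_le_weight {n : ℕ} (φ : Formula (stageVocab V) n) :
    φ.size (V := stageVocab V) ≤ φ.weight := by
  induction φ with
  | atom p ts =>
    cases p with
    | orig p =>
      show 1 + V.arity p ≤ 2 + 2 * V.arity p
      omega
    | _ => exact le_rfl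
  | _ => simp only [Formula.weight, Formula.size]; omega

theorem Formula.weight_le {n : ℕ} (φ : Formula (stageVocab V) n) :
    φ.weight ≤ 2 * φ.size (V := stageVocab V) := by
  induction φ with
  | atom p ts =>
    cases p with
    | orig p =>
      show 2 + 2 * V.arity p ≤ 2 * (1 + V.arity p)
      omega
    | _ => exact Nat.le_mul_of_pos_left _ (by norm_num)
  | _ => simp only [Formula.weight, Formula.size]; omega

/-- An original atom of arity `r` weighs `2 + 2r`, exactly the size of its replacement, which
contains no original atom and is never replaced again. -/
theorem Formula.weight_replaceNeg_le (A : List V.Pred) {n : ℕ} (φ : Formula (stageVocab V) n)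
    (b : Bool) : (φ.replaceNeg A b).weight ≤ φ.weight := by
  induction φ generalizing b with
  | falsum => exact le_rfl
  | verum => exact le_rfl
  | eq t t' => exact le_rfl
  | atom p ts =>
    cases p with
    | orig p =>
      simp only [Formula.replaceNeg]
      split_ifs
      · show 1 + (1 + (V.arity p + V.arity p)) ≤ 2 + 2 * V.arity p
        omega
      · exact le_rfl
    | _ => exact le_rfl
  | neg φ ih => exact Nat.add_le_add_left (ih _) 1
  | and φ ψ ih ih' => exact Nat.add_le_add (Nat.add_le_add_left (ih _) 1) (ih' _)
  | or φ ψ ih ih' => exact Nat.add_le_add (Nat.add_le_add_left (ih _) 1) (ih' _)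
  | all φ ih => exact Nat.add_le_add_left (ih _) 2
  | ex φ ih => exact Nat.add_le_add_left (ih _) 2

theorem Program.size_replaceFor_le (P : Program V) (L : List ℕ) {n : ℕ}
    (φ : Formula (stageVocab V) n) :
    (P.replaceFor L φ).size (V := stageVocab V) ≤ 2 * φ.size (V := stageVocab V) := by
  have h : (P.replaceFor L φ).weight ≤ φ.weight := by
    induction L with
    | nil => exact le_rfl
    | cons l L ih => exact (Formula.weight_replaceNeg_le _ _ _).trans ih
  exact (Formula.size_le_weight _).trans (h.trans (Formula.weight_le φ))

/-! ### Sums over lists -/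

theorem sum_map_ite_le {α : Type*} [DecidableEq α] {l : List α} (hl : l.Nodup) (a : α) (x : ℕ) :
    (l.map fun i => if a = i then x else 0).sum ≤ x := by
  induction l with
  | nil => simp
  | cons b l ih =>
    obtain ⟨hb, hl⟩ := List.nodup_cons.1 hl
    rw [List.map_cons, List.sum_cons]
    split_ifs with hab
    · subst hab
      have : (l.map fun i => if a = i then x else 0) = l.map fun _ => 0 :=
        List.map_congr_left fun i hi => if_neg fun h : a = i => hb (h ▸ hi)
      simp [this]
    · simpa using ih hl

theorem sum_map_affine {α : Type*} (l : List α) (K x y : ℕ) (f g : α → ℕ) :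
    (l.map fun i => K + x * f i + y * g i).sum =
      l.length * K + x * (l.map f).sum + y * (l.map g).sum := by
  induction l with
  | nil => simp
  | cons b l ih =>
    simp only [List.map_cons, List.sum_cons, List.length_cons, ih]
    ring

theorem sum_map_le {α : Type*} {l : List α} {f g : α → ℕ} (h : ∀ i ∈ l, f i ≤ g i) :
    (l.map f).sum ≤ (l.map g).sum :=
  List.sum_le_sum h

/-! ### Parameters of a stratum -/

section Parameters

variable (S : Stratum V)

theorem Stratum.nodup_affected : S.affected.Nodup := by
  classical
  exact List.nodup_dedup _

theorem Stratum.size_cons (ax : Ax V) (S : Stratum V) :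
    Stratum.size (ax :: S) = ax.size + S.size := by
  simp [Stratum.size]

theorem Stratum.length_le_size : S.length ≤ S.size := by
  induction S with
  | nil => simp
  | cons ax S ih =>
    rw [Stratum.size_cons, List.length_cons, Ax.size]
    omega

theorem Stratum.numAffected_le_length : S.numAffected ≤ S.length := by
  classical
  exact ((List.dedup_sublist (S.map Ax.head)).length_le).trans (List.length_map _).le

theorem Stratum.numAffected_le_size : S.numAffected ≤ S.size :=
  S.numAffected_le_length.trans S.length_le_size

theorem Stratum.sumArity_le_size : S.sumArity ≤ S.size := by
  classical
  have h : S.sumArity ≤ ((S.map Ax.head).map fun p => max 1 (V.arity p)).sum :=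
    ((List.dedup_sublist (S.map Ax.head)).map _).sum_le_sum fun _ _ => Nat.zero_le _
  refine h.trans ?_
  rw [List.map_map]
  refine List.sum_le_sum fun ax _ => ?_
  simp only [Function.comp, Ax.size]
  omega

theorem Stratum.numAffected_le_sumArity : S.numAffected ≤ S.sumArity := by
  unfold Stratum.numAffected Stratum.sumArity
  induction S.affected with
  | nil => simp
  | cons p l ih =>
    simp only [List.length_cons, List.map_cons, List.sum_cons]
    omega

theorem Stratum.sum_arity_le : (S.affected.map V.arity).sum ≤ S.sumArity :=
  sum_map_le fun _ _ => le_max_right _ _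

theorem Stratum.arity_le_maxArity {p : V.Pred} (hp : p ∈ S.affected) :
    V.arity p ≤ S.maxArity := by
  unfold Stratum.maxArity
  generalize S.affected = l at hp
  induction l with
  | nil => simp at hp
  | cons q l ih =>
    rw [List.map_cons, List.foldr_cons]
    obtain rfl | hp := List.mem_cons.1 hp
    · exact le_max_left _ _
    · exact (ih hp).trans (le_max_right _ _)

theorem Stratum.maxArity_le_sumArity : S.maxArity ≤ S.sumArity := by
  unfold Stratum.maxArity Stratum.sumArity
  induction S.affected with
  | nil => simp
  | cons p l ih =>
    simp only [List.map_cons, List.foldr_cons, List.sum_cons]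
    omega

theorem Stratum.numOcc_le_size : S.numOcc ≤ S.size := by
  refine List.sum_le_sum fun ax _ => (Formula.countOcc_le_size _ _).trans ?_
  rw [Ax.size]
  omega

/-- Each axiom contributes to one disjunction only. The extra `∨` per axiom and `⊥` per predicate
are paid for by the head and the arrow of the axioms. -/
theorem Stratum.sum_size_bodyOf_le : (S.affected.map fun i => (S.bodyOf i).size).sum ≤ S.size := by
  classical
  have key : ∀ (A : List V.Pred) (_ : A.Nodup) (T : Stratum V),
      (A.map fun i => (T.bodyOf i).size).sum ≤
        A.length + (T.map fun ax => 1 + ax.body.size).sum := by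
    intro A hA T
    induction T with
    | nil =>
      have : (fun i => (Stratum.bodyOf ([] : Stratum V) i).size) = fun _ => 1 := rfl
      simp [this]
    | cons ax T ih =>
      have : (fun i => (Stratum.bodyOf (ax :: T) i).size) = fun i =>
          (if ax.head = i then 1 + ax.body.size else 0) + (Stratum.bodyOf T i).size := by
        funext i
        by_cases h : ax.head = i
        · subst h
          simp [Stratum.bodyOf, Formula.size]
        · simp [Stratum.bodyOf, h]
      rw [this, List.sum_map_add, List.map_cons, List.sum_cons]
      have := sum_map_ite_le hA ax.head (1 + ax.body.size)
      omega
  refine (key _ S.nodup_affected S).trans ?_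
  refine (Nat.add_le_add_right S.numAffected_le_length _).trans ?_
  unfold Stratum.size
  clear key
  induction S with
  | nil => simp
  | cons ax S ih =>
    simp only [List.length_cons, List.map_cons, List.sum_cons, Ax.size] at ih ⊢
    omega

theorem Stratum.sum_countOcc_bodyOf_le :
    (S.affected.map fun i => (S.bodyOf i).countOcc S.affected).sum ≤ S.numOcc := by
  classical
  have key : ∀ (A : List V.Pred) (_ : A.Nodup) (T : Stratum V),
      (A.map fun i => (T.bodyOf i).countOcc A).sum ≤
        (T.map fun ax => ax.body.countOcc A).sum := by
    intro A hA T
    induction T with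
    | nil =>
      have : (fun i => (Stratum.bodyOf ([] : Stratum V) i).countOcc A) = fun _ => 0 := rfl
      simp [this]
    | cons ax T ih =>
      have : (fun i => (Stratum.bodyOf (ax :: T) i).countOcc A) = fun i =>
          (if ax.head = i then ax.body.countOcc A else 0) + (Stratum.bodyOf T i).countOcc A := by
        funext i
        by_cases h : ax.head = i
        · subst h
          simp [Stratum.bodyOf, Formula.countOcc]
        · simp [Stratum.bodyOf, h]
      rw [this, List.sum_map_add, List.map_cons, List.sum_cons]
      have := sum_map_ite_le hA ax.head (ax.body.countOcc A)
      omega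
  exact key _ S.nodup_affected S

/-- An upper bound for the sizes of the transformed disjunctions `φ_i`. -/
noncomputable def Stratum.bodyBound (i : V.Pred) : ℕ :=
  -- A replaced atom gains the arguments of the second tuple and possibly one negation.
  (S.bodyOf i).size + (S.maxArity + 1) * (S.bodyOf i).countOcc S.affected

theorem Stratum.sum_bodyBound_le :
    (S.affected.map S.bodyBound).sum ≤ 2 * (S.size + S.maxArity * S.numOcc) := by
  have h : S.affected.map S.bodyBound = S.affected.map fun i =>
      0 + 1 * (S.bodyOf i).size + (S.maxArity + 1) * (S.bodyOf i).countOcc S.affected :=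
    List.map_congr_left fun i _ => by simp [Stratum.bodyBound]
  rw [h, sum_map_affine]
  have h1 := S.sum_size_bodyOf_le
  have h2 := Nat.mul_le_mul_left (S.maxArity + 1) S.sum_countOcc_bodyOf_le
  have h3 := S.numOcc_le_size
  nlinarith

variable {S} {i j : V.Pred} {m : ℕ} (x : Fin (V.arity i) → Term (stageVocab V) m)
  (y : Fin (V.arity j) → Term (stageVocab V) m)

theorem size_withLt_le (hj : j ∈ S.affected) :
    ((S.bodyOf i).withLt S.affected j x y).size (V := stageVocab V) ≤ S.bodyBound i := by
  refine Formula.size_replace_le (fun m p t y => ⟨fun hp => ?_, fun hp => ?_⟩) _ _ _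
  · rw [if_pos hp]
    show 1 + (V.arity p + V.arity j) ≤ _
    have := S.arity_le_maxArity hj
    omega
  · rw [if_neg hp]
    exact le_rfl

theorem size_withLe_le (hj : j ∈ S.affected) :
    ((S.bodyOf i).withLe S.affected j x y).size (V := stageVocab V) ≤ S.bodyBound i := by
  refine Formula.size_replace_le (fun m p t y => ⟨fun hp => ?_, fun hp => ?_⟩) _ _ _
  · rw [if_pos hp]
    show 1 + (V.arity p + V.arity j) ≤ _
    have := S.arity_le_maxArity hj
    omega
  · rw [if_neg hp]
    exact le_rfl

theorem size_withNotNlt_le (hj : j ∈ S.affected) :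
    ((S.bodyOf i).withNotNlt S.affected j x y).size (V := stageVocab V) ≤ S.bodyBound i := by
  refine Formula.size_replace_le (fun m p t y => ⟨fun hp => ?_, fun hp => ?_⟩) _ _ _
  · rw [if_pos hp]
    show 1 + (1 + (V.arity p + V.arity j)) ≤ _
    have := S.arity_le_maxArity hj
    omega
  · rw [if_neg hp]
    exact le_rfl

theorem size_withNotNle_le (hj : j ∈ S.affected) :
    ((S.bodyOf i).withNotNle S.affected j x y).size (V := stageVocab V) ≤ S.bodyBound i := by
  refine Formula.size_replace_le (fun m p t y => ⟨fun hp => ?_, fun hp => ?_⟩) _ _ _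
  · rw [if_pos hp]
    show 1 + (1 + (V.arity p + V.arity j)) ≤ _
    have := S.arity_le_maxArity hj
    omega
  · rw [if_neg hp]
    exact le_rfl

theorem size_withBot_le :
    ((S.bodyOf i).withBot S.affected x).size (V := stageVocab V) ≤ S.bodyBound i := by
  refine Formula.size_replace_le (fun m p t y => ⟨fun hp => ?_, fun hp => ?_⟩) _ _ _
  · rw [if_pos hp]
    show 1 ≤ _
    omega
  · rw [if_neg hp]
    exact le_rfl

end Parameters

/-! ### Sizes of the stage axioms -/

section StageSizes

variable {S : Stratum V} {l : ℕ} {i j : V.Pred}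

/-- An upper bound for the size of the axiom for `≺_{ij}`. -/
noncomputable def Stratum.pairBound (S : Stratum V) (i j : V.Pred) : ℕ :=
  -- With `1 ≤ m ≤ R`, the constants are at most `3R`, the disjuncts contribute `4m ≤ 4R` and the
  -- arities of the middle atoms at most `4R`; the factor `2m` covers the `m` disjuncts and the
  -- head.
  11 * S.sumArity + 2 * S.numAffected * (V.arity i + V.arity j)

theorem Stratum.one_le_numAffected (hi : i ∈ S.affected) : 1 ≤ S.numAffected :=
  List.length_pos_of_mem hi

/-- The left side is the exact size of the axiom for `≺`, and the estimates for other pair axioms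
use it again to absorb their heads. -/
theorem sum_chain_le (S : Stratum V) (hi : i ∈ S.affected) :
    2 + (V.arity i + V.arity j) + (1 + (S.affected.map fun k => 1 + (2 * V.arity k +
      (1 + (1 + (V.arity i + V.arity k)) + (1 + (V.arity k + V.arity j))))).sum) ≤
      S.pairBound i j := by
  have h : (S.affected.map fun k => 1 + (2 * V.arity k +
      (1 + (1 + (V.arity i + V.arity k)) + (1 + (V.arity k + V.arity j))))) =
      S.affected.map fun k => (4 + (V.arity i + V.arity j)) + 4 * V.arity k + 0 * 0 :=
    List.map_congr_left fun k _ => by ring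
  rw [h, sum_map_affine S.affected _ 4 0 V.arity fun _ => 0]
  have h1 := S.sum_arity_le
  have h2 := S.numAffected_le_sumArity
  have h3 := Stratum.one_le_numAffected hi
  have h4 : S.affected.length = S.numAffected := rfl
  rw [h4, Stratum.pairBound]
  nlinarith [Nat.mul_le_mul_right (V.arity i + V.arity j) h3]

theorem size_ltAxiom_le (hi : i ∈ S.affected) :
    (ltAxiom S i j).size ≤ S.pairBound i j := by
  refine le_trans (le_of_eq ?_) (sum_chain_le S hi)
  have h : (ltAxiom S i j).body.size (V := stageVocab V) = 1 + (S.affected.map fun k =>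
      1 + (2 * V.arity k + (1 + (1 + (V.arity i + V.arity k)) +
        (1 + (V.arity k + V.arity j))))).sum := by
    refine (Formula.size_bigOr (V := stageVocab V) _ _).trans ?_
    refine congrArg (1 + List.sum ·) (List.map_congr_left fun k _ => ?_)
    exact congrArg (1 + ·) (Formula.size_exN (V := stageVocab V) _ _)
  rw [Ax.size, h]
  show 1 + (V.arity i + V.arity j) + 1 + _ = _
  ring

theorem size_leAxiom_le (hi : i ∈ S.affected) (hj : j ∈ S.affected) :
    (leAxiom S i j).size ≤ S.pairBound i j + S.bodyBound i := by
  have h := sum_chain_le (j := j) S hi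
  have hb : (leAxiom S i j).body.size (V := stageVocab V) ≤ S.bodyBound i := size_withLt_le _ _ hj
  have hs : (leAxiom S i j).size = 1 + (V.arity i + V.arity j) + 1 +
    (leAxiom S i j).body.size (V := stageVocab V) := rfl
  omega

theorem size_nltAxiom_le (hi : i ∈ S.affected) :
    (nltAxiom l S i j).size ≤ S.pairBound i j + 3 * S.sumArity + S.bodyBound j := by
  have h := sum_chain_le (j := j) S hi
  have hbot := size_withBot_le (S := S) (i := j) (m := V.arity i + V.arity j)
    (fun a => .var (Fin.natAdd _ a))
  have hb : (nltAxiom l S i j).size = 1 + (V.arity i + V.arity j) + 1 +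
      (1 + ((S.bodyOf j).withBot S.affected (fun a => .var (Fin.natAdd (V.arity i) a))).size
        (V := stageVocab V) + (1 + (1 + (S.affected.map fun k =>
      1 + (2 * V.arity k + (1 + (1 + (V.arity i + V.arity k)) +
        (1 + (V.arity k + V.arity j))))).sum) + 1)) := by
    refine congrArg (1 + (V.arity i + V.arity j) + 1 + ·) ?_
    refine congrArg (fun z => 1 + _ + (1 + z + 1)) ?_
    refine (Formula.size_bigOr (V := stageVocab V) _ _).trans ?_
    refine congrArg (1 + List.sum ·) (List.map_congr_left fun k _ => ?_)
    exact congrArg (1 + ·) (Formula.size_exN (V := stageVocab V) _ _)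
  have h3 := Stratum.one_le_numAffected hi
  have h4 := S.numAffected_le_sumArity
  omega

theorem size_nleAxiom_le (hi : i ∈ S.affected) (hj : j ∈ S.affected) :
    (nleAxiom S i j).size ≤ S.pairBound i j + S.bodyBound i := by
  have h := sum_chain_le (j := j) S hi
  have hb := size_withNotNlt_le (S := S) (i := i) (j := j) (m := V.arity i + V.arity j)
    (fun a => .var (Fin.castAdd _ a)) (fun a => .var (Fin.natAdd _ a)) hj
  have hs : (nleAxiom S i j).size = 1 + (V.arity i + V.arity j) + 1 +
    (1 + ((S.bodyOf i).withNotNlt S.affected j (fun a => .var (Fin.castAdd (V.arity j) a))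
      (fun a => .var (Fin.natAdd (V.arity i) a))).size (V := stageVocab V)) := rfl
  omega

theorem size_triAxiom_le (hi : i ∈ S.affected) :
    (triAxiom S i j).size ≤ S.pairBound i j + S.bodyBound i + 2 * S.bodyBound j := by
  have h1 := size_withLt_le (S := S) (i := i) (j := i) (m := V.arity i + V.arity j)
    (fun a => .var (Fin.castAdd _ a)) (fun a => .var (Fin.castAdd _ a)) hi
  have h2 := size_withNotNlt_le (S := S) (i := j) (j := i) (m := V.arity i + V.arity j)
    (fun a => .var (Fin.natAdd _ a)) (fun a => .var (Fin.castAdd _ a)) hi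
  have h3 := size_withLe_le (S := S) (i := j) (j := i) (m := V.arity i + V.arity j)
    (fun a => .var (Fin.natAdd _ a)) (fun a => .var (Fin.castAdd _ a)) hi
  have hs : (triAxiom S i j).size = 1 + (V.arity i + V.arity j) + 1 +
    (1 + ((S.bodyOf i).withLt S.affected i (fun a => .var (Fin.castAdd (V.arity j) a))
      (fun a => .var (Fin.castAdd (V.arity j) a))).size (V := stageVocab V) +
    (1 + (1 + ((S.bodyOf j).withNotNlt S.affected i (fun a => .var (Fin.natAdd (V.arity i) a))
      (fun a => .var (Fin.castAdd (V.arity j) a))).size (V := stageVocab V)) +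
    (1 + ((S.bodyOf j).withLe S.affected i (fun a => .var (Fin.natAdd (V.arity i) a))
      (fun a => .var (Fin.castAdd (V.arity j) a))).size (V := stageVocab V) +
    (1 + V.arity i)))) := rfl
  have h4 := Stratum.one_le_numAffected hi
  have h5 := S.numAffected_le_sumArity
  have h6 := Nat.mul_le_mul_right (V.arity i + V.arity j) h4
  rw [hs, Stratum.pairBound, mul_assoc]
  omega

theorem size_noneAxiom_le (l : ℕ) (S : Stratum V) :
    (noneAxiom l S).size ≤ 3 + 2 * S.numAffected + 2 * S.sumArity +
      (S.affected.map S.bodyBound).sum := by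
  have hb : (noneAxiom l S).size = 1 + 0 + 1 + (1 + (S.affected.map fun k =>
      1 + (2 * V.arity k + (1 + ((S.bodyOf k).withBot S.affected
        (fun a => .var (Fin.natAdd 0 a))).size (V := stageVocab V)))).sum) := by
    refine congrArg (1 + 0 + 1 + ·) ((Formula.size_bigAnd (V := stageVocab V) _ _).trans ?_)
    refine congrArg (1 + List.sum ·) (List.map_congr_left fun k _ => ?_)
    exact congrArg (1 + ·) (Formula.size_allN (V := stageVocab V) _ _)
  have hle : (S.affected.map fun k =>
      1 + (2 * V.arity k + (1 + ((S.bodyOf k).withBot S.affected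
        (fun a => .var (Fin.natAdd 0 a))).size (V := stageVocab V)))).sum ≤
      (S.affected.map fun k => 2 + 2 * V.arity k + 1 * S.bodyBound k).sum := by
    refine sum_map_le fun k _ => ?_
    have := size_withBot_le (S := S) (i := k) (m := 0 + V.arity k) (fun a => .var (Fin.natAdd _ a))
    omega
  rw [sum_map_affine] at hle
  have h1 := S.sum_arity_le
  have h4 : S.affected.length = S.numAffected := rfl
  omega

theorem size_fixAxiom_le (hi : i ∈ S.affected) :
    (fixAxiom S i).size ≤ 9 * S.sumArity + 2 * (S.affected.map S.bodyBound).sum := by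
  have hb : (fixAxiom S i).size = 1 + V.arity i + 1 + (1 + (S.affected.map fun k =>
      1 + (2 * V.arity k + (1 + (1 + ((S.bodyOf k).withNotNle S.affected i
        (fun a => .var (Fin.natAdd (V.arity i) a))
        (fun a => .var (Fin.castAdd (V.arity k) a))).size (V := stageVocab V)) +
        ((S.bodyOf k).withLt S.affected i (fun a => .var (Fin.natAdd (V.arity i) a))
        (fun a => .var (Fin.castAdd (V.arity k) a))).size (V := stageVocab V)))).sum) := by
    refine congrArg (1 + V.arity i + 1 + ·)
      ((Formula.size_bigAnd (V := stageVocab V) _ _).trans ?_)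
    refine congrArg (1 + List.sum ·) (List.map_congr_left fun k _ => ?_)
    exact congrArg (1 + ·) (Formula.size_allN (V := stageVocab V) _ _)
  have hle : (S.affected.map fun k =>
      1 + (2 * V.arity k + (1 + (1 + ((S.bodyOf k).withNotNle S.affected i
        (fun a => .var (Fin.natAdd (V.arity i) a))
        (fun a => .var (Fin.castAdd (V.arity k) a))).size (V := stageVocab V)) +
        ((S.bodyOf k).withLt S.affected i (fun a => .var (Fin.natAdd (V.arity i) a))
        (fun a => .var (Fin.castAdd (V.arity k) a))).size (V := stageVocab V)))).sum ≤
      (S.affected.map fun k => 3 + 2 * V.arity k + 2 * S.bodyBound k).sum := by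
    refine sum_map_le fun k _ => ?_
    have h1 := size_withNotNle_le (S := S) (i := k) (j := i) (m := V.arity i + V.arity k)
      (fun a => .var (Fin.natAdd _ a)) (fun a => .var (Fin.castAdd _ a)) hi
    have h2 := size_withLt_le (S := S) (i := k) (j := i) (m := V.arity i + V.arity k)
      (fun a => .var (Fin.natAdd _ a)) (fun a => .var (Fin.castAdd _ a)) hi
    omega
  rw [sum_map_affine] at hle
  have h1 := S.sum_arity_le
  have h2 := S.numAffected_le_sumArity
  have h3 := Stratum.one_le_numAffected hi
  have h4 : S.affected.length = S.numAffected := rfl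
  have h5 := (S.arity_le_maxArity hi).trans S.maxArity_le_sumArity
  omega

theorem Stratum.size_append (S T : Stratum V) : Stratum.size (S ++ T) = S.size + T.size := by
  simp [Stratum.size]

theorem Stratum.size_flatMap {α : Type*} (A : List α) (f : α → Stratum V) :
    Stratum.size (A.flatMap f) = (A.map fun i => (f i).size).sum := by
  induction A with
  | nil => rfl
  | cons a A ih => rw [List.flatMap_cons, Stratum.size_append, ih, List.map_cons, List.sum_cons]

/-- Each body bound depends on a single index, so summing over pairs costs only one factor `m` on
their sum `W`; the remaining parts sum to a multiple of `m ^ 2 * R`. -/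
theorem size_stageAxioms_le (hS : S.affected ≠ []) :
    Stratum.size (V := stageVocab V) (stageAxioms l S) ≤
      100 * (S.numAffected * (S.size + S.maxArity * S.numOcc) +
        S.numAffected ^ 2 * S.sumArity) := by
  set A := S.affected with hA
  set m := S.numAffected with hm
  set R := S.sumArity with hR
  set W := (A.map S.bodyBound).sum with hW
  have hmA : A.length = m := rfl
  have hWle : W ≤ 2 * (S.size + S.maxArity * S.numOcc) := S.sum_bodyBound_le
  have hm1 : 1 ≤ m := List.length_pos_of_ne_nil hS
  have hmR : m ≤ R := S.numAffected_le_sumArity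
  have haR : (A.map V.arity).sum ≤ R := S.sum_arity_le
  have hin : ∀ i ∈ A, Stratum.size (V := stageVocab V) (A.flatMap fun j =>
      [ltAxiom S i j, leAxiom S i j, nltAxiom l S i j, nleAxiom S i j, triAxiom S i j]) ≤
      -- The coefficient `68` is `58` from the constant parts below plus `10` from the sum of the
      -- arities of `j`.
      (68 * (m * R) + 3 * W) + 10 * m ^ 2 * V.arity i + 3 * m * S.bodyBound i := by
    intro i hi
    rw [Stratum.size_flatMap (V := stageVocab V)]
    have hle : (A.map fun j => Stratum.size (V := stageVocab V)
        [ltAxiom S i j, leAxiom S i j, nltAxiom l S i j, nleAxiom S i j, triAxiom S i j]).sum ≤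
        -- Five pair bounds give `5 * 11` and `5 * 2`, and `⊀` adds `3`. The bound for `i` is used
        -- once each by `≼`, `⋠` and `◁`, that for `j` once by `⊀` and twice by `◁`.
        (A.map fun j => (58 * R + 10 * m * V.arity i + 3 * S.bodyBound i) +
          10 * m * V.arity j + 3 * S.bodyBound j).sum := by
      refine sum_map_le fun j hj => ?_
      have h1 := size_ltAxiom_le (j := j) hi
      have h2 := size_leAxiom_le hi hj
      have h3 := size_nltAxiom_le (l := l) (j := j) hi
      have h4 := size_nleAxiom_le hi hj
      have h5 := size_triAxiom_le (j := j) hi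
      have h6 : S.pairBound i j = 11 * R + 2 * m * (V.arity i + V.arity j) := rfl
      simp only [Stratum.size, List.map_cons, List.map_nil, List.sum_cons, List.sum_nil]
      rw [h6] at h1 h2 h3 h4 h5
      nlinarith
    rw [sum_map_affine, hmA, ← hW] at hle
    have := Nat.mul_le_mul_left (10 * m) haR
    nlinarith
  have hout : Stratum.size (V := stageVocab V) (stageAxioms l S) =
      (noneAxiom l S).size + (A.map fun i => (fixAxiom S i).size +
        Stratum.size (V := stageVocab V) (A.flatMap fun j =>
      [ltAxiom S i j, leAxiom S i j, nltAxiom l S i j, nleAxiom S i j, triAxiom S i j])).sum := by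
    unfold stageAxioms
    rw [Stratum.size_cons (V := stageVocab V), Stratum.size_flatMap (V := stageVocab V)]
    refine congrArg (_ + List.sum ·) (List.map_congr_left fun i _ => ?_)
    exact Stratum.size_cons (V := stageVocab V) _ _
  have hsum : (A.map fun i => (fixAxiom S i).size +
        Stratum.size (V := stageVocab V) (A.flatMap fun j =>
      [ltAxiom S i j, leAxiom S i j, nltAxiom l S i j, nleAxiom S i j, triAxiom S i j])).sum ≤
      (A.map fun i => (68 * (m * R) + 5 * W + 9 * R) + 10 * m ^ 2 * V.arity i +
        3 * m * S.bodyBound i).sum := by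
    refine sum_map_le fun i hi => ?_
    have h1 := hin i hi
    have h2 := size_fixAxiom_le hi
    rw [← hA, ← hW, ← hR] at h2
    omega
  rw [sum_map_affine, hmA, ← hW] at hsum
  have hnone := size_noneAxiom_le l S
  rw [← hA, ← hm, ← hR, ← hW] at hnone
  rw [hout]
  have h1 : 10 * m ^ 2 * (A.map V.arity).sum ≤ 10 * m ^ 2 * R := Nat.mul_le_mul_left _ haR
  have h2 : m * R ≤ m ^ 2 * R := Nat.mul_le_mul_right R (by nlinarith)
  have h3 : R ≤ m * R := Nat.le_mul_of_pos_left R hm1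
  have h4 : W ≤ m * W := Nat.le_mul_of_pos_left W hm1
  have h5 : m * W ≤ m * (2 * (S.size + S.maxArity * S.numOcc)) := Nat.mul_le_mul_left m hWle
  have h6 : m * (68 * (m * R) + 5 * W + 9 * R) = 68 * (m ^ 2 * R) + 5 * (m * W) + 9 * (m * R) := by
    ring
  have h7 : 3 * m * W = 3 * (m * W) := by ring
  have h8 : 10 * m ^ 2 * R = 10 * (m ^ 2 * R) := by ring
  have h9 : m * (2 * (S.size + S.maxArity * S.numOcc)) =
    2 * (m * (S.size + S.maxArity * S.numOcc)) := by ring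
  omega

end StageSizes

/-! ### Sizes of the transformed program -/

section Transformed

theorem Stratum.size_map_replaceFor_le (P : Program V) (L : List ℕ)
    (T : Stratum (stageVocab V)) :
    Stratum.size (V := stageVocab V) (T.map (Ax.mapBody (V := stageVocab V) (P.replaceFor L))) ≤
      2 * Stratum.size (V := stageVocab V) T := by
  induction T with
  | nil => simp [Stratum.size]
  | cons ax T ih =>
    rw [List.map_cons, Stratum.size_cons (V := stageVocab V), Stratum.size_cons (V := stageVocab V)]
    have h := P.size_replaceFor_le L ax.body
    have h1 : (Ax.mapBody (V := stageVocab V) (P.replaceFor L) ax).size =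
      1 + (stageVocab V).arity ax.head + 1 + (P.replaceFor L ax.body).size (V := stageVocab V) := rfl
    have h2 : ax.size = 1 + (stageVocab V).arity ax.head + 1 +
      ax.body.size (V := stageVocab V) := rfl
    omega

theorem Stratum.size_embed_le (S : Stratum V) :
    Stratum.size (V := stageVocab V) S.embed ≤ S.size := by
  unfold Stratum.size Stratum.embed
  rw [List.map_map]
  exact sum_map_le fun ax _ => Nat.add_le_add_left (Formula.size_embed_le ax.body) _

theorem Stratum.size_stagePart_add_origPart (T : Stratum (stageVocab V)) :
    T.stagePart.size + T.origPart.size = Stratum.size (V := stageVocab V) T := by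
  induction T with
  | nil => rfl
  | cons ax T ih =>
    unfold Stratum.stagePart Stratum.origPart at ih ⊢
    rw [Stratum.size_cons (V := stageVocab V), ← ih]
    cases h : StagePred.isOrig ax.head
    · rw [List.filter_cons_of_pos (by simp [h]), List.filter_cons_of_neg (by simp [h]),
        Stratum.size_cons (V := stageVocab V)]
      omega
    · rw [List.filter_cons_of_neg (by simp [h]), List.filter_cons_of_pos (by simp [h]),
        Stratum.size_cons (V := stageVocab V)]
      omega

/-- The embedded axioms and the stage axioms are separated by their heads; the later replacements at
most double each part. -/
theorem Program.EliminatedFrom.size_parts {P : Program V} {c : ℕ → Prop} {m : ℕ}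
    {Q : Program (stageVocab V)} (h : P.EliminatedFrom c m Q) {i : ℕ} (hi : i < Q.length) :
    Stratum.size (V := stageVocab V) (Stratum.stagePart Q[i]) ≤
      200 * ((P.getD i []).numAffected * ((P.getD i []).size +
        (P.getD i []).maxArity * (P.getD i []).numOcc) +
        (P.getD i []).numAffected ^ 2 * (P.getD i []).sumArity) ∧
      Stratum.size (V := stageVocab V) (Stratum.origPart Q[i]) ≤ 2 * (P.getD i []).size := by
  obtain ⟨L, X, -, hX, he⟩ := h.shape i hi
  have hXo : ∀ ax ∈ X, StagePred.isOrig ax.head = false := by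
    obtain ⟨-, rfl⟩ | ⟨-, rfl⟩ := hX
    · intro ax hax
      cases hh : (ax.head : StagePred V) with
      | orig p => exact absurd ⟨ax, hax, hh⟩ (stageAxioms_not_affects_orig p)
      | _ => rfl
    · simp
  have hEo : ∀ ax ∈ Stratum.embed (P.getD i []), StagePred.isOrig ax.head = true := by
    intro ax hax
    obtain ⟨ax, -, rfl⟩ := List.mem_map.1 hax
    rfl
  rw [he, List.map_append]
  have hs : Stratum.stagePart
      ((Stratum.embed (P.getD i [])).map (Ax.mapBody (V := stageVocab V) (P.replaceFor L)) ++
        X.map (Ax.mapBody (V := stageVocab V) (P.replaceFor L))) =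
      X.map (Ax.mapBody (V := stageVocab V) (P.replaceFor L)) := by
    unfold Stratum.stagePart
    rw [List.filter_append, List.filter_eq_nil_iff.2, List.nil_append, List.filter_eq_self.2]
    · intro ax hax
      obtain ⟨ax', hax', rfl⟩ := List.mem_map.1 hax
      simpa [Ax.mapBody] using hXo ax' hax'
    · intro ax hax
      obtain ⟨ax', hax', rfl⟩ := List.mem_map.1 hax
      simpa [Ax.mapBody] using hEo ax' hax'
  have ho : Stratum.origPart
      ((Stratum.embed (P.getD i [])).map (Ax.mapBody (V := stageVocab V) (P.replaceFor L)) ++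
        X.map (Ax.mapBody (V := stageVocab V) (P.replaceFor L))) =
      (Stratum.embed (P.getD i [])).map (Ax.mapBody (V := stageVocab V) (P.replaceFor L)) := by
    unfold Stratum.origPart
    rw [List.filter_append, List.filter_eq_self.2, List.filter_eq_nil_iff.2, List.append_nil]
    · intro ax hax
      obtain ⟨ax', hax', rfl⟩ := List.mem_map.1 hax
      simpa [Ax.mapBody] using hXo ax' hax'
    · intro ax hax
      obtain ⟨ax', hax', rfl⟩ := List.mem_map.1 hax
      simpa [Ax.mapBody] using hEo ax' hax'
  rw [hs, ho]
  refine ⟨(Stratum.size_map_replaceFor_le P L X).trans ?_,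
    (Stratum.size_map_replaceFor_le P L _).trans
      (Nat.mul_le_mul_left 2 (Stratum.size_embed_le _))⟩
  obtain ⟨hc, rfl⟩ | ⟨-, rfl⟩ := hX
  · have := size_stageAxioms_le (l := i) (h.affected_ne_nil i hc)
    omega
  · simp [Stratum.size]

theorem Program.size_le_mul_of_getElem {W : Vocabulary.{u, v}} {K : ℕ} (Q : Program W)
    (P : Program V) (hl : Q.length = P.length)
    (h : ∀ i (hi : i < Q.length) (hi' : i < P.length),
      Stratum.size Q[i] ≤ K * Stratum.size P[i]) : Q.size ≤ K * P.size := by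
  induction Q generalizing P with
  | nil => simp [Program.size]
  | cons T Q ih =>
    cases P with
    | nil => simp at hl
    | cons S P =>
      have h0 := h 0 (by simp) (by simp)
      have h1 := ih P (by simpa using hl) fun i hi hi' =>
        h (i + 1) (by simpa using hi) (by simpa using hi')
      simp only [Program.size, List.map_cons, List.sum_cons, mul_add] at h1 ⊢
      exact Nat.add_le_add h0 h1

/-- One factor `S.size` is kept while the other parameters are bounded by the program size `N`, so
that the sum over all strata costs no further factor. -/
theorem Stratum.parameters_le {S : Stratum V} {N : ℕ} (hN : S.size ≤ N) :
    200 * (S.numAffected * (S.size + S.maxArity * S.numOcc) +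
      S.numAffected ^ 2 * S.sumArity) + 2 * S.size ≤ (400 * N ^ 2 + 200 * N + 2) * S.size := by
  have hm := S.numAffected_le_size.trans hN
  have hR := S.sumArity_le_size
  have hr := (S.maxArity_le_sumArity.trans S.sumArity_le_size).trans hN
  have ho := S.numOcc_le_size
  have h1 : S.maxArity * S.numOcc ≤ N * S.size := Nat.mul_le_mul hr ho
  have h2 : S.numAffected * (S.size + S.maxArity * S.numOcc) ≤ N * (S.size + N * S.size) :=
    Nat.mul_le_mul hm (Nat.add_le_add_left h1 _)
  have h3 : S.numAffected ^ 2 * S.sumArity ≤ N ^ 2 * S.size :=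
    Nat.mul_le_mul (Nat.pow_le_pow_left hm 2) hR
  calc _ ≤ 200 * (N * (S.size + N * S.size) + N ^ 2 * S.size) + 2 * S.size := by omega
    _ = _ := by ring

theorem Program.size_stratum_le (P : Program V) {i : ℕ} (hi : i < P.length) :
    Stratum.size P[i] ≤ P.size :=
  List.single_le_sum (fun _ _ => Nat.zero_le _) _ (List.mem_map_of_mem (List.getElem_mem hi))

theorem Program.EliminatedFrom.size_le {P : Program V} {c : ℕ → Prop} {m : ℕ}
    {Q : Program (stageVocab V)} (h : P.EliminatedFrom c m Q) :
    Program.size (V := stageVocab V) Q ≤ (400 * P.size ^ 2 + 200 * P.size + 2) * P.size := by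
  refine Program.size_le_mul_of_getElem Q P h.length_eq fun i hi hi' => ?_
  obtain ⟨h1, h2⟩ := h.size_parts hi
  rw [List.getD_eq_getElem _ _ hi'] at h1 h2
  rw [← Stratum.size_stagePart_add_origPart]
  exact (Nat.add_le_add h1 h2).trans (Stratum.parameters_le (P.size_stratum_le hi'))

end Transformed

end Sizes

end AxiomProgram

/-! ### Assembly of the theorem. -/

theorem mainTheorem3 :
    (∀ (V : AxiomProgram.Vocabulary.{u, v}) (P : AxiomProgram.Program V), P.IsStratified →
      P.eliminate.length = P.length ∧
      P.eliminate.IsStratified ∧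
      (∀ p : V.Pred,
        P.eliminate.Derived (AxiomProgram.StagePred.orig p) ↔ P.Derived p) ∧
      P.eliminate.NoNegDerived ∧
      P.eliminate.merge.IsStratified ∧
      P.eliminate.merge.NoNegDerived ∧
      ∀ (O : Type w) [Finite O] (I : V.Const → O)
        (s : AxiomProgram.State (AxiomProgram.stageVocab V) O),
        ∃ (t : AxiomProgram.State V O)
          (t' : AxiomProgram.State (AxiomProgram.stageVocab V) O),
          (∀ e, P.Extends I s.restrict e ↔ e = t) ∧
          (∀ e, P.eliminate.Extends I s e ↔ e = t') ∧
          (∀ e, P.eliminate.merge.Extends I s e ↔ e = t') ∧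
          ∀ (p : V.Pred) (a : Fin (V.arity p) → O),
            t' (AxiomProgram.StagePred.orig p) a ↔ t p a) ∧
    ∃ (C : ℕ) (f : Polynomial ℕ),
      ∀ (V : AxiomProgram.Vocabulary.{u, v}) (P : AxiomProgram.Program V), P.IsStratified →
        P.eliminate.size ≤ f.eval P.size ∧
        ∀ (l : ℕ) (S : AxiomProgram.Stratum V) (S' : AxiomProgram.Stratum (AxiomProgram.stageVocab V)),
          P[l]? = some S → P.eliminate[l]? = some S' →
            S'.stagePart.size ≤
              C * (S.numAffected * (S.size + S.maxArity * S.numOcc)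
                + S.numAffected ^ 2 * S.sumArity) ∧
            S'.origPart.size ≤ C * S.size := by
  refine ⟨fun V P hP => ?_, 200,
    (400 * Polynomial.X ^ 2 + 200 * Polynomial.X + 2) * Polynomial.X, fun V P hP => ?_⟩
  · obtain ⟨c, h⟩ := hP.eliminatedFrom
    have hE := h.isStratified hP
    have hN := h.noNegDerived hP
    refine ⟨h.length_eq, hE, h.derived_orig, hN, hN.merge_isStratified, hN.merge,
      fun O _ I s => ?_⟩
    obtain ⟨t, ht⟩ := AxiomProgram.Program.runStrata_exists I P (P.initial s.restrict)
    obtain ⟨t', ht'⟩ := AxiomProgram.Program.runStrata_exists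
      (V := AxiomProgram.stageVocab V) I P.eliminate (P.eliminate.initial s)
    have hm := AxiomProgram.Program.Extends.merge hE hN ht'
    refine ⟨t, t', fun e => ⟨fun he => hP.extends_unique he ht, fun he => he ▸ ht⟩,
      fun e => ⟨fun he => hE.extends_unique he ht', fun he => he ▸ ht'⟩,
      fun e => ⟨fun he => hN.merge_isStratified.extends_unique he hm, fun he => he ▸ hm⟩,
      fun p a => ?_⟩
    rw [← h.restrict_extends hP ht ht']
    rfl
  · obtain ⟨c, h⟩ := hP.eliminatedFrom
    refine ⟨by simpa using h.size_le, fun l S S' hS hS' => ?_⟩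
    obtain ⟨hl, rfl⟩ := List.getElem?_eq_some_iff.1 hS
    obtain ⟨hl', rfl⟩ := List.getElem?_eq_some_iff.1 hS'
    have hp := h.size_parts hl'
    rw [List.getD_eq_getElem _ _ hl] at hp
    exact ⟨hp.1, hp.2.trans (Nat.mul_le_mul_right _ (by norm_num))⟩
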